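/- **Setting.** A discrete quantum group $G$ is a multiplier Hopf $*$-algebra $(C_c(G),\Delta)$ whose underlying $*$-algebra is an algebraic direct sum $C_c(G)=\bigoplus_{i\in I}M_{n_i}(\mathbb C)$ of full matrix algebras ($n_i\ge 1$), with comultiplication $\Delta$, counit $\epsilon$ and antipode $S$, extended as usual to the multiplier algebra $\prod_i M_{n_i}(\mathbb C)$. Its completion $C_0(G)$ is the $C^*$-direct sum of the blocks. $G$ is *unimodular* if some faithful positive functional $\varphi$ on $C_c(G)$ is both left and right invariant, that is, $(\mathrm{id}\otimes\varphi)\Delta(f)=\varphi(f)1=(\varphi\otimes\mathrm{id})\Delta(f)$ for all $f\in C_c(G)$. A *unitary antipode* of $G$ is an involutive $*$-antiautomorphism $R$ of $\prod_i M_{n_i}(\mathbb C)$ such that $S(f)=R(FfF^{-1})$ for some family $F=(F_i)_i$ of positive definite matrices. Let $X$ be a set. A *quantum permutation* of $X$ on a Hilbert space $H$ is a family $(u_{xy})_{x,y\in X}$ of projections in $B(H)$ such that every row and every column consists of pairwise orthogonal projections with (strongly convergent) sum $1$. An *$X$-free wreath corepresentation* of $G$ on $H_\pi$ is a pair $\pi=(\pi^G,\pi^X)$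 of a family $\pi^G=(\pi^G_x)_{x\in X}$ of nondegenerate $*$-representations of $C_0(G)$ on $H_\pi$ and a quantum permutation $\pi^X=(\pi^X_{xy})$ of $X$ on $H_\pi$ with $\pi^G_x(f)\pi^X_{xy}=\pi^X_{xy}\pi^G_x(f)$ for all $x,y\in X$, $f\in C_0(G)$. An intertwiner $\pi\to\rho$ is a bounded operator $T:H_\pi\to H_\rho$ with $T\pi^G_x(f)=\rho^G_x(f)T$ and $T\pi^X_{xy}=\rho^X_{xy}T$ for all $x,y\in X$, $f\in C_0(G)$. The finite-dimensional $X$-free wreath corepresentations and their intertwiners form a monoidal category $\mathrm{Corep}(G)\wr_*\mathrm{Sym}^+(X)$: the tensor product lives on $H_\pi\otimes H_\rho$ and is given by $$(\pi\otimes\rho)^G_x(f)=\sum_{y\in X}(\pi^G_x\otimes\rho^G_y)\Delta(f)\,(\pi^X_{xy}\otimes 1),\qquad (\pi\otimes\rho)^X_{xy}=\sum_{z\in X}\pi^X_{xz}\otimes\rho^X_{zy},$$ the tensor unit is $\mathbb C$ with $f\mapsto\epsilon(f)$ for every $x\in X$ and the quantum permutation $(\delta_{xy})$, and the associativity and unit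 isomorphisms are those of Hilbert spaces. Given a unitary antipode $R$, the *contragredient* $\bar\pi$ of $\pi$ is the $X$-free wreath corepresentation on the conjugate Hilbert space $\overline{H_\pi}$ given by $$\bar\pi^G_x(f)\bar\xi=\sum_{y\in X}\overline{\pi^G_y(R(f^*))\,\pi^X_{yx}\,\xi},\qquad \bar\pi^X_{xy}\bar\xi=\overline{\pi^X_{yx}\xi}.$$ **Statement.** Let $G$ be a unimodular discrete quantum group and let $X$ be a set. Then: 1. $G$ has exactly one unitary antipode $R$, so that the contragredient $\bar\pi$ is well defined. 2. Every finite-dimensional $X$-free wreath corepresentation $\pi$ of $G$ is dualisable with dual $\bar\pi$: there are intertwiners $ev_\pi:\bar\pi\otimes\pi\to 1$, $db_\pi:1\to\pi\otimes\bar\pi$ satisfying the zig-zag equations $$(\mathrm{id}_\pi\otimes ev_\pi)(db_\pi\otimes\mathrm{id}_\pi)=\mathrm{id}_\pi,\qquad (ev_\pi\otimes\mathrm{id}_{\bar\pi})(\mathrm{id}_{\bar\pi}\otimes db_\pi)=\mathrm{id}_{\bar\pi},$$ and intertwiners $ev_{\bar\pi}:\pi\otimes\bar\pi\to 1$, $db_{\bar\pi}:1\to\bar\pi\otimes\pi$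 satisfying the same equations with the roles of $\pi$ and $\bar\pi$ exchanged. 3. Consequently the monoidal category $\mathrm{Corep}(G)\wr_*\mathrm{Sym}^+(X)$ is rigid: every object has a left dual and a right dual. -/

import Mathlib

noncomputable section

open scoped TensorProduct ENNReal ComplexOrder

/-! ## Partitions of unity and gluing -/

section Glue

/-- A finite partition of unity in a ring: pairwise orthogonal elements, all but finitely many of
them zero, with sum one. -/
def IsPOU {ι B : Type*} [Ring B] (P : ι → B) : Prop :=
  (∀ i j, i ≠ j → P i * P j = 0) ∧ ∃ s : Finset ι, (∀ i, i ∉ s → P i = 0) ∧ ∑ i ∈ s, P i = 1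

namespace IsPOU

variable {ι B : Type*} [Ring B] {P : ι → B}

theorem idem (h : IsPOU P) (i : ι) : P i * P i = P i := by
  classical
  obtain ⟨h1, s, hs, hsum⟩ := h
  by_cases hi : i ∈ s
  · have : P i * ∑ j ∈ s, P j = P i * P i := by
      rw [Finset.mul_sum]
      exact Finset.sum_eq_single_of_mem i hi (fun j _ hj => h1 i j (Ne.symm hj))
    rw [← this, hsum, mul_one]
  · simp [hs i hi]

theorem ext_right (h : IsPOU P) {a b : B} (hab : ∀ i, a * P i = b * P i) : a = b := by
  obtain ⟨-, s, -, hsum⟩ := h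
  rw [← mul_one a, ← mul_one b, ← hsum, Finset.mul_sum, Finset.mul_sum]
  exact Finset.sum_congr rfl fun i _ => hab i

end IsPOU

variable {ι B : Type*} {R : ι → Type*} [∀ i, Ring (R i)] [∀ i, StarRing (R i)]
  [∀ i, Algebra ℂ (R i)] [Ring B] [StarRing B] [Algebra ℂ B]

/-- The sum of a family of star homomorphisms whose units form a partition of unity. -/
def glueFun (τ : ∀ i, R i →⋆ₙₐ[ℂ] B) (m : ∀ i, R i) : B := ∑ᶠ i, τ i (m i)

variable {τ : ∀ i, R i →⋆ₙₐ[ℂ] B}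

theorem tau_one_mul (i : ι) (a : R i) : τ i 1 * τ i a = τ i a := by
  rw [← map_mul, one_mul]

theorem tau_mul_one (i : ι) (a : R i) : τ i a * τ i 1 = τ i a := by
  rw [← map_mul, mul_one]

theorem tau_mul_ne (h : IsPOU fun i => τ i 1) {i j : ι} (hij : i ≠ j) (a : R i) (b : R j) :
    τ i a * τ j b = 0 := by
  rw [← tau_mul_one i a, ← tau_one_mul j b, mul_assoc, ← mul_assoc (τ i 1), h.1 i j hij]
  simp

theorem glueFun_eq_sum (m : ∀ i, R i) {s : Finset ι} (hs : ∀ i, i ∉ s → τ i 1 = 0) :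
    glueFun τ m = ∑ i ∈ s, τ i (m i) := by
  refine finsum_eq_sum_of_support_subset _ fun i hi => ?_
  by_contra his
  apply hi
  have h0 : τ i (m i) = 0 := by rw [← tau_one_mul, hs i his, zero_mul]
  exact h0

theorem glueFun_mul_tau (h : IsPOU fun i => τ i 1) (m : ∀ i, R i) (i : ι) :
    glueFun τ m * τ i 1 = τ i (m i) := by
  classical
  obtain ⟨s, hs, -⟩ := h.2
  rw [glueFun_eq_sum m (s := insert i s) (fun j hj => hs j fun h' => hj (by simp [h'])),
    Finset.sum_mul, Finset.sum_eq_single_of_mem i (Finset.mem_insert_self _ _)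
      (fun j _ hj => tau_mul_ne h hj _ _), tau_mul_one]

/-- `glueFun` as a unital star homomorphism on the product. -/
def glue (τ : ∀ i, R i →⋆ₙₐ[ℂ] B) (h : IsPOU fun i => τ i 1) : (∀ i, R i) →⋆ₐ[ℂ] B where
  toFun := glueFun τ
  map_one' := by
    obtain ⟨s, hs, hsum⟩ := h.2
    rw [glueFun_eq_sum _ hs]
    simpa using hsum
  map_mul' a b := by
    refine h.ext_right fun i => ?_
    rw [glueFun_mul_tau h, mul_assoc, glueFun_mul_tau h]
    obtain ⟨s, hs, hsum⟩ := h.2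
    rw [← tau_one_mul i (b i), ← mul_assoc, glueFun_mul_tau h, Pi.mul_apply, map_mul]
  map_zero' := by simp [glueFun]
  map_add' a b := by
    refine h.ext_right fun i => ?_
    rw [glueFun_mul_tau h, add_mul, glueFun_mul_tau h, glueFun_mul_tau h, Pi.add_apply, map_add]
  commutes' c := by
    refine h.ext_right fun i => ?_
    rw [glueFun_mul_tau h]
    simp [Algebra.algebraMap_eq_smul_one]
  map_star' a := by
    obtain ⟨s, hs, -⟩ := h.2
    rw [glueFun_eq_sum _ hs, glueFun_eq_sum _ hs]
    simp [map_star]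

theorem glue_apply (h : IsPOU fun i => τ i 1) (m : ∀ i, R i) :
    glue τ h m = ∑ᶠ i, τ i (m i) := rfl

theorem glue_eq_sum (h : IsPOU fun i => τ i 1) (m : ∀ i, R i) {s : Finset ι}
    (hs : ∀ i, i ∉ s → τ i 1 = 0) : glue τ h m = ∑ i ∈ s, τ i (m i) := glueFun_eq_sum m hs

theorem glue_mul_tau (h : IsPOU fun i => τ i 1) (m : ∀ i, R i) (i : ι) :
    glue τ h m * τ i 1 = τ i (m i) := glueFun_mul_tau h m i

theorem tau_mul_glue (h : IsPOU fun i => τ i 1) (m : ∀ i, R i) (i : ι) :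
    τ i 1 * glue τ h m = τ i (m i) := by
  have := congrArg star (glue_mul_tau h (star m) i)
  rw [star_mul, ← map_star, ← map_star, ← map_star] at this
  simpa using this

theorem glue_dependsOn (h : IsPOU fun i => τ i 1) :
    ∃ s : Finset ι, DependsOn (glue τ h) (s : Set ι) := by
  obtain ⟨s, hs, -⟩ := h.2
  refine ⟨s, fun x y hxy => ?_⟩
  rw [glue_eq_sum h x hs, glue_eq_sum h y hs]
  exact Finset.sum_congr rfl fun i hi => by rw [hxy i hi]

end Glue

section FiniteDimensional

/-- In a finite dimensional algebra, only finitely many members of a family of pairwise orthogonal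
idempotents are nonzero. -/
theorem finite_support_of_orthogonal {ι B : Type*} [Ring B] [Algebra ℂ B] [FiniteDimensional ℂ B]
    (P : ι → B) (hP : ∀ i, P i * P i = P i) (hne : ∀ i j, i ≠ j → P i * P j = 0) :
    {i | P i ≠ 0}.Finite := by
  classical
  have hli : LinearIndependent ℂ (fun i : {i | P i ≠ 0} => P i) := by
    rw [linearIndependent_iff']
    intro s g hg i hi
    have h1 : P i * ∑ j ∈ s, g j • P j = g i • P i := by
      rw [Finset.mul_sum, Finset.sum_eq_single_of_mem i hi]
      · rw [mul_smul_comm, hP]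
      · intro j _ hj
        rw [mul_smul_comm, hne _ _ (fun h => hj (Subtype.ext h.symm)), smul_zero]
    rw [hg, mul_zero] at h1
    exact (smul_eq_zero.mp h1.symm).resolve_right i.2
  have : Finite {i | P i ≠ 0} := hli.finite
  exact Set.toFinite _

end FiniteDimensional

section Blocks

open scoped Matrix.Norms.L2Operator

/-- The full matrix block with index `i`, a C*-algebra in the operator norm. -/
abbrev MatBlock {I : Type*} (d : I → ℕ) (i : I) : Type := Matrix (Fin (d i)) (Fin (d i)) ℂ

/-- The full product of the matrix blocks: the multiplier algebra of their algebraic direct sum. -/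
abbrev MatFun {I : Type*} (d : I → ℕ) : Type _ := ∀ i, MatBlock d i

/-- The product of the algebras `M_{d i} ⊗ M_{d j}`: the multiplier algebra of the tensor square of
the algebraic direct sum of the blocks. -/
abbrev MatFun₂ {I : Type*} (d : I → ℕ) : Type _ :=
  ∀ p : I × I, MatBlock d p.1 ⊗[ℂ] MatBlock d p.2

open scoped Classical in
/-- The inclusion of a block in the product of all blocks. -/
def blockIncl {I : Type*} (d : I → ℕ) (i : I) : MatBlock d i →ₗ[ℂ] MatFun d :=
  LinearMap.single ℂ (MatBlock d) i

open scoped Classical in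
/-- The inclusion of a block, as a star homomorphism. -/
def blockHom {I : Type*} (d : I → ℕ) (i : I) : MatBlock d i →⋆ₙₐ[ℂ] MatFun d where
  toFun := blockIncl d i
  map_smul' c a := map_smul _ c a
  map_zero' := map_zero _
  map_add' := map_add _
  map_mul' a b := by
    simp only [blockIncl, LinearMap.coe_single]
    exact Pi.single_mul i a b
  map_star' a := by
    simp only [blockIncl, LinearMap.coe_single]
    exact Pi.single_star i a

theorem blockHom_apply {I : Type*} (d : I → ℕ) (i : I) (a : MatBlock d i) :
    blockHom d i a = blockIncl d i a := rfl

/-- The algebraic direct sum of the blocks, inside their bounded product. -/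
def finSuppBlocks {I : Type*} (d : I → ℕ) : NonUnitalStarSubalgebra ℂ (lp (MatBlock d) ∞) where
  carrier := {f | {i | f i ≠ 0}.Finite}
  add_mem' {f g} hf hg := (hf.union hg).subset fun i hi => by
    by_contra h
    simp only [Set.mem_union, Set.mem_ofPred_eq, not_or, not_not] at h
    exact hi (by simp [h.1, h.2])
  zero_mem' := by simp
  mul_mem' {f g} hf hg := hf.subset fun i hi h => hi (by
    change f i * g i = 0
    rw [h, zero_mul])
  smul_mem' c f hf := hf.subset fun i hi h => hi (by simp [h])
  star_mem' {f} hf := hf.subset fun i hi h => hi (by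
    change star (f i) = 0
    rw [h, star_zero])

/-- The C*-direct sum of the blocks: the norm closure of the algebraic direct sum inside the bounded
product. -/
abbrev c0Blocks {I : Type*} (d : I → ℕ) : NonUnitalStarSubalgebra ℂ (lp (MatBlock d) ∞) :=
  (finSuppBlocks d).topologicalClosure

instance {I : Type*} (d : I → ℕ) : IsClosed (c0Blocks d : Set (lp (MatBlock d) ∞)) :=
  NonUnitalStarSubalgebra.isClosed_topologicalClosure _

instance {I : Type*} (d : I → ℕ) : NonUnitalRing (c0Blocks d) := inferInstance

instance {I : Type*} (d : I → ℕ) : NonUnitalSemiring (c0Blocks d) := inferInstance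

instance {I : Type*} (d : I → ℕ) : NonUnitalNonAssocSemiring (c0Blocks d) := inferInstance

instance {I : Type*} (d : I → ℕ) : AddCommMonoid (c0Blocks d) := inferInstance

instance {I : Type*} (d : I → ℕ) : Mul (c0Blocks d) := inferInstance

/-- An element of the C*-direct sum, as a family of matrices. -/
def c0ToFun {I : Type*} (d : I → ℕ) : c0Blocks d →⋆ₙₐ[ℂ] MatFun d where
  toFun f := fun i => (f : lp (MatBlock d) ∞) i
  map_smul' _ _ := rfl
  map_zero' := rfl
  map_add' _ _ := rfl
  map_mul' _ _ := rfl
  map_star' _ := rfl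

open scoped Classical in
/-- The inclusion of a block in the C*-direct sum. -/
def blockC0 {I : Type*} (d : I → ℕ) (i : I) : MatBlock d i →⋆ₙₐ[ℂ] c0Blocks d where
  toFun a := ⟨lp.single ∞ i a, NonUnitalStarSubalgebra.le_topologicalClosure _ (by
    refine (Set.finite_singleton i).subset fun j hj => ?_
    by_contra h
    exact hj (lp.single_apply_ne ∞ i a h))⟩
  map_smul' c a := by
    ext1; exact lp.single_smul ∞ i c a
  map_zero' := by
    ext1; exact map_zero (lp.singleAddMonoidHom ∞ i)
  map_add' a b := by
    ext1; exact lp.single_add ∞ i a b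
  map_mul' a b := by
    ext1; ext1
    exact Pi.single_mul i a b
  map_star' a := by
    ext1; ext1
    exact Pi.single_star i a

theorem c0ToFun_blockC0 {I : Type*} (d : I → ℕ) (i : I) (a : MatBlock d i) :
    c0ToFun d (blockC0 d i a) = blockIncl d i a := rfl

end Blocks

section QuantumGroup

universe u v

/-- A discrete quantum group, as a multiplier Hopf *-algebra `(A, Δ)` whose underlying *-algebra
`A = ⨁ i, M_{dim i}(ℂ)` is an algebraic direct sum of full matrix algebras.

All structure maps are given by their unital extensions to the multiplier algebras
`M(A) = ∏ i, M_{dim i}(ℂ)` and `M(A ⊗ A) = ∏ (i, j), M_{dim i}(ℂ) ⊗ M_{dim j}(ℂ)`. The extension of a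
nondegenerate map on `A` is characterised by the fact that each matrix block of its value depends on
finitely many blocks of the argument only; this is the content of the `_dependsOn` fields. For the
same reason all sums over blocks below are finite. -/
structure DiscreteQuantumGroup where
  /-- The set of matrix blocks, i.e. of classes of irreducible corepresentations. -/
  Irr : Type u
  /-- The sizes of the blocks. -/
  dim : Irr → ℕ
  dim_pos : ∀ i, 0 < dim i
  /-- The comultiplication `M(A) → M(A ⊗ A)`. -/
  comul : MatFun dim →⋆ₐ[ℂ] MatFun₂ dim
  comul_dependsOn : ∀ p, ∃ s : Finset Irr, DependsOn (fun f => comul f p) (s : Set Irr)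
  /-- `Δ(A)(1 ⊗ A)` is contained in `A ⊗ A`. -/
  comul_finite_left : ∀ l j, {i | comul (blockIncl dim l 1) (i, j) ≠ 0}.Finite
  /-- `(A ⊗ 1)Δ(A)` is contained in `A ⊗ A`. -/
  comul_finite_right : ∀ l i, {j | comul (blockIncl dim l 1) (i, j) ≠ 0}.Finite
  /-- `(Δ ⊗ id)Δ = (id ⊗ Δ)Δ`. -/
  coassoc : ∀ f i j k,
    TensorProduct.assoc ℂ (MatBlock dim i) (MatBlock dim j) (MatBlock dim k)
      (∑ᶠ l, ((LinearMap.proj (i, j) ∘ₗ comul.toAlgHom.toLinearMap ∘ₗ blockIncl dim l).rTensor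
        (MatBlock dim k)) (comul f (l, k))) =
    ∑ᶠ l, ((LinearMap.proj (j, k) ∘ₗ comul.toAlgHom.toLinearMap ∘ₗ blockIncl dim l).lTensor
        (MatBlock dim i)) (comul f (i, l))
  /-- The counit. -/
  counit : MatFun dim →⋆ₐ[ℂ] ℂ
  counit_dependsOn : ∃ s : Finset Irr, DependsOn counit (s : Set Irr)
  /-- `(ε ⊗ id)Δ = id`. -/
  counit_left : ∀ f j,
    ∑ᶠ i, TensorProduct.lid ℂ (MatBlock dim j)
      (((counit.toAlgHom.toLinearMap ∘ₗ blockIncl dim i).rTensor (MatBlock dim j))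
        (comul f (i, j))) = f j
  /-- `(id ⊗ ε)Δ = id`. -/
  counit_right : ∀ f i,
    ∑ᶠ j, TensorProduct.rid ℂ (MatBlock dim i)
      (((counit.toAlgHom.toLinearMap ∘ₗ blockIncl dim j).lTensor (MatBlock dim i))
        (comul f (i, j))) = f i
  /-- The antipode. -/
  antipode : MatFun dim →ₗ[ℂ] MatFun dim
  antipode_dependsOn : ∀ k, ∃ s : Finset Irr, DependsOn (fun f => antipode f k) (s : Set Irr)
  antipode_mul : ∀ f g, antipode (f * g) = antipode g * antipode f
  /-- `m(S ⊗ id)Δ(f) = ε(f)1`. -/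
  antipode_left : ∀ f k,
    ∑ᶠ i, LinearMap.mul' ℂ (MatBlock dim k)
      (((LinearMap.proj k ∘ₗ antipode ∘ₗ blockIncl dim i).rTensor (MatBlock dim k))
        (comul f (i, k))) = counit f • 1
  /-- `m(id ⊗ S)Δ(f) = ε(f)1`. -/
  antipode_right : ∀ f k,
    ∑ᶠ j, LinearMap.mul' ℂ (MatBlock dim k)
      (((LinearMap.proj k ∘ₗ antipode ∘ₗ blockIncl dim j).lTensor (MatBlock dim k))
        (comul f (k, j))) = counit f • 1

namespace DiscreteQuantumGroup

variable (G : DiscreteQuantumGroup.{u})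

/-- The matrix block of `G` with index `i`. -/
abbrev Block (i : G.Irr) : Type := MatBlock G.dim i

/-- The algebra of all (not necessarily bounded) functions on `G`. -/
abbrev Fun : Type u := MatFun G.dim

/-- The C*-algebra `C_0(G)` of functions on `G` vanishing at infinity. -/
abbrev C0 : Type u := c0Blocks G.dim

/-- A left Haar weight on `G`, given by its restrictions `φ i` to the matrix blocks: a faithful
positive functional `φ` on the algebra of finitely supported functions such that
`(id ⊗ φ)Δ(a) = φ(a)1` for all finitely supported `a`. -/
structure IsLeftHaar (φ : ∀ i, G.Block i →ₗ[ℂ] ℂ) : Prop where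
  nonneg : ∀ i (a : G.Block i), 0 ≤ φ i (star a * a)
  faithful : ∀ i (a : G.Block i), φ i (star a * a) = 0 → a = 0
  left_invariant : ∀ l (a : G.Block l) i,
    ∑ᶠ j, TensorProduct.rid ℂ (G.Block i)
      ((φ j).lTensor (G.Block i) (G.comul (blockIncl G.dim l a) (i, j))) = φ l a • 1

/-- A right Haar weight on `G`: a faithful positive functional `φ` on the algebra of finitely
supported functions such that `(φ ⊗ id)Δ(a) = φ(a)1` for all finitely supported `a`. -/
structure IsRightHaar (φ : ∀ i, G.Block i →ₗ[ℂ] ℂ) : Prop where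
  nonneg : ∀ i (a : G.Block i), 0 ≤ φ i (star a * a)
  faithful : ∀ i (a : G.Block i), φ i (star a * a) = 0 → a = 0
  right_invariant : ∀ l (a : G.Block l) j,
    ∑ᶠ i, TensorProduct.lid ℂ (G.Block j)
      ((φ i).rTensor (G.Block j) (G.comul (blockIncl G.dim l a) (i, j))) = φ l a • 1

/-- `G` is unimodular if its left and right Haar weights agree. -/
def IsUnimodular : Prop :=
  ∃ φ : ∀ i, G.Block i →ₗ[ℂ] ℂ, G.IsLeftHaar φ ∧ G.IsRightHaar φ

/-- The unitary antipode `R` is the involutive *-antiautomorphism in the polar decomposition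
`S = R τ` of the antipode, where `τ = τ_{-i/2}` is the analytic generator of the scaling group.
On a discrete quantum group, `τ` is conjugation by a positive invertible element of each block. -/
structure IsUnitaryAntipode (R : G.Fun →ₗ[ℂ] G.Fun) : Prop where
  map_mul : ∀ f g, R (f * g) = R g * R f
  map_star : ∀ f, R (star f) = star (R f)
  involutive : ∀ f, R (R f) = f
  polar : ∃ F : G.Fun, (∀ i, (F i).PosDef) ∧ ∀ f, G.antipode f = R (F * f * F⁻¹)

variable {G}

theorem IsUnitaryAntipode.map_one {R : G.Fun →ₗ[ℂ] G.Fun} (hR : G.IsUnitaryAntipode R) :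
    R 1 = 1 := by
  have h := hR.map_mul (R 1) 1
  rwa [mul_one, hR.involutive, mul_one, eq_comm] at h

end DiscreteQuantumGroup

end QuantumGroup

section Operators

open TensorProduct

variable {H H' H'' K K' K'' L M : Type*}
  [NormedAddCommGroup H] [InnerProductSpace ℂ H] [NormedAddCommGroup H'] [InnerProductSpace ℂ H']
  [NormedAddCommGroup H''] [InnerProductSpace ℂ H'']
  [NormedAddCommGroup K] [InnerProductSpace ℂ K] [NormedAddCommGroup K'] [InnerProductSpace ℂ K']
  [NormedAddCommGroup K''] [InnerProductSpace ℂ K'']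
  [NormedAddCommGroup L] [InnerProductSpace ℂ L] [NormedAddCommGroup M] [InnerProductSpace ℂ M]

/-- The tensor product of (finite dimensional) Hilbert spaces: Mathlib's tensor product with its
inner product. -/
def HTensor (H K : Type*) [NormedAddCommGroup H] [InnerProductSpace ℂ H]
    [NormedAddCommGroup K] [InnerProductSpace ℂ K] : Type _ := H ⊗[ℂ] K

namespace HTensor

instance : NormedAddCommGroup (HTensor H K) := inferInstanceAs (NormedAddCommGroup (H ⊗[ℂ] K))

instance : InnerProductSpace ℂ (HTensor H K) := inferInstanceAs (InnerProductSpace ℂ (H ⊗[ℂ] K))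

instance [FiniteDimensional ℂ H] [FiniteDimensional ℂ K] : FiniteDimensional ℂ (HTensor H K) :=
  inferInstanceAs (Module.Finite ℂ (H ⊗[ℂ] K))

instance [FiniteDimensional ℂ H] [FiniteDimensional ℂ K] : CompleteSpace (HTensor H K) :=
  FiniteDimensional.complete ℂ _

/-- The elementary tensor `a ⊗ b`. -/
def tmul (a : H) (b : K) : HTensor H K := a ⊗ₜ[ℂ] b

/-- The operator `S ⊗ T`. -/
def map (S : H →L[ℂ] H') (T : K →L[ℂ] K') : HTensor H K →L[ℂ] HTensor H' K' :=
  TensorProduct.mapL S T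

@[simp]
theorem map_tmul (S : H →L[ℂ] H') (T : K →L[ℂ] K') (a : H) (b : K) :
    map S T (tmul a b) = tmul (S a) (T b) := rfl

theorem ext {S T : HTensor H K →L[ℂ] M} (h : ∀ a b, S (tmul a b) = T (tmul a b)) : S = T := by
  ext x
  change H ⊗[ℂ] K at x
  induction x using TensorProduct.induction_on with
  | zero => exact (map_zero S).trans (map_zero T).symm
  | tmul a b => exact h a b
  | add x y hx hy => exact (map_add S x y).trans ((congrArg₂ _ hx hy).trans (map_add T x y).symm)

theorem map_comp (S' : H' →L[ℂ] H'') (T' : K' →L[ℂ] K'') (S : H →L[ℂ] H') (T : K →L[ℂ] K') :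
    map (S' ∘L S) (T' ∘L T) = map S' T' ∘L map S T := ext fun _ _ => rfl

theorem map_mul (S' S : H →L[ℂ] H) (T' T : K →L[ℂ] K) :
    map (S' * S) (T' * T) = map S' T' * map S T := ext fun _ _ => rfl

theorem map_one : map (1 : H →L[ℂ] H) (1 : K →L[ℂ] K) = 1 := ext fun _ _ => rfl

theorem map_id : map (.id ℂ H) (.id ℂ K) = .id ℂ (HTensor H K) := ext fun _ _ => rfl

theorem map_zero_left (T : K →L[ℂ] K') : map (0 : H →L[ℂ] H') T = 0 :=
  TensorProduct.mapL_zero_left T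

theorem map_zero_right (S : H →L[ℂ] H') : map S (0 : K →L[ℂ] K') = 0 :=
  TensorProduct.mapL_zero_right S

theorem star_map [FiniteDimensional ℂ H] [FiniteDimensional ℂ K] [CompleteSpace H] [CompleteSpace K]
    (S : H →L[ℂ] H) (T : K →L[ℂ] K) : star (map S T) = map (star S) (star T) := by
  have : CompleteSpace (H ⊗[ℂ] K) := FiniteDimensional.complete ℂ _
  exact TensorProduct.adjoint_mapL S T

/-- The bilinear map `(S, T) ↦ S ⊗ T` on operators. -/
def mapBilin (H K : Type*) [NormedAddCommGroup H] [InnerProductSpace ℂ H]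
    [NormedAddCommGroup K] [InnerProductSpace ℂ K] :
    (H →L[ℂ] H) →ₗ[ℂ] (K →L[ℂ] K) →ₗ[ℂ] (HTensor H K →L[ℂ] HTensor H K) :=
  LinearMap.mk₂ ℂ map mapL_add_left mapL_smul_left mapL_add_right mapL_smul_right

theorem mapBilin_apply (S : H →L[ℂ] H) (T : K →L[ℂ] K) : mapBilin H K S T = map S T := rfl

theorem sum_map {ι : Type*} (s : Finset ι) (S : ι → H →L[ℂ] H) (T : K →L[ℂ] K) :
    map (∑ i ∈ s, S i) T = ∑ i ∈ s, map (S i) T :=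
  map_sum ((mapBilin H K).flip T) S s

theorem map_sum' {ι : Type*} (s : Finset ι) (S : H →L[ℂ] H) (T : ι → K →L[ℂ] K) :
    map S (∑ i ∈ s, T i) = ∑ i ∈ s, map S (T i) :=
  map_sum (mapBilin H K S) T s

/-- The associativity isomorphism. -/
def assoc (H K L : Type*) [NormedAddCommGroup H] [InnerProductSpace ℂ H]
    [NormedAddCommGroup K] [InnerProductSpace ℂ K] [NormedAddCommGroup L] [InnerProductSpace ℂ L] :
    HTensor (HTensor H K) L ≃ₗᵢ[ℂ] HTensor H (HTensor K L) :=
  TensorProduct.assocIsometry ℂ H K L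

@[simp]
theorem assoc_tmul (a : H) (b : K) (c : L) :
    assoc H K L (tmul (tmul a b) c) = tmul a (tmul b c) := rfl

@[simp]
theorem assoc_symm_tmul (a : H) (b : K) (c : L) :
    (assoc H K L).symm (tmul a (tmul b c)) = tmul (tmul a b) c := rfl

/-- The left unit isomorphism. -/
def lid (H : Type*) [NormedAddCommGroup H] [InnerProductSpace ℂ H] : HTensor ℂ H ≃ₗᵢ[ℂ] H :=
  TensorProduct.lidIsometry ℂ H

@[simp]
theorem lid_tmul (c : ℂ) (a : H) : lid H (tmul c a) = c • a := rfl

@[simp]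
theorem lid_symm_apply (a : H) : (lid H).symm a = tmul 1 a := rfl

/-- The right unit isomorphism. -/
def rid (H : Type*) [NormedAddCommGroup H] [InnerProductSpace ℂ H] : HTensor H ℂ ≃ₗᵢ[ℂ] H :=
  TensorProduct.ridIsometry ℂ H

@[simp]
theorem rid_tmul (c : ℂ) (a : H) : rid H (tmul a c) = c • a := rfl

@[simp]
theorem rid_symm_apply (a : H) : (rid H).symm a = tmul a 1 := rfl

theorem tmul_smul' (c : ℂ) (a : H) (b : K) : tmul a (c • b) = tmul (c • a) b :=
  (TensorProduct.smul_tmul c a b).symm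

theorem lid_naturality (T : H →L[ℂ] H') : (lid H' : HTensor ℂ H' →L[ℂ] H') ∘L map (.id ℂ ℂ) T =
    T ∘L (lid H : HTensor ℂ H →L[ℂ] H) := ext fun c ξ => (map_smul T c ξ).symm

theorem rid_naturality (T : H →L[ℂ] H') : (rid H' : HTensor H' ℂ →L[ℂ] H') ∘L map T (.id ℂ ℂ) =
    T ∘L (rid H : HTensor H ℂ →L[ℂ] H) := ext fun ξ c => (map_smul T c ξ).symm

theorem ext₃ {S T : HTensor (HTensor H K) L →L[ℂ] M}
    (h : ∀ a b c, S (tmul (tmul a b) c) = T (tmul (tmul a b) c)) : S = T := by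
  refine ext fun x c => ?_
  change H ⊗[ℂ] K at x
  induction x using TensorProduct.induction_on with
  | zero =>
    have h0 : tmul (0 : HTensor H K) c = 0 := TensorProduct.zero_tmul _ c
    exact (congrArg S h0).trans ((map_zero S).trans
      ((map_zero T).symm.trans (congrArg T h0.symm)))
  | tmul a b => exact h a b c
  | add x y hx hy =>
    have h0 : tmul (x + y : HTensor H K) c = tmul x c + tmul y c := TensorProduct.add_tmul x y c
    exact (congrArg S h0).trans ((map_add S _ _).trans ((congrArg₂ _ hx hy).trans
      ((map_add T _ _).symm.trans (congrArg T h0.symm))))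

theorem ext₄ {S T : HTensor (HTensor (HTensor H K) L) H' →L[ℂ] M}
    (h : ∀ a b c d, S (tmul (tmul (tmul a b) c) d) = T (tmul (tmul (tmul a b) c) d)) : S = T := by
  refine ext₃ fun x c d => ?_
  change H ⊗[ℂ] K at x
  induction x using TensorProduct.induction_on with
  | zero =>
    have h0 : tmul (tmul (0 : HTensor H K) c) d = 0 :=
      (congrArg (fun y : HTensor (HTensor H K) L => tmul y d) (TensorProduct.zero_tmul _ c)).trans
        (TensorProduct.zero_tmul _ d)
    exact (congrArg S h0).trans ((map_zero S).trans
      ((map_zero T).symm.trans (congrArg T h0.symm)))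
  | tmul a b => exact h a b c d
  | add x y hx hy =>
    have h0 : tmul (tmul (x + y : HTensor H K) c) d = tmul (tmul x c) d + tmul (tmul y c) d :=
      (congrArg (fun y : HTensor (HTensor H K) L => tmul y d) (TensorProduct.add_tmul x y c)).trans
        (TensorProduct.add_tmul _ _ d)
    exact (congrArg S h0).trans ((map_add S _ _).trans ((congrArg₂ _ hx hy).trans
      ((map_add T _ _).symm.trans (congrArg T h0.symm))))

section Star

variable [FiniteDimensional ℂ H] [FiniteDimensional ℂ K] [CompleteSpace H] [CompleteSpace K]

/-- The star homomorphism `a ⊗ b ↦ α a ⊗ β b`. -/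
def pairHom {R R' : Type*} [Ring R] [StarRing R] [Algebra ℂ R] [StarModule ℂ R]
    [Ring R'] [StarRing R'] [Algebra ℂ R'] [StarModule ℂ R']
    (α : R →⋆ₙₐ[ℂ] (H →L[ℂ] H)) (β : R' →⋆ₙₐ[ℂ] (K →L[ℂ] K)) :
    R ⊗[ℂ] R' →⋆ₙₐ[ℂ] (HTensor H K →L[ℂ] HTensor H K) where
  toFun := TensorProduct.lift ((mapBilin H K).compl₁₂ (α : R →ₗ[ℂ] _) (β : R' →ₗ[ℂ] _))
  map_smul' c m := map_smul _ c m
  map_zero' := map_zero _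
  map_add' := map_add _
  map_mul' m n := by
    induction m using TensorProduct.induction_on with
    | zero => simp
    | add m m' h h' => simp only [add_mul, map_add, h, h']
    | tmul a b =>
      induction n using TensorProduct.induction_on with
      | zero => simp
      | add n n' h h' => simp only [mul_add, map_add, h, h']
      | tmul c d => simp [mapBilin_apply, map_mul]
  map_star' m := by
    induction m using TensorProduct.induction_on with
    | zero => simp
    | add m m' h h' => simp only [star_add, map_add, h, h']
    | tmul a b => simp [mapBilin_apply, star_map, map_star]

@[simp]
theorem pairHom_tmul {R R' : Type*} [Ring R] [StarRing R] [Algebra ℂ R] [StarModule ℂ R]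
    [Ring R'] [StarRing R'] [Algebra ℂ R'] [StarModule ℂ R']
    (α : R →⋆ₙₐ[ℂ] (H →L[ℂ] H)) (β : R' →⋆ₙₐ[ℂ] (K →L[ℂ] K)) (a : R) (b : R') :
    pairHom α β (a ⊗ₜ b) = map (α a) (β b) := rfl

end Star

end HTensor

theorem IsPOU.map_left {ι : Type*} {P : ι → H →L[ℂ] H} (hP : IsPOU P) :
    IsPOU fun i => HTensor.map (P i) (1 : K →L[ℂ] K) := by
  refine ⟨fun i j hij => ?_, ?_⟩
  · rw [← HTensor.map_mul, hP.1 i j hij, HTensor.map_zero_left]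
  · obtain ⟨s, hs, hsum⟩ := hP.2
    refine ⟨s, fun i hi => by simp only [hs i hi, HTensor.map_zero_left], ?_⟩
    rw [← HTensor.map_one, ← hsum, HTensor.sum_map]

theorem IsPOU.map_right {ι : Type*} {P : ι → K →L[ℂ] K} (hP : IsPOU P) :
    IsPOU fun i => HTensor.map (1 : H →L[ℂ] H) (P i) := by
  refine ⟨fun i j hij => ?_, ?_⟩
  · rw [← HTensor.map_mul, hP.1 i j hij, HTensor.map_zero_right]
  · obtain ⟨s, hs, hsum⟩ := hP.2
    refine ⟨s, fun i hi => by simp only [hs i hi, HTensor.map_zero_right], ?_⟩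
    rw [← HTensor.map_one, ← hsum, HTensor.map_sum']

theorem IsPOU.map_prod {ι κ : Type*} {P : ι → H →L[ℂ] H} {Q : κ → K →L[ℂ] K} (hP : IsPOU P)
    (hQ : IsPOU Q) : IsPOU fun p : ι × κ => HTensor.map (P p.1) (Q p.2) := by
  refine ⟨fun p q hpq => ?_, ?_⟩
  · rw [← HTensor.map_mul]
    by_cases h : p.1 = q.1
    · rw [hQ.1 p.2 q.2 (fun h' => hpq (Prod.ext h h')), HTensor.map_zero_right]
    · rw [hP.1 _ _ h, HTensor.map_zero_left]
  · obtain ⟨s, hs, hsum⟩ := hP.2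
    obtain ⟨t, ht, htsum⟩ := hQ.2
    refine ⟨s ×ˢ t, fun p hp => ?_, ?_⟩
    · rw [Finset.mem_product, not_and_or] at hp
      rcases hp with hp | hp
      · simp only [hs _ hp, HTensor.map_zero_left]
      · simp only [ht _ hp, HTensor.map_zero_right]
    · rw [← HTensor.map_one, ← hsum, ← htsum, Finset.sum_product, HTensor.sum_map]
      refine Finset.sum_congr rfl fun i _ => ?_
      rw [HTensor.map_sum']

end Operators

section NormalRep

open TensorProduct

universe u

variable {G : DiscreteQuantumGroup.{u}}
variable {H H' K K' L : Type*}
  [NormedAddCommGroup H] [InnerProductSpace ℂ H] [FiniteDimensional ℂ H] [CompleteSpace H]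
  [NormedAddCommGroup H'] [InnerProductSpace ℂ H'] [FiniteDimensional ℂ H'] [CompleteSpace H']
  [NormedAddCommGroup K] [InnerProductSpace ℂ K] [FiniteDimensional ℂ K] [CompleteSpace K]
  [NormedAddCommGroup K'] [InnerProductSpace ℂ K'] [FiniteDimensional ℂ K'] [CompleteSpace K']
  [NormedAddCommGroup L] [InnerProductSpace ℂ L] [FiniteDimensional ℂ L] [CompleteSpace L]

/-- A *-representation of all functions on `G` on a finite dimensional Hilbert space that depends
on finitely many matrix blocks only. These are the unital extensions of the nondegenerate
*-representations of `C_0(G)`. -/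
structure NormalRep (G : DiscreteQuantumGroup.{u}) (H : Type*) [NormedAddCommGroup H]
    [InnerProductSpace ℂ H] [CompleteSpace H] where
  hom : G.Fun →⋆ₐ[ℂ] (H →L[ℂ] H)
  dep : ∃ s : Finset G.Irr, DependsOn hom (s : Set G.Irr)

namespace NormalRep

/-- The restriction of a representation to a matrix block. -/
def block (φ : NormalRep G H) (i : G.Irr) : G.Block i →⋆ₙₐ[ℂ] (H →L[ℂ] H) :=
  (φ.hom : G.Fun →⋆ₙₐ[ℂ] (H →L[ℂ] H)).comp (blockHom G.dim i)

theorem block_apply (φ : NormalRep G H) (i : G.Irr) (a : G.Block i) :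
    φ.block i a = φ.hom (blockIncl G.dim i a) := rfl

theorem sum_blockIncl (f : G.Fun) (s : Finset G.Irr) (i : G.Irr) (hi : i ∈ s) :
    (∑ j ∈ s, blockIncl G.dim j (f j)) i = f i := by
  classical
  rw [Finset.sum_apply, Finset.sum_eq_single_of_mem i hi]
  · simp [blockIncl]
  · intro j _ hj
    simp [blockIncl, Pi.single_eq_of_ne (Ne.symm hj)]

theorem pou (φ : NormalRep G H) : IsPOU fun i => φ.block i 1 := by
  classical
  refine ⟨fun i j hij => ?_, ?_⟩
  · change φ.hom (blockIncl G.dim i 1) * φ.hom (blockIncl G.dim j 1) = 0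
    rw [← map_mul]
    have : blockIncl G.dim i 1 * blockIncl G.dim j 1 = 0 := by
      ext1 k
      by_cases hk : k = i
      · subst hk; simp [blockIncl, Pi.single_eq_of_ne hij]
      · simp [blockIncl, Pi.single_eq_of_ne hk]
    rw [this, map_zero]
  · obtain ⟨s, hs⟩ := φ.dep
    refine ⟨s, fun i hi => ?_, ?_⟩
    · change φ.hom (blockIncl G.dim i 1) = 0
      rw [← map_zero φ.hom]
      refine hs fun j hj => ?_
      have : j ≠ i := fun h => hi (h ▸ hj)
      simp [blockIncl, Pi.single_eq_of_ne this]
    · simp only [block_apply]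
      rw [← map_sum, ← map_one φ.hom]
      exact hs fun i hi => sum_blockIncl 1 s i hi

theorem hom_mul_block (φ : NormalRep G H) (f : G.Fun) (i : G.Irr) :
    φ.hom f * φ.block i 1 = φ.block i (f i) := by
  classical
  rw [block_apply, block_apply, ← map_mul]
  congr 1
  ext1 k
  by_cases hk : k = i
  · subst hk; simp [blockIncl]
  · simp [blockIncl, Pi.single_eq_of_ne hk]

/-- The homomorphism `a ⊗ b ↦ φ a ⊗ ψ b` on a pair of matrix blocks. -/
def pairBlock (φ : NormalRep G H) (ψ : NormalRep G K) (p : G.Irr × G.Irr) :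
    MatBlock G.dim p.1 ⊗[ℂ] MatBlock G.dim p.2 →⋆ₙₐ[ℂ] (HTensor H K →L[ℂ] HTensor H K) :=
  HTensor.pairHom (φ.block p.1) (ψ.block p.2)

theorem pairBlock_tmul (φ : NormalRep G H) (ψ : NormalRep G K) (p : G.Irr × G.Irr)
    (a : G.Block p.1) (b : G.Block p.2) :
    φ.pairBlock ψ p (a ⊗ₜ b) = HTensor.map (φ.block p.1 a) (ψ.block p.2 b) := rfl

theorem pairBlock_one (φ : NormalRep G H) (ψ : NormalRep G K) (p : G.Irr × G.Irr) :
    φ.pairBlock ψ p 1 = HTensor.map (φ.block p.1 1) (ψ.block p.2 1) := by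
  rw [Algebra.TensorProduct.one_def, pairBlock_tmul]

theorem pairBlock_pou (φ : NormalRep G H) (ψ : NormalRep G K) :
    IsPOU fun p => φ.pairBlock ψ p 1 := by
  have h := IsPOU.map_prod φ.pou ψ.pou
  simpa only [pairBlock_one] using h

/-- The homomorphism `φ ⊗ ψ` on `M(C_c(G) ⊗ C_c(G))`. -/
def box (φ : NormalRep G H) (ψ : NormalRep G K) :
    MatFun₂ G.dim →⋆ₐ[ℂ] (HTensor H K →L[ℂ] HTensor H K) :=
  glue (φ.pairBlock ψ) (φ.pairBlock_pou ψ)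

theorem box_apply (φ : NormalRep G H) (ψ : NormalRep G K) (m : MatFun₂ G.dim) :
    φ.box ψ m = ∑ᶠ p : G.Irr × G.Irr, φ.pairBlock ψ p (m p) := rfl

theorem box_mul (φ : NormalRep G H) (ψ : NormalRep G K) (m : MatFun₂ G.dim) (p : G.Irr × G.Irr) :
    φ.box ψ m * HTensor.map (φ.block p.1 1) (ψ.block p.2 1) = φ.pairBlock ψ p (m p) := by
  rw [← pairBlock_one]
  exact glue_mul_tau (φ.pairBlock_pou ψ) m p

theorem box_eq_sum (φ : NormalRep G H) (ψ : NormalRep G K) (m : MatFun₂ G.dim) {s t : Finset G.Irr}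
    (hs : ∀ i, i ∉ s → φ.block i 1 = 0) (ht : ∀ i, i ∉ t → ψ.block i 1 = 0) :
    φ.box ψ m = ∑ p ∈ s ×ˢ t, φ.pairBlock ψ p (m p) := by
  refine glue_eq_sum (φ.pairBlock_pou ψ) m fun p hp => ?_
  rw [pairBlock_one]
  rw [Finset.mem_product, not_and_or] at hp
  rcases hp with hp | hp
  · rw [hs _ hp, HTensor.map_zero_left]
  · rw [ht _ hp, HTensor.map_zero_right]

theorem box_intertwine {φ : NormalRep G H} {φ' : NormalRep G H'} {ψ : NormalRep G K}
    {ψ' : NormalRep G K'} {T : H →L[ℂ] H'} {S : K →L[ℂ] K'}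
    (hT : ∀ f, T ∘L φ.hom f = φ'.hom f ∘L T) (hS : ∀ f, S ∘L ψ.hom f = ψ'.hom f ∘L S)
    (m : MatFun₂ G.dim) :
    HTensor.map T S ∘L φ.box ψ m = φ'.box ψ' m ∘L HTensor.map T S := by
  classical
  obtain ⟨s, hs, -⟩ := φ.pou.2
  obtain ⟨s', hs', -⟩ := φ'.pou.2
  obtain ⟨t, ht, -⟩ := ψ.pou.2
  obtain ⟨t', ht', -⟩ := ψ'.pou.2
  rw [box_eq_sum φ ψ m (s := s ∪ s') (t := t ∪ t')
      (fun i hi => hs i fun h => hi (Finset.mem_union_left _ h))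
      (fun i hi => ht i fun h => hi (Finset.mem_union_left _ h)),
    box_eq_sum φ' ψ' m (s := s ∪ s') (t := t ∪ t')
      (fun i hi => hs' i fun h => hi (Finset.mem_union_right _ h))
      (fun i hi => ht' i fun h => hi (Finset.mem_union_right _ h)),
    ContinuousLinearMap.comp_finsetSum, ContinuousLinearMap.finsetSum_comp]
  refine Finset.sum_congr rfl fun p _ => ?_
  induction m p using TensorProduct.induction_on with
  | zero => simp
  | add a b ha hb =>
    rw [map_add, map_add, ContinuousLinearMap.comp_add, ContinuousLinearMap.add_comp, ha, hb]
  | tmul a b =>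
    rw [pairBlock_tmul, pairBlock_tmul, ← HTensor.map_comp, ← HTensor.map_comp, block_apply, block_apply,
      block_apply, block_apply, hT, hS]

/-- The tensor product `(φ ⊗ ψ)Δ`. -/
def mul (φ : NormalRep G H) (ψ : NormalRep G K) : NormalRep G (HTensor H K) where
  hom := (φ.box ψ).comp G.comul
  dep := by
    classical
    obtain ⟨s, hs⟩ := glue_dependsOn (φ.pairBlock_pou ψ)
    choose t ht using G.comul_dependsOn
    refine ⟨s.biUnion t, fun f g hfg => hs fun p hp => ht p fun i hi => hfg i ?_⟩
    exact Finset.mem_coe.mpr (Finset.mem_biUnion.mpr ⟨p, hp, hi⟩)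

theorem mul_hom (φ : NormalRep G H) (ψ : NormalRep G K) (f : G.Fun) :
    (φ.mul ψ).hom f = φ.box ψ (G.comul f) := rfl

/-- The homomorphism `f ↦ φ(f) P` for a projection `P` commuting with `φ`. -/
def cut (φ : NormalRep G H) (P : H →L[ℂ] H) (hP : IsStarProjection P)
    (hcomm : ∀ f, φ.hom f * P = P * φ.hom f) : G.Fun →⋆ₙₐ[ℂ] (H →L[ℂ] H) where
  toFun f := φ.hom f * P
  map_smul' c f := by simp
  map_zero' := by simp
  map_add' f g := by rw [map_add, add_mul]
  map_mul' f g := by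
    rw [map_mul, mul_assoc, mul_assoc, ← mul_assoc P, ← hcomm g, mul_assoc,
      hP.isIdempotentElem.eq]
  map_star' f := by
    rw [star_mul, hP.isSelfAdjoint.star_eq, ← map_star, hcomm]

theorem cut_apply (φ : NormalRep G H) (P : H →L[ℂ] H) (hP : IsStarProjection P)
    (hcomm : ∀ f, φ.hom f * P = P * φ.hom f) (f : G.Fun) : φ.cut P hP hcomm f = φ.hom f * P := rfl

/-- The diagonal homomorphism. -/
def diag (A X : Type*) [Ring A] [StarRing A] [Algebra ℂ A] : A →⋆ₐ[ℂ] (X → A) where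
  toFun f _ := f
  map_one' := rfl
  map_mul' _ _ := rfl
  map_zero' := rfl
  map_add' _ _ := rfl
  commutes' _ := rfl
  map_star' _ := rfl

section GlueProj

variable {X : Type*} (φ : X → NormalRep G H) (P : X → H →L[ℂ] H) (hP : IsPOU P)
  (hproj : ∀ y, IsStarProjection (P y)) (hcomm : ∀ y f, (φ y).hom f * P y = P y * (φ y).hom f)

theorem cut_pou (φ : X → NormalRep G H) (P : X → H →L[ℂ] H) (hP : IsPOU P)
    (hproj : ∀ y, IsStarProjection (P y)) (hcomm : ∀ y f, (φ y).hom f * P y = P y * (φ y).hom f) :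
    IsPOU fun y => (φ y).cut (P y) (hproj y) (hcomm y) 1 := by
  simpa [cut_apply] using hP

/-- The representation `f ↦ ∑ y, φ_y(f) P_y` glued from representations `φ_y` along a partition of
unity by projections `P_y` commuting with `φ_y`. -/
def glueProj : NormalRep G H where
  hom := (glue (R := fun _ : X => G.Fun) (fun y => (φ y).cut (P y) (hproj y) (hcomm y))
    (cut_pou φ P hP hproj hcomm)).comp (diag G.Fun X)
  dep := by
    classical
    choose t ht using fun y => (φ y).dep
    obtain ⟨s, hs, -⟩ := (cut_pou φ P hP hproj hcomm).2
    refine ⟨s.biUnion t, fun f g hfg => ?_⟩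
    change glue _ (cut_pou φ P hP hproj hcomm) _ = glue _ (cut_pou φ P hP hproj hcomm) _
    rw [glue_eq_sum _ _ hs, glue_eq_sum _ _ hs]
    refine Finset.sum_congr rfl fun y hy => ?_
    change (φ y).hom f * P y = (φ y).hom g * P y
    rw [ht y fun i hi => hfg i (Finset.mem_coe.mpr (Finset.mem_biUnion.mpr ⟨y, hy, hi⟩))]

theorem glueProj_hom (f : G.Fun) :
    (glueProj φ P hP hproj hcomm).hom f = ∑ᶠ y, (φ y).hom f * P y := rfl

theorem glueProj_mul (f : G.Fun) (y : X) :
    (glueProj φ P hP hproj hcomm).hom f * P y = (φ y).hom f * P y := by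
  have := glue_mul_tau (cut_pou φ P hP hproj hcomm) (fun _ => f) y
  rw [cut_apply, cut_apply, map_one, one_mul] at this
  exact this

theorem mul_glueProj (f : G.Fun) (y : X) :
    P y * (glueProj φ P hP hproj hcomm).hom f = (φ y).hom f * P y := by
  have := tau_mul_glue (cut_pou φ P hP hproj hcomm) (fun _ => f) y
  rw [cut_apply, cut_apply, map_one, one_mul] at this
  exact this

end GlueProj

end NormalRep
end NormalRep

section QuantumPermutation

variable {X : Type*} {H H' K K' : Type*}
  [NormedAddCommGroup H] [InnerProductSpace ℂ H] [CompleteSpace H]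
  [NormedAddCommGroup K] [InnerProductSpace ℂ K] [CompleteSpace K]

/-- A quantum permutation (magic unitary) of the set `X` on the Hilbert space `H`. -/
structure QuantumPermutation (X : Type*) (H : Type*) [NormedAddCommGroup H]
    [InnerProductSpace ℂ H] [CompleteSpace H] where
  u : X → X → H →L[ℂ] H
  isProj : ∀ x y, IsStarProjection (u x y)
  row_orth : ∀ x y z, y ≠ z → u x y * u x z = 0
  col_orth : ∀ y x z, x ≠ z → u x y * u z y = 0
  /-- `∑ z, u x z = 1` in the strong operator topology. -/
  row_sum : ∀ x ξ, HasSum (fun z => u x z ξ) ξ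
  /-- `∑ z, u z y = 1` in the strong operator topology. -/
  col_sum : ∀ y ξ, HasSum (fun z => u z y ξ) ξ

theorem isPOU_of_hasSum [FiniteDimensional ℂ H] {P : X → H →L[ℂ] H}
    (hP : ∀ x, IsStarProjection (P x)) (horth : ∀ x y, x ≠ y → P x * P y = 0)
    (hsum : ∀ ξ, HasSum (fun z => P z ξ) ξ) : IsPOU P := by
  have hfin := finite_support_of_orthogonal P (fun i => (hP i).isIdempotentElem.eq) horth
  have h0 : ∀ i, i ∉ hfin.toFinset → P i = 0 := fun i hi => by
    by_contra h
    exact hi (hfin.mem_toFinset.mpr h)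
  refine ⟨horth, hfin.toFinset, h0, ?_⟩
  ext ξ
  rw [ContinuousLinearMap.sum_apply]
  have h : HasSum (fun z => P z ξ) (∑ z ∈ hfin.toFinset, P z ξ) :=
    hasSum_sum_of_ne_finset_zero fun i hi => by rw [h0 i hi]; rfl
  exact h.unique (hsum ξ)

theorem IsPOU.hasSum {P : X → H →L[ℂ] H} (hP : IsPOU P) (ξ : H) :
    HasSum (fun z => P z ξ) ξ := by
  obtain ⟨s, hs, hsum⟩ := hP.2
  have h : HasSum (fun z => P z ξ) (∑ z ∈ s, P z ξ) :=
    hasSum_sum_of_ne_finset_zero fun i hi => by rw [hs i hi]; rfl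
  have e : ∑ z ∈ s, P z ξ = ξ := by
    rw [← ContinuousLinearMap.sum_apply, hsum]; rfl
  rwa [e] at h

namespace QuantumPermutation

theorem row_pou [FiniteDimensional ℂ H] (q : QuantumPermutation X H) (x : X) : IsPOU (q.u x) :=
  isPOU_of_hasSum (q.isProj x) (fun y z h => q.row_orth x y z h) (q.row_sum x)

theorem col_pou [FiniteDimensional ℂ H] (q : QuantumPermutation X H) (y : X) :
    IsPOU fun x => q.u x y :=
  isPOU_of_hasSum (fun x => q.isProj x y) (fun x z h => q.col_orth y x z h) (q.col_sum y)

/-- A matrix of projections whose rows and columns are finite partitions of unity. -/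
def ofPOU (u : X → X → H →L[ℂ] H) (hu : ∀ x y, IsStarProjection (u x y))
    (hrow : ∀ x, IsPOU (u x)) (hcol : ∀ y, IsPOU fun x => u x y) : QuantumPermutation X H where
  u := u
  isProj := hu
  row_orth x y z h := (hrow x).1 y z h
  col_orth y x z h := (hcol y).1 x z h
  row_sum x ξ := (hrow x).hasSum ξ
  col_sum y ξ := (hcol y).hasSum ξ

open scoped Classical in
/-- The trivial quantum permutation on `ℂ`. -/
def trivial (X : Type*) : QuantumPermutation X ℂ :=
  ofPOU (fun x y => if x = y then 1 else 0)
    (fun x y => by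
      split_ifs
      · exact IsStarProjection.one _
      · exact IsStarProjection.zero _)
    (fun x => ⟨fun y z h => by
        by_cases h1 : x = y
        · have h2 : x ≠ z := fun h2 => h (h1.symm.trans h2)
          simp [h2]
        · simp [h1],
      {x}, fun y hy => by
        rw [Finset.mem_singleton] at hy
        simp [Ne.symm hy], by simp⟩)
    (fun y => ⟨fun x z h => by
        by_cases h1 : x = y
        · have h2 : z ≠ y := fun h2 => h (h1.trans h2.symm)
          simp [h2]
        · simp [h1],
      {y}, fun x hx => by
        rw [Finset.mem_singleton] at hx
        simp [hx], by simp⟩)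

theorem trivial_ne {x y : X} (h : x ≠ y) : (trivial X).u x y = 0 := by
  classical
  change (if x = y then 1 else 0 : ℂ →L[ℂ] ℂ) = 0
  rw [if_neg h]

theorem trivial_self (x : X) : (trivial X).u x x = 1 := by
  classical
  change (if x = x then 1 else 0 : ℂ →L[ℂ] ℂ) = 1
  rw [if_pos rfl]

section Tensor

variable [FiniteDimensional ℂ H] [FiniteDimensional ℂ K]
variable (q : QuantumPermutation X H) (r : QuantumPermutation X K)

/-- The entries `∑ z, q_{xz} ⊗ r_{zy}` of the tensor product. -/
def tensorU (x y : X) : HTensor H K →L[ℂ] HTensor H K :=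
  ∑ᶠ z, HTensor.map (q.u x z) (r.u z y)

theorem tensorU_eq_sum_row (x y : X) {s : Finset X} (hs : ∀ z, z ∉ s → q.u x z = 0) :
    q.tensorU r x y = ∑ z ∈ s, HTensor.map (q.u x z) (r.u z y) := by
  refine finsum_eq_sum_of_support_subset _ fun z hz => ?_
  by_contra hzs
  refine hz ?_
  change HTensor.map (q.u x z) (r.u z y) = 0
  rw [hs z hzs, HTensor.map_zero_left]

theorem tensorU_eq_sum_col (x y : X) {s : Finset X} (hs : ∀ z, z ∉ s → r.u z y = 0) :
    q.tensorU r x y = ∑ z ∈ s, HTensor.map (q.u x z) (r.u z y) := by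
  refine finsum_eq_sum_of_support_subset _ fun z hz => ?_
  by_contra hzs
  refine hz ?_
  change HTensor.map (q.u x z) (r.u z y) = 0
  rw [hs z hzs, HTensor.map_zero_right]

theorem tensorU_mul_row (x y z : X) :
    q.tensorU r x y * HTensor.map (q.u x z) 1 = HTensor.map (q.u x z) (r.u z y) := by
  classical
  obtain ⟨s, hs, -⟩ := (q.row_pou x).2
  rw [tensorU_eq_sum_row q r x y (s := insert z s) (fun j hj => hs j fun h' => hj (by simp [h'])),
    Finset.sum_mul, Finset.sum_eq_single_of_mem z (Finset.mem_insert_self _ _)]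
  · rw [← HTensor.map_mul, (q.isProj x z).isIdempotentElem.eq, mul_one]
  · intro j _ hj
    rw [← HTensor.map_mul, q.row_orth x j z hj, HTensor.map_zero_left]

theorem tensorU_mul_col (x y z : X) :
    q.tensorU r x y * HTensor.map 1 (r.u z y) = HTensor.map (q.u x z) (r.u z y) := by
  classical
  obtain ⟨s, hs, -⟩ := (r.col_pou y).2
  rw [tensorU_eq_sum_col q r x y (s := insert z s) (fun j hj => hs j fun h' => hj (by simp [h'])),
    Finset.sum_mul, Finset.sum_eq_single_of_mem z (Finset.mem_insert_self _ _)]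
  · rw [← HTensor.map_mul, (r.isProj z y).isIdempotentElem.eq, mul_one]
  · intro j _ hj
    rw [← HTensor.map_mul, r.col_orth y j z hj, HTensor.map_zero_right]

theorem star_tensorU (x y : X) : star (q.tensorU r x y) = q.tensorU r x y := by
  obtain ⟨s, hs, -⟩ := (q.row_pou x).2
  rw [tensorU_eq_sum_row q r x y hs, star_sum]
  refine Finset.sum_congr rfl fun z _ => ?_
  rw [HTensor.star_map, (q.isProj x z).isSelfAdjoint.star_eq, (r.isProj z y).isSelfAdjoint.star_eq]

theorem row_mul_tensorU (x y z : X) :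
    HTensor.map (q.u x z) 1 * q.tensorU r x y = HTensor.map (q.u x z) (r.u z y) := by
  have h := congrArg star (tensorU_mul_row q r x y z)
  rwa [star_mul, star_tensorU, HTensor.star_map, HTensor.star_map, star_one,
    (q.isProj x z).isSelfAdjoint.star_eq, (r.isProj z y).isSelfAdjoint.star_eq] at h

theorem tensorU_row_pou (x : X) : IsPOU (q.tensorU r x) := by
  classical
  have horth : ∀ y z, y ≠ z → q.tensorU r x y * q.tensorU r x z = 0 := fun y z hyz => by
    refine (q.row_pou x).map_left.ext_right fun w => ?_
    rw [mul_assoc, tensorU_mul_row, zero_mul]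
    have e : HTensor.map (q.u x w) (r.u w z) =
        HTensor.map (q.u x w) 1 * HTensor.map 1 (r.u w z) := by
      rw [← HTensor.map_mul, one_mul, mul_one]
    rw [e, ← mul_assoc, tensorU_mul_row, ← HTensor.map_mul, r.row_orth w y z hyz,
      HTensor.map_zero_right]
  obtain ⟨s, hs, -⟩ := (q.row_pou x).2
  choose t ht htsum using fun z => (r.row_pou z).2
  refine ⟨horth, s.biUnion t, fun y hy => ?_, ?_⟩
  · rw [tensorU_eq_sum_row q r x y hs]
    refine Finset.sum_eq_zero fun z hz => ?_
    rw [ht z y fun h => hy (Finset.mem_biUnion.mpr ⟨z, hz, h⟩), HTensor.map_zero_right]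
  · refine (q.row_pou x).map_left.ext_right fun w => ?_
    rw [Finset.sum_mul, one_mul]
    simp only [tensorU_mul_row]
    rw [← HTensor.map_sum']
    by_cases hw : w ∈ s
    · rw [← Finset.sum_subset (Finset.subset_biUnion_of_mem t hw) (fun y _ hy => ht w y hy),
        htsum]
    · rw [hs w hw, HTensor.map_zero_left, HTensor.map_zero_left]

theorem tensorU_col_pou (y : X) : IsPOU fun x => q.tensorU r x y := by
  classical
  have horth : ∀ x z, x ≠ z → q.tensorU r x y * q.tensorU r z y = 0 := fun x z hxz => by
    refine (r.col_pou y).map_right.ext_right fun w => ?_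
    rw [mul_assoc, tensorU_mul_col, zero_mul]
    have e : HTensor.map (q.u z w) (r.u w y) =
        HTensor.map 1 (r.u w y) * HTensor.map (q.u z w) 1 := by
      rw [← HTensor.map_mul, one_mul, mul_one]
    rw [e, ← mul_assoc, tensorU_mul_col, ← HTensor.map_mul, q.col_orth w x z hxz,
      HTensor.map_zero_left]
  obtain ⟨s, hs', -⟩ := (r.col_pou y).2
  choose t ht' htsum using fun z => (q.col_pou z).2
  have hs : ∀ w, w ∉ s → r.u w y = 0 := hs'
  have ht : ∀ z i, i ∉ t z → q.u i z = 0 := ht'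
  refine ⟨horth, s.biUnion t, fun x hx => ?_, ?_⟩
  · change q.tensorU r x y = 0
    rw [tensorU_eq_sum_col q r x y hs]
    refine Finset.sum_eq_zero fun z hz => ?_
    rw [ht z x fun h => hx (Finset.mem_biUnion.mpr ⟨z, hz, h⟩), HTensor.map_zero_left]
  · refine (r.col_pou y).map_right.ext_right fun w => ?_
    rw [Finset.sum_mul, one_mul]
    simp only [tensorU_mul_col]
    rw [← HTensor.sum_map]
    by_cases hw : w ∈ s
    · rw [← Finset.sum_subset (Finset.subset_biUnion_of_mem t hw) (fun x _ hx => ht w x hx),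
        htsum]
    · rw [hs w hw, HTensor.map_zero_right, HTensor.map_zero_right]

/-- The tensor product of quantum permutations. -/
def tensor : QuantumPermutation X (HTensor H K) :=
  ofPOU (q.tensorU r) (fun x y => ⟨(q.tensorU_row_pou r x).idem y, star_tensorU q r x y⟩)
    (q.tensorU_row_pou r) (q.tensorU_col_pou r)

end Tensor

end QuantumPermutation

end QuantumPermutation

section C0Rep

open scoped Matrix.Norms.L2Operator
open Topology Filter

variable {I : Type*} {d : I → ℕ} {H : Type*} [NormedAddCommGroup H] [InnerProductSpace ℂ H]
  [CompleteSpace H]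

theorem mul_blockC0_one (f : c0Blocks d) (i : I) :
    f * blockC0 d i 1 = blockC0 d i (c0ToFun d f i) := by
  classical
  ext1; ext1; ext1 j
  change (f : lp (MatBlock d) ∞) j * (Pi.single i 1 : MatFun d) j =
    (Pi.single i ((f : lp (MatBlock d) ∞) i) : MatFun d) j
  by_cases hj : j = i
  · subst hj; simp
  · simp [Pi.single_eq_of_ne hj]

theorem blockC0_mul_ne {i j : I} (hij : i ≠ j) (a : MatBlock d i) (b : MatBlock d j) :
    blockC0 d i a * blockC0 d j b = 0 := by
  classical
  ext1; ext1; ext1 k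
  change (Pi.single i a : MatFun d) k * (Pi.single j b : MatFun d) k = 0
  by_cases hk : k = i
  · subst hk; simp [Pi.single_eq_of_ne hij]
  · simp [Pi.single_eq_of_ne hk]

theorem finSupp_eq_sum (f : c0Blocks d) (s : Finset I)
    (hs : ∀ i, i ∉ s → c0ToFun d f i = 0) : f = ∑ i ∈ s, blockC0 d i (c0ToFun d f i) := by
  classical
  have hinj : Function.Injective (c0ToFun d) := fun f g h => by
    ext1; ext1
    exact h
  apply hinj
  rw [map_sum]
  simp only [c0ToFun_blockC0]
  ext1 i
  rw [Finset.sum_apply]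
  by_cases hi : i ∈ s
  · rw [Finset.sum_eq_single_of_mem i hi]
    · simp [blockIncl]
    · intro j _ hj
      simp [blockIncl, Pi.single_eq_of_ne (Ne.symm hj)]
  · rw [hs i hi, Finset.sum_eq_zero]
    intro j hj
    have : i ≠ j := fun h => hi (h ▸ hj)
    simp [blockIncl, Pi.single_eq_of_ne this]

theorem continuous_c0Rep (τ : c0Blocks d →⋆ₙₐ[ℂ] (H →L[ℂ] H)) : Continuous τ :=
  AddMonoidHomClass.continuous_of_bound τ 1 fun f => by
    rw [one_mul]; exact NonUnitalStarAlgHom.norm_apply_le τ f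

/-- A *-representation of `C_0(G)` is nondegenerate if the span of its range vectors is dense. -/
def IsNondegenerateRep (τ : c0Blocks d →⋆ₙₐ[ℂ] (H →L[ℂ] H)) : Prop :=
  (Submodule.span ℂ {ζ : H | ∃ f ξ, τ f ξ = ζ}).topologicalClosure = ⊤

theorem IsNondegenerateRep.pou [FiniteDimensional ℂ H] {τ : c0Blocks d →⋆ₙₐ[ℂ] (H →L[ℂ] H)}
    (hτ : IsNondegenerateRep τ) : IsPOU fun i => τ.comp (blockC0 d i) 1 := by
  classical
  have horth : ∀ i j, i ≠ j → τ (blockC0 d i 1) * τ (blockC0 d j 1) = 0 := fun i j hij => by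
    rw [← map_mul, blockC0_mul_ne hij, map_zero]
  have hidem : ∀ i, τ (blockC0 d i 1) * τ (blockC0 d i 1) = τ (blockC0 d i 1) := fun i => by
    rw [← map_mul, ← map_mul, one_mul]
  have hfin := finite_support_of_orthogonal (fun i => τ (blockC0 d i 1)) hidem horth
  have h0 : ∀ i, i ∉ hfin.toFinset → τ (blockC0 d i 1) = 0 := fun i hi => by
    by_contra h
    exact hi (hfin.mem_toFinset.mpr h)
  refine ⟨horth, hfin.toFinset, h0, ?_⟩
  change ∑ i ∈ hfin.toFinset, τ (blockC0 d i 1) = 1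
  set e := ∑ i ∈ hfin.toFinset, τ (blockC0 d i 1) with he
  have h1 : ∀ i (a : MatBlock d i), e * τ (blockC0 d i a) = τ (blockC0 d i a) := fun i a => by
    have h2 : τ (blockC0 d i a) = τ (blockC0 d i 1) * τ (blockC0 d i a) := by
      rw [← map_mul, ← map_mul, one_mul]
    by_cases hi : i ∈ hfin.toFinset
    · rw [h2, ← mul_assoc, he, Finset.sum_mul, Finset.sum_eq_single_of_mem i hi, hidem]
      exact fun j _ hj => horth j i hj
    · rw [h2, h0 i hi, zero_mul, mul_zero]
  have h2 : ∀ f : c0Blocks d, e * τ f = τ f := fun f => by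
    obtain ⟨x, hx, hlim⟩ := mem_closure_iff_seq_limit.mp f.2
    let y : ℕ → c0Blocks d := fun n => ⟨x n, subset_closure (hx n)⟩
    have hy : Tendsto y atTop (𝓝 f) := tendsto_subtype_rng.mpr hlim
    have h3 : ∀ n, e * τ (y n) = τ (y n) := fun n => by
      have hf : {i | x n i ≠ 0}.Finite := hx n
      rw [finSupp_eq_sum (y n) hf.toFinset fun i hi => by
        by_contra h
        exact hi (hf.mem_toFinset.mpr h), map_sum, Finset.mul_sum]
      exact Finset.sum_congr rfl fun i _ => h1 i _
    have hτc := ((continuous_c0Rep τ).tendsto f).comp hy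
    refine tendsto_nhds_unique (hτc.const_mul e) ?_
    exact hτc.congr fun n => (h3 n).symm
  ext ζ
  have hle : (Submodule.span ℂ {ζ : H | ∃ f ξ, τ f ξ = ζ}).topologicalClosure ≤
      LinearMap.eqLocus (e : H →ₗ[ℂ] H) LinearMap.id := by
    refine Submodule.topologicalClosure_minimal _ (Submodule.span_le.mpr ?_) ?_
    · rintro _ ⟨f, ξ, rfl⟩
      exact congrArg (fun T : H →L[ℂ] H => T ξ) (h2 f)
    · exact isClosed_eq e.continuous continuous_id
  have hmem : ζ ∈ (Submodule.span ℂ {ζ : H | ∃ f ξ, τ f ξ = ζ}).topologicalClosure := by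
    rw [show (Submodule.span ℂ {ζ : H | ∃ f ξ, τ f ξ = ζ}).topologicalClosure = ⊤ from hτ]
    trivial
  exact hle hmem

end C0Rep

section NormalExtension

open scoped Matrix.Norms.L2Operator

universe u

variable {G : DiscreteQuantumGroup.{u}} {H : Type*} [NormedAddCommGroup H] [InnerProductSpace ℂ H]
  [FiniteDimensional ℂ H] [CompleteSpace H]

namespace NormalRep

/-- The unital extension of a nondegenerate *-representation of `C_0(G)` to all functions. -/
def extend (τ : G.C0 →⋆ₙₐ[ℂ] (H →L[ℂ] H)) (hτ : IsNondegenerateRep τ) : NormalRep G H where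
  hom := glue (fun i => τ.comp (blockC0 G.dim i)) hτ.pou
  dep := glue_dependsOn hτ.pou

theorem extend_hom (τ : G.C0 →⋆ₙₐ[ℂ] (H →L[ℂ] H)) (hτ : IsNondegenerateRep τ) (f : G.C0) :
    (extend τ hτ).hom (c0ToFun G.dim f) = τ f := by
  refine hτ.pou.ext_right fun i => ?_
  refine (glue_mul_tau hτ.pou _ i).trans ?_
  change τ (blockC0 G.dim i (c0ToFun G.dim f i)) = τ f * τ (blockC0 G.dim i 1)
  rw [← mul_blockC0_one, map_mul]

/-- The restriction of a representation of all functions to `C_0(G)`. -/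
def restrict (φ : NormalRep G H) : G.C0 →⋆ₙₐ[ℂ] (H →L[ℂ] H) :=
  (φ.hom : G.Fun →⋆ₙₐ[ℂ] (H →L[ℂ] H)).comp (c0ToFun G.dim)

theorem restrict_apply (φ : NormalRep G H) (f : G.C0) :
    φ.restrict f = φ.hom (c0ToFun G.dim f) := rfl

theorem restrict_nondegenerate (φ : NormalRep G H) : IsNondegenerateRep φ.restrict := by
  obtain ⟨s, -, hsum⟩ := φ.pou.2
  rw [IsNondegenerateRep, eq_top_iff]
  intro ζ _
  refine Submodule.le_topologicalClosure _ (Submodule.subset_span ⟨∑ i ∈ s, blockC0 G.dim i 1, ζ, ?_⟩)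
  rw [map_sum]
  change (∑ i ∈ s, φ.block i 1) ζ = ζ
  rw [hsum]; rfl

theorem ext_block {φ ψ : NormalRep G H} (h : ∀ i a, φ.block i a = ψ.block i a) : φ = ψ := by
  have h' : φ.hom = ψ.hom := by
    ext1 f
    refine φ.pou.ext_right fun i => ?_
    rw [hom_mul_block, h i 1, hom_mul_block, h]
  cases φ; cases ψ; cases h'; rfl

theorem extend_restrict (φ : NormalRep G H) :
    extend φ.restrict φ.restrict_nondegenerate = φ := by
  refine ext_block fun i a => ?_
  rw [block_apply, ← c0ToFun_blockC0, extend_hom, restrict_apply, c0ToFun_blockC0, block_apply]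

end NormalRep

/-- An `X`-free wreath corepresentation of `G` on the Hilbert space `H`. -/
structure WreathCorep (G : DiscreteQuantumGroup.{u}) (X : Type*) (H : Type*) [NormedAddCommGroup H]
    [InnerProductSpace ℂ H] [CompleteSpace H] where
  /-- The *-representations `π^G_x` of `C_0(G)`. -/
  rep : X → G.C0 →⋆ₙₐ[ℂ] (H →L[ℂ] H)
  nondegenerate : ∀ x, IsNondegenerateRep (rep x)
  /-- The quantum permutation `π^X`. -/
  perm : QuantumPermutation X H
  comm : ∀ x y f, rep x f * perm.u x y = perm.u x y * rep x f

namespace WreathCorep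

variable {X : Type*}

/-- The unital extension of `π^G_x` to all functions on `G`. -/
def ext (π : WreathCorep G X H) (x : X) : NormalRep G H :=
  NormalRep.extend (π.rep x) (π.nondegenerate x)

theorem ext_hom (π : WreathCorep G X H) (x : X) (f : G.C0) :
    (π.ext x).hom (c0ToFun G.dim f) = π.rep x f := NormalRep.extend_hom _ _ f

theorem ext_block (π : WreathCorep G X H) (x : X) (i : G.Irr) (a : G.Block i) :
    (π.ext x).block i a = π.rep x (blockC0 G.dim i a) := by
  rw [NormalRep.block_apply, ← c0ToFun_blockC0, ext_hom]

theorem ext_comm (π : WreathCorep G X H) (x y : X) (f : G.Fun) :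
    (π.ext x).hom f * π.perm.u x y = π.perm.u x y * (π.ext x).hom f := by
  obtain ⟨s, hs, -⟩ := (π.nondegenerate x).pou.2
  have h : (π.ext x).hom f = ∑ i ∈ s, π.rep x (blockC0 G.dim i (f i)) :=
    glue_eq_sum (π.nondegenerate x).pou f hs
  rw [h, Finset.sum_mul, Finset.mul_sum]
  exact Finset.sum_congr rfl fun i _ => π.comm x y _

/-- A wreath corepresentation built from representations of all functions. -/
def ofNormal (φ : X → NormalRep G H) (u : QuantumPermutation X H)
    (h : ∀ x y f, (φ x).hom f * u.u x y = u.u x y * (φ x).hom f) : WreathCorep G X H where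
  rep x := (φ x).restrict
  nondegenerate x := (φ x).restrict_nondegenerate
  perm := u
  comm x y f := h x y _

theorem ofNormal_ext (φ : X → NormalRep G H) (u : QuantumPermutation X H)
    (h : ∀ x y f, (φ x).hom f * u.u x y = u.u x y * (φ x).hom f) (x : X) :
    (ofNormal φ u h).ext x = φ x := NormalRep.extend_restrict _

end WreathCorep

end NormalExtension

theorem IsPOU.ext_comp {ι H M : Type*} [NormedAddCommGroup H] [InnerProductSpace ℂ H]
    [NormedAddCommGroup M] [InnerProductSpace ℂ M] {P : ι → H →L[ℂ] H} (hP : IsPOU P)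
    {A B : H →L[ℂ] M} (h : ∀ i, A ∘L P i = B ∘L P i) : A = B := by
  obtain ⟨-, s, -, hsum⟩ := hP
  have e : ∀ C : H →L[ℂ] M, C = ∑ i ∈ s, C ∘L P i := fun C => by
    rw [← ContinuousLinearMap.comp_finsetSum, hsum]; rfl
  rw [e A, e B]
  exact Finset.sum_congr rfl fun i _ => h i

section Intertwines

open TensorProduct

universe u

variable {G : DiscreteQuantumGroup.{u}}
variable {H H' H'' K K' L : Type*}
  [NormedAddCommGroup H] [InnerProductSpace ℂ H] [FiniteDimensional ℂ H] [CompleteSpace H]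
  [NormedAddCommGroup H'] [InnerProductSpace ℂ H'] [FiniteDimensional ℂ H'] [CompleteSpace H']
  [NormedAddCommGroup H''] [InnerProductSpace ℂ H''] [FiniteDimensional ℂ H''] [CompleteSpace H'']
  [NormedAddCommGroup K] [InnerProductSpace ℂ K] [FiniteDimensional ℂ K] [CompleteSpace K]
  [NormedAddCommGroup K'] [InnerProductSpace ℂ K'] [FiniteDimensional ℂ K'] [CompleteSpace K']
  [NormedAddCommGroup L] [InnerProductSpace ℂ L] [FiniteDimensional ℂ L] [CompleteSpace L]

namespace NormalRep

/-- The operator `T` intertwines `φ` and `ψ`. -/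
def Intertwines (φ : NormalRep G H) (ψ : NormalRep G K) (T : H →L[ℂ] K) : Prop :=
  ∀ f, T ∘L φ.hom f = ψ.hom f ∘L T

theorem Intertwines.comp {φ : NormalRep G H} {φ' : NormalRep G H'} {φ'' : NormalRep G H''}
    {S : H' →L[ℂ] H''} {T : H →L[ℂ] H'} (hS : φ'.Intertwines φ'' S) (hT : φ.Intertwines φ' T) :
    φ.Intertwines φ'' (S ∘L T) := fun f => by
  rw [ContinuousLinearMap.comp_assoc, hT, ← ContinuousLinearMap.comp_assoc, hS,
    ContinuousLinearMap.comp_assoc]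

theorem Intertwines.one (φ : NormalRep G H) : φ.Intertwines φ 1 := fun _ => rfl

theorem Intertwines.map {φ : NormalRep G H} {φ' : NormalRep G H'} {ψ : NormalRep G K}
    {ψ' : NormalRep G K'} {T : H →L[ℂ] H'} {S : K →L[ℂ] K'} (hT : φ.Intertwines φ' T)
    (hS : ψ.Intertwines ψ' S) : (φ.mul ψ).Intertwines (φ'.mul ψ') (HTensor.map T S) :=
  fun f => box_intertwine hT hS (G.comul f)

theorem hom_eq_sum (φ : NormalRep G H) (f : G.Fun) {s : Finset G.Irr}
    (hs : ∀ i, i ∉ s → φ.block i 1 = 0) : φ.hom f = ∑ i ∈ s, φ.block i (f i) := by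
  refine φ.pou.ext_right fun j => ?_
  rw [hom_mul_block, Finset.sum_mul]
  by_cases hj : j ∈ s
  · rw [Finset.sum_eq_single_of_mem j hj, tau_mul_one]
    exact fun i _ hij => tau_mul_ne φ.pou hij _ _
  · have h0 : φ.block j 1 = 0 := hs j hj
    rw [← tau_one_mul, h0, zero_mul, Finset.sum_eq_zero]
    exact fun i _ => mul_zero _

theorem intertwines_of_block {φ : NormalRep G H} {ψ : NormalRep G K} {T : H →L[ℂ] K}
    (h : ∀ i a, T ∘L φ.block i a = ψ.block i a ∘L T) : φ.Intertwines ψ T := fun f => by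
  classical
  obtain ⟨s, hs, -⟩ := φ.pou.2
  obtain ⟨t, ht, -⟩ := ψ.pou.2
  rw [hom_eq_sum φ f (s := s ∪ t) (fun i hi => hs i fun h => hi (Finset.mem_union_left _ h)),
    hom_eq_sum ψ f (s := s ∪ t) (fun i hi => ht i fun h => hi (Finset.mem_union_right _ h)),
    ContinuousLinearMap.comp_finsetSum, ContinuousLinearMap.finsetSum_comp]
  exact Finset.sum_congr rfl fun i _ => h i _

/-- The counit, as a representation on `ℂ`. -/
def counit (G : DiscreteQuantumGroup.{u}) : NormalRep G ℂ where
  hom := (StarAlgHom.ofId ℂ (ℂ →L[ℂ] ℂ)).comp G.counit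
  dep := by
    obtain ⟨s, hs⟩ := G.counit_dependsOn
    exact ⟨s, fun f g h => congrArg (StarAlgHom.ofId ℂ (ℂ →L[ℂ] ℂ)) (hs h)⟩

theorem counit_hom_apply (f : G.Fun) (c : ℂ) : (counit G).hom f c = G.counit f * c := rfl

theorem lid_intertwines (φ : NormalRep G H) :
    ((counit G).mul φ).Intertwines φ (HTensor.lid H : HTensor ℂ H →L[ℂ] H) := fun f => by
  obtain ⟨s, hs, -⟩ := (counit G).pou.2
  obtain ⟨t, ht, -⟩ := φ.pou.2
  rw [mul_hom, box_eq_sum (counit G) φ _ hs ht, hom_eq_sum φ f ht, Finset.sum_product_right,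
    ContinuousLinearMap.comp_finsetSum, ContinuousLinearMap.finsetSum_comp]
  refine Finset.sum_congr rfl fun j _ => ?_
  have hz : ∀ i, i ∉ s → G.counit.toAlgHom.toLinearMap ∘ₗ blockIncl G.dim i = 0 := fun i hi => by
    ext1 a
    have h1 : (counit G).block i a 1 = 0 := by
      rw [← tau_one_mul, show (counit G).block i 1 = 0 from hs i hi, zero_mul]; rfl
    rw [block_apply, counit_hom_apply, mul_one] at h1
    exact h1
  rw [← G.counit_left f j, finsum_eq_sum_of_support_subset (s := s) _ (fun i hi => by
    by_contra his
    refine hi ?_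
    dsimp only
    rw [hz i his, LinearMap.rTensor_zero, LinearMap.zero_apply, map_zero]), map_sum,
    ContinuousLinearMap.comp_finsetSum, ContinuousLinearMap.finsetSum_comp]
  refine Finset.sum_congr rfl fun i _ => ?_
  induction G.comul f (i, j) using TensorProduct.induction_on with
  | zero => simp
  | add a b ha hb =>
    rw [map_add, map_add, map_add, map_add, ContinuousLinearMap.comp_add,
      ContinuousLinearMap.add_comp, ha, hb]
  | tmul a b =>
    refine HTensor.ext fun c ξ => ?_
    change (G.counit (blockIncl G.dim i a) * c) • φ.block j b ξ =
      φ.block j (G.counit (blockIncl G.dim i a) • b) (c • ξ)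
    rw [map_smul, map_smul, ContinuousLinearMap.smul_apply, smul_smul, mul_comm]

theorem rid_intertwines (φ : NormalRep G H) :
    (φ.mul (counit G)).Intertwines φ (HTensor.rid H : HTensor H ℂ →L[ℂ] H) := fun f => by
  obtain ⟨s, hs, -⟩ := (counit G).pou.2
  obtain ⟨t, ht, -⟩ := φ.pou.2
  rw [mul_hom, box_eq_sum φ (counit G) _ ht hs, hom_eq_sum φ f ht, Finset.sum_product,
    ContinuousLinearMap.comp_finsetSum, ContinuousLinearMap.finsetSum_comp]
  refine Finset.sum_congr rfl fun j _ => ?_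
  have hz : ∀ i, i ∉ s → G.counit.toAlgHom.toLinearMap ∘ₗ blockIncl G.dim i = 0 := fun i hi => by
    ext1 a
    have h1 : (counit G).block i a 1 = 0 := by
      rw [← tau_one_mul, show (counit G).block i 1 = 0 from hs i hi, zero_mul]; rfl
    rw [block_apply, counit_hom_apply, mul_one] at h1
    exact h1
  rw [← G.counit_right f j, finsum_eq_sum_of_support_subset (s := s) _ (fun i hi => by
    by_contra his
    refine hi ?_
    dsimp only
    rw [hz i his, LinearMap.lTensor_zero, LinearMap.zero_apply, map_zero]), map_sum,
    ContinuousLinearMap.comp_finsetSum, ContinuousLinearMap.finsetSum_comp]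
  refine Finset.sum_congr rfl fun i _ => ?_
  induction G.comul f (j, i) using TensorProduct.induction_on with
  | zero => simp
  | add a b ha hb =>
    rw [map_add, map_add, map_add, map_add, ContinuousLinearMap.comp_add,
      ContinuousLinearMap.add_comp, ha, hb]
  | tmul a b =>
    refine HTensor.ext fun ξ c => ?_
    change (G.counit (blockIncl G.dim i b) * c) • φ.block j a ξ =
      φ.block j (G.counit (blockIncl G.dim i b) • a) (c • ξ)
    rw [map_smul, map_smul, ContinuousLinearMap.smul_apply, smul_smul, mul_comm]

theorem comul_block_eq_zero (p : G.Irr × G.Irr) : ∃ s : Finset G.Irr, ∀ l, l ∉ s →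
    LinearMap.proj p ∘ₗ G.comul.toAlgHom.toLinearMap ∘ₗ blockIncl G.dim l = 0 := by
  classical
  obtain ⟨s, hs⟩ := G.comul_dependsOn p
  refine ⟨s, fun l hl => ?_⟩
  ext1 a
  have h : G.comul (blockIncl G.dim l a) p = G.comul 0 p := hs fun j hj => by
    have : j ≠ l := fun h => hl (h ▸ hj)
    simp [blockIncl, Pi.single_eq_of_ne this]
  rw [map_zero] at h
  exact h

theorem mul_block (φ : NormalRep G H) (ψ : NormalRep G K) {s t : Finset G.Irr}
    (hs : ∀ i, i ∉ s → φ.block i 1 = 0) (ht : ∀ i, i ∉ t → ψ.block i 1 = 0) (l : G.Irr)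
    (a : G.Block l) : (φ.mul ψ).block l a =
      ∑ p ∈ s ×ˢ t, φ.pairBlock ψ p (G.comul (blockIncl G.dim l a) p) := by
  rw [block_apply, mul_hom, box_eq_sum φ ψ _ hs ht]

theorem box_mul_left_eq (φ : NormalRep G H) (ψ : NormalRep G K) (χ : NormalRep G L)
    {s t r : Finset G.Irr} (hs : ∀ i, i ∉ s → φ.block i 1 = 0) (ht : ∀ i, i ∉ t → ψ.block i 1 = 0)
    (hr : ∀ i, i ∉ r → χ.block i 1 = 0) (m : MatFun₂ G.dim) :
    (φ.mul ψ).box χ m = ∑ k ∈ r, ∑ p ∈ s ×ˢ t,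
      HTensor.pairHom (φ.pairBlock ψ p) (χ.block k) (∑ᶠ l,
        ((LinearMap.proj p ∘ₗ G.comul.toAlgHom.toLinearMap ∘ₗ blockIncl G.dim l).rTensor
          (MatBlock G.dim k)) (m (l, k))) := by
  classical
  choose w hw using fun p => comul_block_eq_zero (G := G) p
  obtain ⟨v, hv, -⟩ := (φ.mul ψ).pou.2
  set q := v ∪ (s ×ˢ t).biUnion w with hq
  have hvq : ∀ i, i ∉ q → (φ.mul ψ).block i 1 = 0 :=
    fun i hi => hv i fun h => hi (Finset.mem_union_left _ h)
  rw [box_eq_sum _ χ m hvq hr, Finset.sum_product_right]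
  refine Finset.sum_congr rfl fun k _ => ?_
  have h1 : ∀ p ∈ s ×ˢ t, (∑ᶠ l,
        ((LinearMap.proj p ∘ₗ G.comul.toAlgHom.toLinearMap ∘ₗ blockIncl G.dim l).rTensor
          (MatBlock G.dim k)) (m (l, k))) = ∑ l ∈ q,
        ((LinearMap.proj p ∘ₗ G.comul.toAlgHom.toLinearMap ∘ₗ blockIncl G.dim l).rTensor
          (MatBlock G.dim k)) (m (l, k)) := fun p hp =>
    finsum_eq_sum_of_support_subset _ fun l hl => by
      by_contra h
      refine hl ?_
      dsimp only
      rw [hw p l fun h' => h (Finset.mem_union_right _ (Finset.mem_biUnion.mpr ⟨p, hp, h'⟩)),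
        LinearMap.rTensor_zero, LinearMap.zero_apply]
  refine Eq.symm (Eq.trans (Finset.sum_congr rfl fun p hp =>
    (congrArg _ (h1 p hp)).trans (map_sum _ _ _)) ?_)
  rw [Finset.sum_comm]
  refine Finset.sum_congr rfl fun l _ => Eq.symm ?_
  induction m (l, k) using TensorProduct.induction_on with
  | zero => simp
  | add a b ha hb => simp only [map_add, ha, hb, Finset.sum_add_distrib]
  | tmul a b =>
    rw [pairBlock_tmul, mul_block φ ψ hs ht, HTensor.sum_map]
    rfl

theorem box_mul_right_eq (φ : NormalRep G H) (ψ : NormalRep G K) (χ : NormalRep G L)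
    {s t r : Finset G.Irr} (hs : ∀ i, i ∉ s → φ.block i 1 = 0) (ht : ∀ i, i ∉ t → ψ.block i 1 = 0)
    (hr : ∀ i, i ∉ r → χ.block i 1 = 0) (m : MatFun₂ G.dim) :
    φ.box (ψ.mul χ) m = ∑ i ∈ s, ∑ p ∈ t ×ˢ r,
      HTensor.pairHom (φ.block i) (ψ.pairBlock χ p) (∑ᶠ l,
        ((LinearMap.proj p ∘ₗ G.comul.toAlgHom.toLinearMap ∘ₗ blockIncl G.dim l).lTensor
          (MatBlock G.dim i)) (m (i, l))) := by
  classical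
  choose w hw using fun p => comul_block_eq_zero (G := G) p
  obtain ⟨v, hv, -⟩ := (ψ.mul χ).pou.2
  set q := v ∪ (t ×ˢ r).biUnion w with hq
  have hvq : ∀ i, i ∉ q → (ψ.mul χ).block i 1 = 0 :=
    fun i hi => hv i fun h => hi (Finset.mem_union_left _ h)
  rw [box_eq_sum φ _ m hs hvq, Finset.sum_product]
  refine Finset.sum_congr rfl fun i _ => ?_
  have h1 : ∀ p ∈ t ×ˢ r, (∑ᶠ l,
        ((LinearMap.proj p ∘ₗ G.comul.toAlgHom.toLinearMap ∘ₗ blockIncl G.dim l).lTensor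
          (MatBlock G.dim i)) (m (i, l))) = ∑ l ∈ q,
        ((LinearMap.proj p ∘ₗ G.comul.toAlgHom.toLinearMap ∘ₗ blockIncl G.dim l).lTensor
          (MatBlock G.dim i)) (m (i, l)) := fun p hp =>
    finsum_eq_sum_of_support_subset _ fun l hl => by
      by_contra h
      refine hl ?_
      dsimp only
      rw [hw p l fun h' => h (Finset.mem_union_right _ (Finset.mem_biUnion.mpr ⟨p, hp, h'⟩)),
        LinearMap.lTensor_zero, LinearMap.zero_apply]
  refine Eq.symm (Eq.trans (Finset.sum_congr rfl fun p hp =>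
    (congrArg _ (h1 p hp)).trans (map_sum _ _ _)) ?_)
  rw [Finset.sum_comm]
  refine Finset.sum_congr rfl fun l _ => Eq.symm ?_
  induction m (i, l) using TensorProduct.induction_on with
  | zero => simp
  | add a b ha hb => simp only [map_add, ha, hb, Finset.sum_add_distrib]
  | tmul a b =>
    rw [pairBlock_tmul, mul_block ψ χ ht hr, HTensor.map_sum']
    rfl

theorem assoc_pair (α : NormalRep G H) (β : NormalRep G K) (γ : NormalRep G L) (i j k : G.Irr)
    (m : (G.Block i ⊗[ℂ] G.Block j) ⊗[ℂ] G.Block k) :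
    (HTensor.assoc H K L : _ →L[ℂ] _) ∘L
      HTensor.pairHom (α.pairBlock β (i, j)) (γ.block k) m =
    HTensor.pairHom (α.block i) (β.pairBlock γ (j, k))
      (TensorProduct.assoc ℂ (G.Block i) (G.Block j) (G.Block k) m) ∘L
        (HTensor.assoc H K L : _ →L[ℂ] _) := by
  induction m using TensorProduct.induction_on with
  | zero => simp
  | add a b ha hb =>
    rw [map_add, map_add, map_add, ContinuousLinearMap.comp_add, ContinuousLinearMap.add_comp, ha,
      hb]
  | tmul m c =>
    induction m using TensorProduct.induction_on with
    | zero => simp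
    | add a b ha hb =>
      rw [TensorProduct.add_tmul, map_add, map_add, map_add, ContinuousLinearMap.comp_add,
        ContinuousLinearMap.add_comp, ha, hb]
    | tmul a b => exact HTensor.ext₃ fun ξ η ζ => rfl

theorem assoc_intertwines (φ : NormalRep G H) (ψ : NormalRep G K) (χ : NormalRep G L) :
    ((φ.mul ψ).mul χ).Intertwines (φ.mul (ψ.mul χ))
      (HTensor.assoc H K L : HTensor (HTensor H K) L →L[ℂ] HTensor H (HTensor K L)) := fun f => by
  obtain ⟨s, hs, -⟩ := φ.pou.2
  obtain ⟨t, ht, -⟩ := ψ.pou.2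
  obtain ⟨r, hr, -⟩ := χ.pou.2
  rw [mul_hom, mul_hom, box_mul_left_eq φ ψ χ hs ht hr, box_mul_right_eq φ ψ χ hs ht hr]
  simp only [Finset.sum_product]
  rw [Finset.sum_comm]
  rw [ContinuousLinearMap.comp_finsetSum, ContinuousLinearMap.finsetSum_comp]
  refine Finset.sum_congr rfl fun i _ => ?_
  rw [Finset.sum_comm]
  rw [ContinuousLinearMap.comp_finsetSum, ContinuousLinearMap.finsetSum_comp]
  refine Finset.sum_congr rfl fun j _ => ?_
  rw [ContinuousLinearMap.comp_finsetSum, ContinuousLinearMap.finsetSum_comp]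
  refine Finset.sum_congr rfl fun k _ => ?_
  rw [← G.coassoc f i j k]
  exact assoc_pair φ ψ χ i j k _

theorem glueProj_intertwines {X : Type*} (φ : X → NormalRep G H) (P : X → H →L[ℂ] H) (hP : IsPOU P)
    (hproj : ∀ y, IsStarProjection (P y)) (hcomm : ∀ y f, (φ y).hom f * P y = P y * (φ y).hom f)
    (y : X) : (φ y).Intertwines (glueProj φ P hP hproj hcomm) (P y) := fun f => by
  refine Eq.trans ?_ (glueProj_mul φ P hP hproj hcomm f y).symm
  exact (hcomm y f).symm

/-- Intertwiners out of a representation are detected on the members of a partition of unity. -/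
theorem intertwines_of_pou {ι : Type*} {φ : NormalRep G H} {ψ : NormalRep G K} {T : H →L[ℂ] K} {P : ι → H →L[ℂ] H} (hP : IsPOU P)
    {θ : ι → NormalRep G H} (h1 : ∀ i, (θ i).Intertwines φ (P i))
    (h2 : ∀ i, (θ i).Intertwines ψ (T ∘L P i)) : φ.Intertwines ψ T := fun f => by
  refine hP.ext_comp fun i => ?_
  rw [ContinuousLinearMap.comp_assoc, ← h1 i f, ← ContinuousLinearMap.comp_assoc, h2 i f,
    ContinuousLinearMap.comp_assoc]

end NormalRep

end Intertwines

section WreathTensor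

open scoped Matrix.Norms.L2Operator

universe u v

variable {G : DiscreteQuantumGroup.{u}} {X : Type v}
variable {H H' K K' L : Type*}
  [NormedAddCommGroup H] [InnerProductSpace ℂ H] [FiniteDimensional ℂ H] [CompleteSpace H]
  [NormedAddCommGroup H'] [InnerProductSpace ℂ H'] [FiniteDimensional ℂ H'] [CompleteSpace H']
  [NormedAddCommGroup K] [InnerProductSpace ℂ K] [FiniteDimensional ℂ K] [CompleteSpace K]
  [NormedAddCommGroup K'] [InnerProductSpace ℂ K'] [FiniteDimensional ℂ K'] [CompleteSpace K']
  [NormedAddCommGroup L] [InnerProductSpace ℂ L] [FiniteDimensional ℂ L] [CompleteSpace L]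

theorem HTensor.isStarProjection_map {P : H →L[ℂ] H} {Q : K →L[ℂ] K} (hP : IsStarProjection P)
    (hQ : IsStarProjection Q) : IsStarProjection (HTensor.map P Q) :=
  ⟨by
    change HTensor.map P Q * HTensor.map P Q = HTensor.map P Q
    rw [← HTensor.map_mul, hP.isIdempotentElem.eq, hQ.isIdempotentElem.eq],
    by
    change star (HTensor.map P Q) = HTensor.map P Q
    rw [HTensor.star_map, hP.isSelfAdjoint.star_eq, hQ.isSelfAdjoint.star_eq]⟩

namespace WreathCorep

theorem perm_intertwines (π : WreathCorep G X H) (x y : X) :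
    (π.ext x).Intertwines (π.ext x) (π.perm.u x y) := fun f => (π.ext_comm x y f).symm

/-- The representation `(π ⊗ ρ)^G_x`, given by
`f ↦ ∑ y, (π^G_x ⊗ ρ^G_y)(Δ f) (π^X_{xy} ⊗ 1)`. -/
def tensorRep (π : WreathCorep G X H) (ρ : WreathCorep G X K) (x : X) :
    NormalRep G (HTensor H K) :=
  NormalRep.glueProj (fun y => (π.ext x).mul (ρ.ext y))
    (fun y => HTensor.map (π.perm.u x y) (1 : K →L[ℂ] K)) (π.perm.row_pou x).map_left
    (fun y => HTensor.isStarProjection_map (π.perm.isProj x y) (IsStarProjection.one _))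
    (fun y f => (((π.perm_intertwines x y).map (NormalRep.Intertwines.one (ρ.ext y))) f).symm)

theorem tensorRep_hom (π : WreathCorep G X H) (ρ : WreathCorep G X K) (x : X) (f : G.Fun) :
    (π.tensorRep ρ x).hom f = ∑ᶠ y, (π.ext x).box (ρ.ext y) (G.comul f) *
      HTensor.map (π.perm.u x y) 1 := rfl

/-- The components of the tensor product in terms of its constituents. -/
theorem tensorRep_intertwines (π : WreathCorep G X H) (ρ : WreathCorep G X K) (x y : X)
    {S : K →L[ℂ] K} (hS : (ρ.ext y).Intertwines (ρ.ext y) S) :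
    ((π.ext x).mul (ρ.ext y)).Intertwines (π.tensorRep ρ x) (HTensor.map (π.perm.u x y) S) := by
  have h1 := (NormalRep.glueProj_intertwines (fun y => (π.ext x).mul (ρ.ext y))
    (fun y => HTensor.map (π.perm.u x y) (1 : K →L[ℂ] K)) (π.perm.row_pou x).map_left
    (fun y => HTensor.isStarProjection_map (π.perm.isProj x y) (IsStarProjection.one _))
    (fun y f => (((π.perm_intertwines x y).map (NormalRep.Intertwines.one (ρ.ext y))) f).symm) y)
  have h2 := h1.comp ((NormalRep.Intertwines.one (π.ext x)).map hS)
  rw [← HTensor.map_comp] at h2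
  exact h2

theorem tensor_comm (π : WreathCorep G X H) (ρ : WreathCorep G X K) (x y : X) :
    (π.tensorRep ρ x).Intertwines (π.tensorRep ρ x) (π.perm.tensorU ρ.perm x y) := by
  refine NormalRep.intertwines_of_pou (P := fun z => HTensor.map (π.perm.u x z) (1 : K →L[ℂ] K))
    (π.perm.row_pou x).map_left (θ := fun z => (π.ext x).mul (ρ.ext z)) (fun z => ?_) (fun z => ?_)
  · exact π.tensorRep_intertwines ρ x z (NormalRep.Intertwines.one _)
  · have h := π.perm.tensorU_mul_row ρ.perm x y z
    change π.perm.tensorU ρ.perm x y ∘L HTensor.map (π.perm.u x z) 1 = _ at h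
    rw [h]
    exact π.tensorRep_intertwines ρ x z (ρ.perm_intertwines z y)

/-- The tensor product of finite dimensional `X`-free wreath corepresentations. -/
def tensor (π : WreathCorep G X H) (ρ : WreathCorep G X K) : WreathCorep G X (HTensor H K) :=
  ofNormal (π.tensorRep ρ) (π.perm.tensor ρ.perm) (fun x y f => (π.tensor_comm ρ x y f).symm)

theorem tensor_rep (π : WreathCorep G X H) (ρ : WreathCorep G X K) (x : X) (f : G.C0) :
    (π.tensor ρ).rep x f = ∑ᶠ y, (π.ext x).box (ρ.ext y) (G.comul (c0ToFun G.dim f)) *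
      HTensor.map (π.perm.u x y) 1 := rfl

theorem tensor_perm (π : WreathCorep G X H) (ρ : WreathCorep G X K) (x y : X) :
    (π.tensor ρ).perm.u x y = ∑ᶠ z, HTensor.map (π.perm.u x z) (ρ.perm.u z y) := rfl

theorem tensor_ext (π : WreathCorep G X H) (ρ : WreathCorep G X K) (x : X) :
    (π.tensor ρ).ext x = π.tensorRep ρ x := ofNormal_ext _ _ _ x

/-- The trivial `X`-free wreath corepresentation. -/
def unit (G : DiscreteQuantumGroup.{u}) (X : Type v) : WreathCorep G X ℂ :=
  ofNormal (fun _ => NormalRep.counit G) (QuantumPermutation.trivial X) (fun x y f => by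
    by_cases h : x = y
    · subst h
      rw [QuantumPermutation.trivial_self, one_mul, mul_one]
    · rw [QuantumPermutation.trivial_ne h, zero_mul, mul_zero])

theorem unit_ext (x : X) : (unit G X).ext x = NormalRep.counit G := ofNormal_ext _ _ _ x

/-- `T` intertwines the `X`-free wreath corepresentations `π` and `ρ`. -/
structure Intertwines (π : WreathCorep G X H) (ρ : WreathCorep G X K) (T : H →L[ℂ] K) : Prop where
  rep : ∀ x f, T ∘L π.rep x f = ρ.rep x f ∘L T
  perm : ∀ x y, T ∘L π.perm.u x y = ρ.perm.u x y ∘L T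

theorem intertwines_ext {π : WreathCorep G X H} {ρ : WreathCorep G X K} {T : H →L[ℂ] K}
    (hT : π.Intertwines ρ T) (x : X) : (π.ext x).Intertwines (ρ.ext x) T :=
  NormalRep.intertwines_of_block fun i a => by rw [ext_block, ext_block, hT.rep]

theorem intertwines_of_ext {π : WreathCorep G X H} {ρ : WreathCorep G X K} {T : H →L[ℂ] K}
    (h : ∀ x, (π.ext x).Intertwines (ρ.ext x) T)
    (h' : ∀ x y, T ∘L π.perm.u x y = ρ.perm.u x y ∘L T) : π.Intertwines ρ T :=
  ⟨fun x f => by rw [← ext_hom, ← ext_hom, h], h'⟩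

theorem Intertwines.id (π : WreathCorep G X H) : π.Intertwines π (.id ℂ H) :=
  ⟨fun _ _ => rfl, fun _ _ => rfl⟩

theorem Intertwines.comp {π : WreathCorep G X H} {ρ : WreathCorep G X K} {σ : WreathCorep G X L}
    {S : K →L[ℂ] L} {T : H →L[ℂ] K} (hS : ρ.Intertwines σ S) (hT : π.Intertwines ρ T) :
    π.Intertwines σ (S ∘L T) where
  rep x f := by
    rw [ContinuousLinearMap.comp_assoc, hT.rep, ← ContinuousLinearMap.comp_assoc, hS.rep,
      ContinuousLinearMap.comp_assoc]
  perm x y := by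
    rw [ContinuousLinearMap.comp_assoc, hT.perm, ← ContinuousLinearMap.comp_assoc, hS.perm,
      ContinuousLinearMap.comp_assoc]

theorem Intertwines.symm {π : WreathCorep G X H} {ρ : WreathCorep G X K} {e : H ≃ₗᵢ[ℂ] K}
    (h : π.Intertwines ρ (e : H →L[ℂ] K)) : ρ.Intertwines π (e.symm : K →L[ℂ] H) where
  rep x f := by
    ext ξ
    have := congrArg (fun T : H →L[ℂ] K => e.symm (T (e.symm ξ))) (h.rep x f)
    simpa using this.symm
  perm x y := by
    ext ξ
    have := congrArg (fun T : H →L[ℂ] K => e.symm (T (e.symm ξ))) (h.perm x y)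
    simpa using this.symm

theorem Intertwines.map {π : WreathCorep G X H} {π' : WreathCorep G X H'} {ρ : WreathCorep G X K}
    {ρ' : WreathCorep G X K'} {T : H →L[ℂ] H'} {S : K →L[ℂ] K'} (hT : π.Intertwines π' T)
    (hS : ρ.Intertwines ρ' S) : (π.tensor ρ).Intertwines (π'.tensor ρ') (HTensor.map T S) := by
  refine intertwines_of_ext (fun x => ?_) (fun x y => ?_)
  · rw [tensor_ext, tensor_ext]
    refine NormalRep.intertwines_of_pou (P := fun z => HTensor.map (π.perm.u x z) (1 : K →L[ℂ] K))
      (π.perm.row_pou x).map_left (θ := fun z => (π.ext x).mul (ρ.ext z)) (fun z => ?_)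
      (fun z => ?_)
    · exact π.tensorRep_intertwines ρ x z (NormalRep.Intertwines.one _)
    · have h := (π'.tensorRep_intertwines ρ' x z (NormalRep.Intertwines.one _)).comp
        ((intertwines_ext hT x).map (intertwines_ext hS z))
      rw [← HTensor.map_comp, ← hT.perm] at h
      rw [← HTensor.map_comp]
      exact h
  · refine (π.perm.row_pou x).map_left.ext_comp (M := HTensor H' K') fun z => ?_
    have h1 := π.perm.tensorU_mul_row ρ.perm x y z
    have h2 := π'.perm.tensorU_mul_row ρ'.perm x y z
    change (π.tensor ρ).perm.u x y ∘L HTensor.map (π.perm.u x z) 1 = _ at h1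
    change (π'.tensor ρ').perm.u x y ∘L HTensor.map (π'.perm.u x z) 1 = _ at h2
    have h3 : HTensor.map T S ∘L HTensor.map (π.perm.u x z) (1 : K →L[ℂ] K) =
        HTensor.map (π'.perm.u x z) 1 ∘L HTensor.map T S := by
      rw [← HTensor.map_comp, ← HTensor.map_comp, hT.perm]; rfl
    rw [ContinuousLinearMap.comp_assoc, h1, ContinuousLinearMap.comp_assoc, h3,
      ← ContinuousLinearMap.comp_assoc, h2, ← HTensor.map_comp, ← HTensor.map_comp, hT.perm,
      hS.perm]

theorem trivial_row (x y : X) (h : x ≠ y) : (unit G X).perm.u x y = 0 :=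
  QuantumPermutation.trivial_ne h

theorem trivial_diag (x : X) : (unit G X).perm.u x x = 1 := QuantumPermutation.trivial_self x

theorem lid_intertwines (π : WreathCorep G X H) :
    ((unit G X).tensor π).Intertwines π (HTensor.lid H : HTensor ℂ H →L[ℂ] H) := by
  refine intertwines_of_ext (fun x => ?_) (fun x y => ?_)
  · rw [tensor_ext]
    have h1 := (unit G X).tensorRep_intertwines π x x (NormalRep.Intertwines.one _)
    rw [trivial_diag, HTensor.map_one, unit_ext] at h1
    intro f
    have h2 := h1 f
    have h3 : ((unit G X).tensorRep π x).hom f = ((NormalRep.counit G).mul (π.ext x)).hom f :=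
      h2.symm
    rw [h3]
    exact NormalRep.lid_intertwines (π.ext x) f
  · have h1 := (unit G X).perm.tensorU_mul_row π.perm x y x
    rw [trivial_diag, HTensor.map_one, mul_one] at h1
    change _ ∘L (unit G X).perm.tensorU π.perm x y = _
    rw [h1]
    exact HTensor.ext fun c ξ => (map_smul (π.perm.u x y) c ξ).symm

theorem rid_intertwines (π : WreathCorep G X H) :
    (π.tensor (unit G X)).Intertwines π (HTensor.rid H : HTensor H ℂ →L[ℂ] H) := by
  refine intertwines_of_ext (fun x => ?_) (fun x y => ?_)
  · rw [tensor_ext]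
    refine NormalRep.intertwines_of_pou (P := fun z => HTensor.map (π.perm.u x z) (1 : ℂ →L[ℂ] ℂ))
      (π.perm.row_pou x).map_left (θ := fun z => (π.ext x).mul ((unit G X).ext z)) (fun z => ?_)
      (fun z => ?_)
    · exact π.tensorRep_intertwines (unit G X) x z (NormalRep.Intertwines.one _)
    · rw [unit_ext]
      exact (NormalRep.rid_intertwines (π.ext x)).comp
        ((π.perm_intertwines x z).map (NormalRep.Intertwines.one _))
  · refine (π.perm.row_pou x).map_left.ext_comp (M := H) fun z => ?_
    have h1 := π.perm.tensorU_mul_row (unit G X).perm x y z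
    change (π.tensor (unit G X)).perm.u x y ∘L HTensor.map (π.perm.u x z) 1 = _ at h1
    rw [ContinuousLinearMap.comp_assoc, h1]
    by_cases hzy : z = y
    · subst hzy
      rw [trivial_diag]
      refine HTensor.ext fun ξ c => ?_
      change c • π.perm.u x z ξ = π.perm.u x z (c • π.perm.u x z ξ)
      rw [map_smul]
      congr 1
      exact (congrArg (fun T : H →L[ℂ] H => T ξ) (π.perm.isProj x z).isIdempotentElem.eq).symm
    · rw [trivial_row z y hzy, HTensor.map_zero_right, ContinuousLinearMap.comp_zero]
      refine HTensor.ext fun ξ c => ?_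
      change (0 : H) = π.perm.u x y (c • π.perm.u x z ξ)
      have h0 : π.perm.u x y (π.perm.u x z ξ) = 0 :=
        congrArg (fun T : H →L[ℂ] H => T ξ) (π.perm.row_orth x y z (Ne.symm hzy))
      rw [map_smul, h0, smul_zero]

theorem assoc_pou (π : WreathCorep G X H) (ρ : WreathCorep G X K) (L : Type*)
    [NormedAddCommGroup L] [InnerProductSpace ℂ L] (x : X) {M : Type*} [NormedAddCommGroup M]
    [InnerProductSpace ℂ M] {A B : HTensor (HTensor H K) L →L[ℂ] M}
    (h : ∀ y z, A ∘L HTensor.map (HTensor.map (π.perm.u x y) (ρ.perm.u y z)) (1 : L →L[ℂ] L) =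
      B ∘L HTensor.map (HTensor.map (π.perm.u x y) (ρ.perm.u y z)) (1 : L →L[ℂ] L)) : A = B := by
  have h1 : IsPOU fun y => HTensor.map (HTensor.map (π.perm.u x y) (1 : K →L[ℂ] K))
      (1 : L →L[ℂ] L) := (π.perm.row_pou x).map_left.map_left
  refine h1.ext_comp fun y => ?_
  have h2 : IsPOU fun z => HTensor.map (HTensor.map (1 : H →L[ℂ] H) (ρ.perm.u y z))
      (1 : L →L[ℂ] L) := (ρ.perm.row_pou y).map_right.map_left
  refine h2.ext_comp fun z => ?_
  have h3 : HTensor.map (HTensor.map (π.perm.u x y) (1 : K →L[ℂ] K)) (1 : L →L[ℂ] L) ∘L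
      HTensor.map (HTensor.map (1 : H →L[ℂ] H) (ρ.perm.u y z)) (1 : L →L[ℂ] L) =
      HTensor.map (HTensor.map (π.perm.u x y) (ρ.perm.u y z)) (1 : L →L[ℂ] L) := by
    rw [← HTensor.map_comp, ← HTensor.map_comp]; rfl
  rw [ContinuousLinearMap.comp_assoc, ContinuousLinearMap.comp_assoc, h3, h]

theorem assoc_intertwines (π : WreathCorep G X H) (ρ : WreathCorep G X K) (σ : WreathCorep G X L) :
    ((π.tensor ρ).tensor σ).Intertwines (π.tensor (ρ.tensor σ))
      (HTensor.assoc H K L : HTensor (HTensor H K) L →L[ℂ] HTensor H (HTensor K L)) := by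
  have hα : ∀ (A : H →L[ℂ] H) (B : K →L[ℂ] K) (C : L →L[ℂ] L),
      (HTensor.assoc H K L : HTensor (HTensor H K) L →L[ℂ] HTensor H (HTensor K L)) ∘L
        HTensor.map (HTensor.map A B) C = HTensor.map A (HTensor.map B C) ∘L
        (HTensor.assoc H K L : HTensor (HTensor H K) L →L[ℂ] HTensor H (HTensor K L)) :=
    fun A B C => HTensor.ext₃ fun _ _ _ => rfl
  have hE : ∀ x y z w, ((π.tensor ρ).tensor σ).perm.u x w ∘L
      HTensor.map (HTensor.map (π.perm.u x y) (ρ.perm.u y z)) 1 =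
      HTensor.map (HTensor.map (π.perm.u x y) (ρ.perm.u y z)) (σ.perm.u z w) := by
    intro x y z w
    have h1 : (π.tensor ρ).perm.u x z ∘L HTensor.map (π.perm.u x y) (1 : K →L[ℂ] K) =
      HTensor.map (π.perm.u x y) (ρ.perm.u y z) := π.perm.tensorU_mul_row ρ.perm x z y
    have h2 : ((π.tensor ρ).tensor σ).perm.u x w ∘L
      HTensor.map ((π.tensor ρ).perm.u x z) (1 : L →L[ℂ] L) =
      HTensor.map ((π.tensor ρ).perm.u x z) (σ.perm.u z w) :=
      (π.tensor ρ).perm.tensorU_mul_row σ.perm x w z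
    have h3 : HTensor.map (HTensor.map (π.perm.u x y) (ρ.perm.u y z)) (1 : L →L[ℂ] L) =
        HTensor.map ((π.tensor ρ).perm.u x z) (1 : L →L[ℂ] L) ∘L
          HTensor.map (HTensor.map (π.perm.u x y) (1 : K →L[ℂ] K)) (1 : L →L[ℂ] L) := by
      rw [← HTensor.map_comp, h1]; rfl
    rw [h3, ← ContinuousLinearMap.comp_assoc, h2, ← HTensor.map_comp, h1]; rfl
  have hF : ∀ x y z w, (π.tensor (ρ.tensor σ)).perm.u x w ∘L
      HTensor.map (π.perm.u x y) (HTensor.map (ρ.perm.u y z) 1) =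
      HTensor.map (π.perm.u x y) (HTensor.map (ρ.perm.u y z) (σ.perm.u z w)) := by
    intro x y z w
    have h1 : (ρ.tensor σ).perm.u y w ∘L HTensor.map (ρ.perm.u y z) (1 : L →L[ℂ] L) =
      HTensor.map (ρ.perm.u y z) (σ.perm.u z w) := ρ.perm.tensorU_mul_row σ.perm y w z
    have h2 : (π.tensor (ρ.tensor σ)).perm.u x w ∘L
      HTensor.map (π.perm.u x y) (1 : HTensor K L →L[ℂ] HTensor K L) =
      HTensor.map (π.perm.u x y) ((ρ.tensor σ).perm.u y w) :=
      π.perm.tensorU_mul_row (ρ.tensor σ).perm x w y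
    have h3 : HTensor.map (π.perm.u x y) (HTensor.map (ρ.perm.u y z) (1 : L →L[ℂ] L)) =
        HTensor.map (π.perm.u x y) 1 ∘L
          HTensor.map (1 : H →L[ℂ] H) (HTensor.map (ρ.perm.u y z) (1 : L →L[ℂ] L)) := by
      rw [← HTensor.map_comp]; rfl
    rw [h3, ← ContinuousLinearMap.comp_assoc, h2, ← HTensor.map_comp, h1]; rfl
  refine intertwines_of_ext (fun x => ?_) (fun x w => ?_)
  · rw [tensor_ext, tensor_ext]
    intro f
    refine assoc_pou π ρ L x fun y z => ?_
    have h1 : (((π.ext x).mul (ρ.ext y)).mul (σ.ext z)).Intertwines ((π.tensor ρ).tensorRep σ x)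
        (HTensor.map (HTensor.map (π.perm.u x y) (ρ.perm.u y z)) 1) := by
      have h2 := (π.tensor ρ).tensorRep_intertwines σ x z (NormalRep.Intertwines.one _)
      rw [tensor_ext] at h2
      have h3 := h2.comp ((π.tensorRep_intertwines ρ x y (NormalRep.Intertwines.one _)).map
        (NormalRep.Intertwines.one (σ.ext z)))
      have h4 : (π.tensor ρ).perm.u x z ∘L HTensor.map (π.perm.u x y) (1 : K →L[ℂ] K) =
        HTensor.map (π.perm.u x y) (ρ.perm.u y z) := π.perm.tensorU_mul_row ρ.perm x z y
      rw [← HTensor.map_comp, h4] at h3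
      exact h3
    have h2 : ((π.ext x).mul ((ρ.ext y).mul (σ.ext z))).Intertwines (π.tensorRep (ρ.tensor σ) x)
        (HTensor.map (π.perm.u x y) (HTensor.map (ρ.perm.u y z) 1)) := by
      have h2 := π.tensorRep_intertwines (ρ.tensor σ) x y (NormalRep.Intertwines.one _)
      rw [tensor_ext] at h2
      have h3 := h2.comp ((NormalRep.Intertwines.one (π.ext x)).map
        (ρ.tensorRep_intertwines σ y z (NormalRep.Intertwines.one _)))
      rw [← HTensor.map_comp] at h3
      exact h3
    have h3 := h2.comp (NormalRep.assoc_intertwines (π.ext x) (ρ.ext y) (σ.ext z))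
    rw [ContinuousLinearMap.comp_assoc, ← h1 f, ← ContinuousLinearMap.comp_assoc, hα, h3 f,
      ContinuousLinearMap.comp_assoc, hα]
  · refine assoc_pou π ρ L x fun y z => ?_
    rw [ContinuousLinearMap.comp_assoc, hE, hα, ContinuousLinearMap.comp_assoc, hα,
      ← ContinuousLinearMap.comp_assoc, hF]

end WreathCorep

end WreathTensor

section Conjugate

open scoped ComplexConjugate

/-- The conjugate Hilbert space of `H`: a copy of the additive group `H`, whose elements are written
`toConj ξ`, with `c • toConj ξ = toConj (conj c • ξ)` and `⟪toConj ξ, toConj η⟫ = ⟪η, ξ⟫`. -/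
def ConjSpace (H : Type*) : Type _ := H

variable {H : Type*} [NormedAddCommGroup H] [InnerProductSpace ℂ H]

namespace ConjSpace

instance : NormedAddCommGroup (ConjSpace H) := inferInstanceAs (NormedAddCommGroup H)

instance : Module ℂ (ConjSpace H) := Module.compHom H (starRingEnd ℂ)

/-- The vector `ξ̄` of the conjugate space, additively. -/
def mk : H ≃+ ConjSpace H := AddEquiv.refl H

theorem smul_mk (c : ℂ) (ξ : H) : c • mk ξ = mk (conj c • ξ) := rfl

instance : NormedSpace ℂ (ConjSpace H) where
  norm_smul_le c ξ := by
    change ‖conj c • mk.symm ξ‖ ≤ ‖c‖ * ‖mk.symm ξ‖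
    rw [norm_smul, RCLike.norm_conj]

instance : InnerProductSpace ℂ (ConjSpace H) where
  inner ξ η := inner ℂ (mk.symm η) (mk.symm ξ)
  norm_sq_eq_re_inner ξ := norm_sq_eq_re_inner (𝕜 := ℂ) (E := H) ξ
  conj_inner_symm ξ η := inner_conj_symm (𝕜 := ℂ) (E := H) η ξ
  add_left ξ η ζ := inner_add_right (𝕜 := ℂ) (E := H) ζ ξ η
  smul_left ξ η c := inner_smul_right (𝕜 := ℂ) (E := H) η ξ (conj c)

/-- The antiunitary `ξ ↦ ξ̄` from a Hilbert space to its conjugate. -/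
def toConj (H : Type*) [NormedAddCommGroup H] [InnerProductSpace ℂ H] :
    H ≃ₗᵢ⋆[ℂ] ConjSpace H where
  toFun := mk
  invFun := mk.symm
  map_add' _ _ := rfl
  map_smul' c ξ := by
    change mk (c • ξ) = mk (conj (conj c) • ξ)
    rw [Complex.conj_conj]
  left_inv _ := rfl
  right_inv _ := rfl
  norm_map' _ := rfl

theorem inner_toConj (ξ η : H) : inner ℂ (toConj H ξ) (toConj H η) = inner ℂ η ξ := rfl

theorem smul_toConj (c : ℂ) (ξ : H) : c • toConj H ξ = toConj H (conj c • ξ) := rfl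

instance [FiniteDimensional ℂ H] : FiniteDimensional ℂ (ConjSpace H) :=
  Module.Finite.of_surjective (toConj H).toLinearEquiv.toLinearMap (toConj H).surjective

instance [CompleteSpace H] : CompleteSpace (ConjSpace H) := inferInstanceAs (CompleteSpace H)

/-- The operator `ξ̄ ↦ conj (T ξ)` on the conjugate space. -/
def bar (T : H →L[ℂ] H) : ConjSpace H →L[ℂ] ConjSpace H :=
  ((toConj H).toContinuousLinearEquiv : H →L⋆[ℂ] ConjSpace H) ∘SL T ∘SL
    ((toConj H).symm.toContinuousLinearEquiv : ConjSpace H →L⋆[ℂ] H)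

theorem bar_toConj (T : H →L[ℂ] H) (ξ : H) : bar T (toConj H ξ) = toConj H (T ξ) := rfl

theorem bar_zero : bar (0 : H →L[ℂ] H) = 0 := rfl

theorem bar_one : bar (1 : H →L[ℂ] H) = 1 := rfl

theorem bar_mul (S T : H →L[ℂ] H) : bar (S * T) = bar S * bar T := rfl

theorem bar_add (S T : H →L[ℂ] H) : bar (S + T) = bar S + bar T := rfl

theorem bar_smul (c : ℂ) (T : H →L[ℂ] H) : bar (c • T) = conj c • bar T := by
  ext ξ
  change mk (c • T (mk.symm ξ)) = mk (conj (conj c) • T (mk.symm ξ))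
  rw [Complex.conj_conj]

theorem star_bar [CompleteSpace H] (T : H →L[ℂ] H) : star (bar T) = bar (star T) := by
  refine ((ContinuousLinearMap.eq_adjoint_iff (bar (star T)) (bar T)).mpr fun ξ η => ?_).symm
  change inner ℂ (mk.symm η) ((star T) (mk.symm ξ)) = inner ℂ (T (mk.symm η)) (mk.symm ξ)
  exact ContinuousLinearMap.adjoint_inner_right T _ _

theorem bar_sum {ι : Type*} (s : Finset ι) (T : ι → H →L[ℂ] H) :
    bar (∑ i ∈ s, T i) = ∑ i ∈ s, bar (T i) :=
  map_sum (⟨⟨bar, bar_zero⟩, bar_add⟩ : (H →L[ℂ] H) →+ (ConjSpace H →L[ℂ] ConjSpace H)) T s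

theorem isStarProjection_bar [CompleteSpace H] {P : H →L[ℂ] H} (hP : IsStarProjection P) :
    IsStarProjection (bar P) :=
  ⟨by
    change bar P * bar P = bar P
    rw [← bar_mul, hP.isIdempotentElem.eq],
    by
    change star (bar P) = bar P
    rw [star_bar, hP.isSelfAdjoint.star_eq]⟩

theorem pou_bar {ι : Type*} {P : ι → H →L[ℂ] H} (hP : IsPOU P) : IsPOU fun i => bar (P i) := by
  refine ⟨fun i j hij => ?_, ?_⟩
  · rw [← bar_mul, hP.1 i j hij, bar_zero]
  · obtain ⟨s, hs, hsum⟩ := hP.2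
    refine ⟨s, fun i hi => by simp only [hs i hi, bar_zero], ?_⟩
    rw [← bar_sum, hsum, bar_one]

end ConjSpace

end Conjugate

section Contragredient

open scoped Matrix.Norms.L2Operator

universe u v

variable {G : DiscreteQuantumGroup.{u}} {X : Type v} {H : Type*} [NormedAddCommGroup H]
  [InnerProductSpace ℂ H] [FiniteDimensional ℂ H] [CompleteSpace H]

theorem DiscreteQuantumGroup.IsUnitaryAntipode.dependsOn {R : G.Fun →ₗ[ℂ] G.Fun}
    (hR : G.IsUnitaryAntipode R) (k : G.Irr) :
    ∃ s : Finset G.Irr, DependsOn (fun f => R f k) (s : Set G.Irr) := by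
  obtain ⟨F, hF, hS⟩ := hR.polar
  obtain ⟨s, hs⟩ := G.antipode_dependsOn k
  have hF1 : F * F⁻¹ = 1 := funext fun i =>
    Matrix.mul_nonsing_inv _ ((hF i).det_pos.ne'.isUnit)
  have h : ∀ f, R f = G.antipode (F⁻¹ * f * F) := fun f => by
    rw [hS]
    congr 1
    rw [mul_assoc, mul_assoc, mul_assoc, hF1, mul_one, ← mul_assoc, hF1, one_mul]
  refine ⟨s, fun f g hfg => ?_⟩
  change R f k = R g k
  rw [h, h]
  refine hs fun i hi => ?_
  change F⁻¹ i * f i * F i = F⁻¹ i * g i * F i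
  rw [hfg i hi]

namespace NormalRep

/-- The conjugate representation `f ↦ conj (φ (R (f*)))`. -/
def conj (φ : NormalRep G H) {R : G.Fun →ₗ[ℂ] G.Fun} (hR : G.IsUnitaryAntipode R) :
    NormalRep G (ConjSpace H) where
  hom :=
    { toFun f := ConjSpace.bar (φ.hom (R (star f)))
      map_one' := by rw [star_one, hR.map_one, _root_.map_one, ConjSpace.bar_one]
      map_mul' f g := by rw [star_mul, hR.map_mul, _root_.map_mul, ConjSpace.bar_mul]
      map_zero' := by rw [star_zero, _root_.map_zero, _root_.map_zero, ConjSpace.bar_zero]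
      map_add' f g := by rw [star_add, map_add, map_add, ConjSpace.bar_add]
      commutes' c := by
        rw [Algebra.algebraMap_eq_smul_one, star_smul, star_one, map_smul, hR.map_one, map_smul,
          _root_.map_one, ConjSpace.bar_smul, ConjSpace.bar_one, Algebra.algebraMap_eq_smul_one]
        congr 1
        exact star_star c
      map_star' f := by
        rw [hR.map_star, map_star, ConjSpace.star_bar] }
  dep := by
    classical
    obtain ⟨s, hs⟩ := φ.dep
    choose t ht using hR.dependsOn
    refine ⟨s.biUnion t, fun f g hfg => ?_⟩
    change ConjSpace.bar (φ.hom (R (star f))) = ConjSpace.bar (φ.hom (R (star g)))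
    congr 1
    refine hs fun k hk => ht k fun i hi => ?_
    change star (f i) = star (g i)
    rw [hfg i (Finset.mem_coe.mpr (Finset.mem_biUnion.mpr ⟨k, hk, hi⟩))]

theorem conj_hom (φ : NormalRep G H) {R : G.Fun →ₗ[ℂ] G.Fun} (hR : G.IsUnitaryAntipode R)
    (f : G.Fun) : (φ.conj hR).hom f = ConjSpace.bar (φ.hom (R (star f))) := rfl

end NormalRep

/-- The conjugate `ū_{xy} = conj (u_{yx})` of a quantum permutation. -/
def QuantumPermutation.conj (q : QuantumPermutation X H) : QuantumPermutation X (ConjSpace H) :=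
  ofPOU (fun x y => ConjSpace.bar (q.u y x))
    (fun x y => ConjSpace.isStarProjection_bar (q.isProj y x))
    (fun x => ConjSpace.pou_bar (q.col_pou x)) (fun y => ConjSpace.pou_bar (q.row_pou y))

namespace WreathCorep

theorem conj_comm (π : WreathCorep G X H) {R : G.Fun →ₗ[ℂ] G.Fun} (hR : G.IsUnitaryAntipode R)
    (x y : X) (f : G.Fun) : ((π.ext y).conj hR).hom f * ConjSpace.bar (π.perm.u y x) =
      ConjSpace.bar (π.perm.u y x) * ((π.ext y).conj hR).hom f := by
  rw [NormalRep.conj_hom, ← ConjSpace.bar_mul, π.ext_comm, ConjSpace.bar_mul]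

/-- The representation `f ↦ ∑ y, conj (π^G_y(R(f*)) π^X_{yx})`. -/
def contragredientRep (π : WreathCorep G X H) {R : G.Fun →ₗ[ℂ] G.Fun} (hR : G.IsUnitaryAntipode R)
    (x : X) : NormalRep G (ConjSpace H) :=
  NormalRep.glueProj (fun y => (π.ext y).conj hR) (fun y => ConjSpace.bar (π.perm.u y x))
    (ConjSpace.pou_bar (π.perm.col_pou x))
    (fun y => ConjSpace.isStarProjection_bar (π.perm.isProj y x)) (π.conj_comm hR x)

theorem contragredient_comm (π : WreathCorep G X H) {R : G.Fun →ₗ[ℂ] G.Fun}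
    (hR : G.IsUnitaryAntipode R) (x y : X) (f : G.Fun) :
    (π.contragredientRep hR x).hom f * ConjSpace.bar (π.perm.u y x) =
      ConjSpace.bar (π.perm.u y x) * (π.contragredientRep hR x).hom f := by
  have h1 := NormalRep.glueProj_mul (fun y => (π.ext y).conj hR)
    (fun y => ConjSpace.bar (π.perm.u y x)) (ConjSpace.pou_bar (π.perm.col_pou x))
    (fun y => ConjSpace.isStarProjection_bar (π.perm.isProj y x)) (π.conj_comm hR x) f y
  have h2 := NormalRep.mul_glueProj (fun y => (π.ext y).conj hR)
    (fun y => ConjSpace.bar (π.perm.u y x)) (ConjSpace.pou_bar (π.perm.col_pou x))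
    (fun y => ConjSpace.isStarProjection_bar (π.perm.isProj y x)) (π.conj_comm hR x) f y
  exact h1.trans h2.symm

/-- The contragredient of a finite dimensional `X`-free wreath corepresentation `π` of `G`, with
respect to the unitary antipode `R` of `G`. -/
def contragredient (π : WreathCorep G X H) {R : G.Fun →ₗ[ℂ] G.Fun} (hR : G.IsUnitaryAntipode R) :
    WreathCorep G X (ConjSpace H) :=
  ofNormal (π.contragredientRep hR) π.perm.conj (fun x y f => π.contragredient_comm hR x y f)

/-- `π̄^G_x(f)ξ̄ = ∑ y, conj (π^G_y(R(f*)) π^X_{yx} ξ)`. -/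
theorem contragredient_rep (π : WreathCorep G X H) {R : G.Fun →ₗ[ℂ] G.Fun}
    (hR : G.IsUnitaryAntipode R) (x : X) (f : G.C0) (ξ : H) :
    (π.contragredient hR).rep x f (ConjSpace.toConj H ξ) = ∑ᶠ y, ConjSpace.toConj H
      ((π.ext y).hom (R (star (c0ToFun G.dim f))) (π.perm.u y x ξ)) := by
  obtain ⟨s, hs, -⟩ := (π.perm.col_pou x).2
  have hs' : ∀ y, y ∉ s → π.perm.u y x = 0 := hs
  have h1 : (π.contragredient hR).rep x f = ∑ᶠ y, ConjSpace.bar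
      ((π.ext y).hom (R (star (c0ToFun G.dim f)))) * ConjSpace.bar (π.perm.u y x) := rfl
  rw [h1, finsum_eq_sum_of_support_subset (s := s) _ (fun y hy => by
    by_contra h
    refine hy ?_
    dsimp only
    rw [hs' y h, ConjSpace.bar_zero, mul_zero]), ContinuousLinearMap.sum_apply,
    finsum_eq_sum_of_support_subset (s := s) _ (fun y hy => by
    by_contra h
    refine hy ?_
    dsimp only
    rw [hs' y h, ContinuousLinearMap.zero_apply, map_zero, map_zero])]
  rfl

/-- `π̄^X_{xy}ξ̄ = conj (π^X_{yx} ξ)`. -/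
theorem contragredient_perm (π : WreathCorep G X H) {R : G.Fun →ₗ[ℂ] G.Fun}
    (hR : G.IsUnitaryAntipode R) (x y : X) (ξ : H) :
    (π.contragredient hR).perm.u x y (ConjSpace.toConj H ξ) =
      ConjSpace.toConj H (π.perm.u y x ξ) := rfl

end WreathCorep

end Contragredient

section FreeWreathCategory

open CategoryTheory
open scoped Matrix.Norms.L2Operator

universe u v

/-- A finite dimensional `X`-free wreath corepresentation of `G`: an object of the category
`Corep(G) ≀_* Sym⁺(X)`. -/
structure FreeWreath (G : DiscreteQuantumGroup.{u}) (X : Type v) where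
  space : Type
  [normed : NormedAddCommGroup space]
  [inner : InnerProductSpace ℂ space]
  [finite : FiniteDimensional ℂ space]
  [complete : CompleteSpace space]
  corep : WreathCorep G X space

namespace FreeWreath

attribute [instance] normed inner finite complete

variable {G : DiscreteQuantumGroup.{u}} {X : Type v}

/-- An intertwiner of `X`-free wreath corepresentations. -/
@[ext]
structure Hom (π ρ : FreeWreath G X) where
  op : π.space →L[ℂ] ρ.space
  intertwines : π.corep.Intertwines ρ.corep op

instance : Category (FreeWreath G X) where
  Hom := Hom
  id π := ⟨.id ℂ _, .id _⟩
  comp f g := ⟨g.op ∘L f.op, g.intertwines.comp f.intertwines⟩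

/-- The operator underlying a morphism. -/
def op {π ρ : FreeWreath G X} (f : π ⟶ ρ) : π.space →L[ℂ] ρ.space := Hom.op f

theorem op_intertwines {π ρ : FreeWreath G X} (f : π ⟶ ρ) :
    π.corep.Intertwines ρ.corep (op f) := Hom.intertwines f

theorem hom_ext {π ρ : FreeWreath G X} {f g : π ⟶ ρ} (h : op f = op g) : f = g := Hom.ext h

theorem op_comp {π ρ σ : FreeWreath G X} (f : π ⟶ ρ) (g : ρ ⟶ σ) :
    op (f ≫ g) = op g ∘L op f := rfl

theorem op_id (π : FreeWreath G X) : op (𝟙 π) = .id ℂ π.space := rfl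

/-- The isomorphism given by a unitary intertwiner. -/
def isoOfUnitary {π ρ : FreeWreath G X} (e : π.space ≃ₗᵢ[ℂ] ρ.space)
    (h : π.corep.Intertwines ρ.corep (e : π.space →L[ℂ] ρ.space)) : π ≅ ρ where
  hom := ⟨e, h⟩
  inv := ⟨e.symm, h.symm⟩
  hom_inv_id := hom_ext (by ext ξ; exact e.symm_apply_apply ξ)
  inv_hom_id := hom_ext (by ext ξ; exact e.apply_symm_apply ξ)

instance : MonoidalCategoryStruct (FreeWreath G X) where
  tensorObj π ρ := ⟨HTensor π.space ρ.space, π.corep.tensor ρ.corep⟩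
  tensorHom f g := ⟨HTensor.map (op f) (op g), (op_intertwines f).map (op_intertwines g)⟩
  whiskerLeft π _ _ g := ⟨HTensor.map (.id ℂ π.space) (op g),
    (WreathCorep.Intertwines.id π.corep).map (op_intertwines g)⟩
  whiskerRight f ρ := ⟨HTensor.map (op f) (.id ℂ ρ.space),
    (op_intertwines f).map (WreathCorep.Intertwines.id ρ.corep)⟩
  tensorUnit := ⟨ℂ, WreathCorep.unit G X⟩
  associator π ρ σ := isoOfUnitary (HTensor.assoc π.space ρ.space σ.space)
    (WreathCorep.assoc_intertwines π.corep ρ.corep σ.corep)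
  leftUnitor π := isoOfUnitary (HTensor.lid π.space) (WreathCorep.lid_intertwines π.corep)
  rightUnitor π := isoOfUnitary (HTensor.rid π.space) (WreathCorep.rid_intertwines π.corep)

instance : MonoidalCategory (FreeWreath G X) :=
  MonoidalCategory.ofTensorHom
    (id_tensorHom_id := fun _ _ => hom_ext HTensor.map_id)
    (id_tensorHom := fun _ _ _ _ => rfl)
    (tensorHom_id := fun _ _ => rfl)
    (tensorHom_comp_tensorHom := fun _ _ _ _ => hom_ext (HTensor.map_comp _ _ _ _).symm)
    (associator_naturality := fun _ _ _ => hom_ext (HTensor.ext₃ fun _ _ _ => rfl))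
    (leftUnitor_naturality := fun f => hom_ext (HTensor.lid_naturality (op f)))
    (rightUnitor_naturality := fun f => hom_ext (HTensor.rid_naturality (op f)))
    (pentagon := fun _ _ _ _ => hom_ext (HTensor.ext₄ fun _ _ _ _ => rfl))
    (triangle := fun _ _ => hom_ext (HTensor.ext₃ fun ξ c η => HTensor.tmul_smul' c ξ η))

/-- The contragredient, as an object of the category. -/
def contragredient (π : FreeWreath G X) {R : G.Fun →ₗ[ℂ] G.Fun} (hR : G.IsUnitaryAntipode R) :
    FreeWreath G X :=
  ⟨ConjSpace π.space, π.corep.contragredient hR⟩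

end FreeWreath

end FreeWreathCategory

end

open CategoryTheory

universe u v

/-! Everything rests on one fact: unimodularity forces the antipode `S` to be involutive and
*-preserving. Then `S` is the only unitary antipode, and the ordinary Hilbert space pairing between
`H` and its conjugate is an intertwiner.

The fact is proved with the central projection `p` of the trivial block, which satisfies `fp = ε(f)p
= pf`. A character is nonzero on a full matrix algebra only in size one, so such a `p` exists. Since
`Δ(p)` absorbs `Δ(f)` up to the scalar `ε(f)`, the antipode axioms give `Δ(p)(a ⊗ 1) = Δ(p)(1 ⊗
S(a))` and `(1 ⊗ a)Δ(p) = (S(a) ⊗ 1)Δ(p)`. Invariance gives `(id ⊗ φ)Δ(p) = c1 = (φ ⊗ id)Δ(p)` with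
`c = φ(p) ≠ 0`, so elements can be recovered from these identities by slicing. Comparing the second
identity, starred, with the first yields `S(S(a)*) = a*`. With `σ` defined by `φ(ay) = φ(yσ(a))`,
slicing on the right yields `S² = σ`, and slicing on the left, with the same `φ` and `σ`, yields `S⁴
= 1`. On `y = S²(a) - a` one has `σ(y) = -y`, so `φ(yy*) = -φ(y*y)`; positivity and faithfulness
give `y = 0`.

Uniqueness: if `S = R ∘ Ad F` and `S` preserves the star, then `Ad F = Ad F⁻¹`, so `F²` is central,
hence so is the positive `F`, and `S = R`.

Duality: for an antiunitary `J : H → K` that identifies `ρ` with the conjugate of `π`, set `ev(Jξ ⊗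
η) = ⟪ξ, η⟫`. Equivariance for `G` is the axiom `m(S ⊗ id)Δ(f) = ε(f)1` read through this pairing;
equivariance for the quantum permutations is orthogonality of projections in a row. The relation
between `π`, `ρ` and `J` is symmetric, so `J⁻¹` gives the evaluation in the other order, and
coevaluations are adjoints of evaluations. The zig-zag equations are the expansion of a vector in an
orthonormal basis. -/

open scoped TensorProduct ComplexOrder

/-! ### Finite sums over blocks, and characters of matrix algebras -/

section BlockSums

theorem finsum_eq_sum_of_notMem {ι M : Type*} [AddCommMonoid M] {f : ι → M} {s : Finset ι}
    (h : ∀ i, i ∉ s → f i = 0) : ∑ᶠ i, f i = ∑ i ∈ s, f i :=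
  finsum_eq_sum_of_support_subset _ fun i hi => by
    by_contra h'
    exact hi (h i h')

theorem sum_lTensor_apply {ι M N P : Type*} [AddCommGroup M] [Module ℂ M] [AddCommGroup N]
    [Module ℂ N] [AddCommGroup P] [Module ℂ P] (s : Finset ι) (T : ι → N →ₗ[ℂ] P)
    (x : TensorProduct ℂ M N) :
    ∑ i ∈ s, (T i).lTensor M x = (∑ i ∈ s, T i).lTensor M x := by
  change _ = LinearMap.lTensorHom (R := ℂ) M (∑ i ∈ s, T i) x
  rw [map_sum, LinearMap.sum_apply]
  rfl

theorem sum_rTensor_apply {ι M N P : Type*} [AddCommGroup M] [Module ℂ M] [AddCommGroup N]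
    [Module ℂ N] [AddCommGroup P] [Module ℂ P] (s : Finset ι) (T : ι → N →ₗ[ℂ] P)
    (x : TensorProduct ℂ N M) :
    ∑ i ∈ s, (T i).rTensor M x = (∑ i ∈ s, T i).rTensor M x := by
  change _ = LinearMap.rTensorHom (R := ℂ) M (∑ i ∈ s, T i) x
  rw [map_sum, LinearMap.sum_apply]
  rfl

variable {I : Type*} {d : I → ℕ}

theorem mul_blockIncl_one (f : MatFun d) (i : I) : f * blockIncl d i 1 = blockIncl d i (f i) := by
  classical
  ext1 k
  by_cases hk : k = i
  · subst hk; simp [blockIncl]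
  · simp [blockIncl, Pi.single_eq_of_ne hk]

theorem blockIncl_one_mul (f : MatFun d) (i : I) : blockIncl d i 1 * f = blockIncl d i (f i) := by
  classical
  ext1 k
  by_cases hk : k = i
  · subst hk; simp [blockIncl]
  · simp [blockIncl, Pi.single_eq_of_ne hk]

theorem star_blockIncl (i : I) (a : MatBlock d i) :
    star (blockIncl d i a) = blockIncl d i (star a) :=
  (map_star (blockHom d i) a).symm

theorem blockIncl_apply_self (i : I) (a : MatBlock d i) : blockIncl d i a i = a := by
  classical
  simp [blockIncl]

theorem blockIncl_apply_ne {i j : I} (h : j ≠ i) (a : MatBlock d i) : blockIncl d i a j = 0 := by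
  classical
  simp [blockIncl, Pi.single_eq_of_ne h]

/-- A linear map depending on finitely many blocks vanishes on the other blocks. -/
theorem DependsOn.comp_blockIncl_eq_zero {V : Type*} [AddCommGroup V] [Module ℂ V]
    {T : MatFun d →ₗ[ℂ] V} {s : Finset I} (hs : DependsOn T (s : Set I)) {l : I} (hl : l ∉ s) :
    T ∘ₗ blockIncl d l = 0 := by
  ext1 a
  rw [LinearMap.comp_apply, LinearMap.zero_apply, ← map_zero T]
  exact hs fun j hj => blockIncl_apply_ne (ne_of_mem_of_not_mem hj hl) a

/-- A linear map depending on finitely many blocks is the sum of its restrictions to them. -/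
theorem DependsOn.eq_sum_blockIncl {V : Type*} [AddCommGroup V] [Module ℂ V]
    {T : MatFun d →ₗ[ℂ] V} {s t : Finset I} (hs : DependsOn T (s : Set I)) (hst : s ⊆ t)
    (f : MatFun d) : T f = ∑ l ∈ t, T (blockIncl d l (f l)) := by
  classical
  rw [← map_sum]
  refine hs fun i hi => ?_
  rw [Finset.sum_apply, Finset.sum_eq_single_of_mem i (hst hi), blockIncl_apply_self]
  exact fun j _ hj => blockIncl_apply_ne (Ne.symm hj) _

/-- A character of a full matrix algebra forces the algebra to be one-dimensional. -/
theorem subsingleton_of_character {n : ℕ} (χ : Matrix (Fin n) (Fin n) ℂ →ₗ[ℂ] ℂ)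
    (hmul : ∀ a b, χ (a * b) = χ a * χ b) (hone : χ 1 ≠ 0) : Subsingleton (Fin n) := by
  classical
  refine ⟨fun i j => ?_⟩
  by_contra hij
  refine hone ?_
  -- For `m ≠ k` the matrix unit `e_km` has square zero, so `χ` kills it, and with it the product
  -- `e_km e_mk = e_kk`. Summing over `k` contradicts `χ 1 ≠ 0`.
  have hsq : ∀ k, χ (Matrix.single k k 1) = 0 := fun k => by
    obtain ⟨m, hm⟩ : ∃ m, m ≠ k := by
      by_cases h : i = k
      · exact ⟨j, fun h' => hij (h.trans h'.symm)⟩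
      · exact ⟨i, h⟩
    have h1 : χ (Matrix.single k k 1) = χ (Matrix.single k m 1) * χ (Matrix.single m k 1) := by
      rw [← hmul, Matrix.single_mul_single_same, one_mul]
    have h2 : χ (Matrix.single k m 1) * χ (Matrix.single k m 1) = 0 := by
      rw [← hmul, Matrix.single_mul_single_of_ne _ _ _ _ hm, map_zero]
    rw [h1, mul_self_eq_zero.mp h2, zero_mul]
  rw [← Matrix.sum_single_one, map_sum]
  exact Finset.sum_eq_zero fun k _ => hsq k

end BlockSums

/-! ### The projection onto the trivial block and its two antipode identities -/

namespace DiscreteQuantumGroup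

variable (G : DiscreteQuantumGroup.{u})

/-- The restriction of the counit to a block. -/
noncomputable abbrev counitBlock (l : G.Irr) : G.Block l →ₗ[ℂ] ℂ :=
  G.counit.toAlgHom.toLinearMap ∘ₗ blockIncl G.dim l

/-- The `(i, j)`-component of the comultiplication on a block. -/
noncomputable abbrev comulBlock (i j l : G.Irr) : G.Block l →ₗ[ℂ] G.Block i ⊗[ℂ] G.Block j :=
  LinearMap.proj (φ := fun p : G.Irr × G.Irr => G.Block p.1 ⊗[ℂ] G.Block p.2) (i, j) ∘ₗ
    G.comul.toAlgHom.toLinearMap ∘ₗ blockIncl G.dim l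

/-- The `k`-component of the antipode on a block. -/
noncomputable abbrev antipodeBlock (k l : G.Irr) : G.Block l →ₗ[ℂ] G.Block k :=
  LinearMap.proj k ∘ₗ G.antipode ∘ₗ blockIncl G.dim l

theorem counitBlock_left {e : Finset G.Irr} (he : ∀ l, l ∉ e → G.counitBlock l = 0) (f : G.Fun)
    (j : G.Irr) : ∑ i ∈ e, TensorProduct.lid ℂ (G.Block j)
      ((G.counitBlock i).rTensor (G.Block j) (G.comul f (i, j))) = f j :=
  (finsum_eq_sum_of_notMem fun i hi => by
    rw [he i hi, LinearMap.rTensor_zero, LinearMap.zero_apply, map_zero]).symm.trans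
      (G.counit_left f j)

theorem counitBlock_right {e : Finset G.Irr} (he : ∀ l, l ∉ e → G.counitBlock l = 0) (f : G.Fun)
    (i : G.Irr) : ∑ j ∈ e, TensorProduct.rid ℂ (G.Block i)
      ((G.counitBlock j).lTensor (G.Block i) (G.comul f (i, j))) = f i :=
  (finsum_eq_sum_of_notMem fun j hj => by
    rw [he j hj, LinearMap.lTensor_zero, LinearMap.zero_apply, map_zero]).symm.trans
      (G.counit_right f i)

theorem antipodeBlock_left {k : G.Irr} {s : Finset G.Irr}
    (hs : ∀ l, l ∉ s → G.antipodeBlock k l = 0) (f : G.Fun) :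
    ∑ i ∈ s, LinearMap.mul' ℂ (G.Block k)
      ((G.antipodeBlock k i).rTensor (G.Block k) (G.comul f (i, k))) = G.counit f • 1 :=
  (finsum_eq_sum_of_notMem fun i hi => by
    rw [hs i hi, LinearMap.rTensor_zero, LinearMap.zero_apply, map_zero]).symm.trans
      (G.antipode_left f k)

theorem antipodeBlock_right {k : G.Irr} {s : Finset G.Irr}
    (hs : ∀ l, l ∉ s → G.antipodeBlock k l = 0) (f : G.Fun) :
    ∑ j ∈ s, LinearMap.mul' ℂ (G.Block k)
      ((G.antipodeBlock k j).lTensor (G.Block k) (G.comul f (k, j))) = G.counit f • 1 :=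
  (finsum_eq_sum_of_notMem fun j hj => by
    rw [hs j hj, LinearMap.lTensor_zero, LinearMap.zero_apply, map_zero]).symm.trans
      (G.antipode_right f k)

/-- Coassociativity as an identity of finite sums. -/
theorem comulBlock_coassoc {i j k : G.Irr} {q : Finset G.Irr}
    (hl : ∀ l, l ∉ q → G.comulBlock i j l = 0) (hr : ∀ l, l ∉ q → G.comulBlock j k l = 0)
    (f : G.Fun) : TensorProduct.assoc ℂ (G.Block i) (G.Block j) (G.Block k)
      (∑ l ∈ q, (G.comulBlock i j l).rTensor (G.Block k) (G.comul f (l, k))) =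
      ∑ l ∈ q, (G.comulBlock j k l).lTensor (G.Block i) (G.comul f (i, l)) := by
  rw [← finsum_eq_sum_of_notMem fun l h => by
      rw [hl l h, LinearMap.rTensor_zero, LinearMap.zero_apply],
    ← finsum_eq_sum_of_notMem fun l h => by
      rw [hr l h, LinearMap.lTensor_zero, LinearMap.zero_apply]]
  exact G.coassoc f i j k

theorem exists_counitBlock_eq_zero : ∃ s : Finset G.Irr, ∀ l, l ∉ s → G.counitBlock l = 0 := by
  obtain ⟨s, hs⟩ := G.counit_dependsOn
  exact ⟨s, fun l hl => DependsOn.comp_blockIncl_eq_zero (T := G.counit.toAlgHom.toLinearMap) hs hl⟩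

theorem exists_antipodeBlock (k : G.Irr) : ∃ s : Finset G.Irr,
    (∀ l, l ∉ s → G.antipodeBlock k l = 0) ∧ ∀ t, s ⊆ t → ∀ f,
      G.antipode f k = ∑ l ∈ t, G.antipodeBlock k l (f l) := by
  obtain ⟨s, hs⟩ := G.antipode_dependsOn k
  exact ⟨s, fun l hl =>
    DependsOn.comp_blockIncl_eq_zero (T := LinearMap.proj k ∘ₗ G.antipode) hs hl,
    fun t ht f => DependsOn.eq_sum_blockIncl (T := LinearMap.proj k ∘ₗ G.antipode) hs ht f⟩

/-- The unit `p` of the block of the trivial corepresentation satisfies `fp = ε(f)p = pf`. -/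
theorem exists_trivial_block : ∃ i : G.Irr,
    (∀ f, f * blockIncl G.dim i 1 = G.counit f • blockIncl G.dim i 1) ∧
    ∀ f, blockIncl G.dim i 1 * f = G.counit f • blockIncl G.dim i 1 := by
  obtain ⟨s, hs⟩ := G.counit_dependsOn
  -- The counit sees only finitely many blocks, so `1 = ε(1)` is a finite sum of its values on the
  -- units of blocks, and one of these is nonzero.
  obtain ⟨i, hi⟩ : ∃ i, G.counit (blockIncl G.dim i 1) ≠ 0 := by
    by_contra! h
    have h1 := DependsOn.eq_sum_blockIncl (T := G.counit.toAlgHom.toLinearMap) hs subset_rfl 1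
    have h2 : G.counit 1 = ∑ l ∈ s, G.counit (blockIncl G.dim l 1) := h1
    rw [map_one, Finset.sum_eq_zero fun l _ => h l] at h2
    exact one_ne_zero h2
  have hidem : G.counit (blockIncl G.dim i 1) = 1 := by
    have h := map_mul G.counit (blockIncl G.dim i 1) (blockIncl G.dim i 1)
    rw [mul_blockIncl_one, blockIncl_apply_self] at h
    exact (mul_eq_left₀ hi).mp h.symm
  have hsub : Subsingleton (Fin (G.dim i)) :=
    subsingleton_of_character (G.counitBlock i) (fun a b => by
      change G.counit (blockHom G.dim i (a * b)) =
        G.counit (blockHom G.dim i a) * G.counit (blockHom G.dim i b)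
      rw [map_mul, map_mul]) hi
  -- The block has size one, so `f i` is a scalar; this scalar is `ε(f)` because `ε(f) = ε(f)ε(p) =
  -- ε(fp)`.
  have key : ∀ f : G.Fun, blockIncl G.dim i (f i) = G.counit f • blockIncl G.dim i 1 := fun f => by
    have h1 : f i = f i ⟨0, G.dim_pos i⟩ ⟨0, G.dim_pos i⟩ • (1 : G.Block i) := by
      ext a b
      rw [Subsingleton.elim a ⟨0, G.dim_pos i⟩, Subsingleton.elim b ⟨0, G.dim_pos i⟩]
      simp
    have h2 : G.counit f = G.counit (blockIncl G.dim i (f i)) := by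
      rw [← mul_blockIncl_one, map_mul, hidem, mul_one]
    rw [h1, map_smul] at h2
    rw [h1, map_smul, h2, map_smul, hidem, smul_eq_mul, mul_one]
  exact ⟨i, fun f => (mul_blockIncl_one f i).trans (key f),
    fun f => (blockIncl_one_mul f i).trans (key f)⟩

/-- `Δ(p)(a ⊗ 1) = Δ(p)(1 ⊗ S(a))` if `pf = ε(f)p` for all `f`. -/
theorem comul_mul_tmul_one {p : G.Fun} (hp : ∀ f, p * f = G.counit f • p) (a : G.Fun)
    (i j : G.Irr) :
    G.comul p (i, j) * (a i ⊗ₜ[ℂ] 1) = G.comul p (i, j) * (1 ⊗ₜ[ℂ] G.antipode a j) := by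
  classical
  obtain ⟨s, hs, hsum⟩ := G.exists_antipodeBlock j
  obtain ⟨e, he⟩ := G.exists_counitBlock_eq_zero
  choose w hw using fun p => NormalRep.comul_block_eq_zero (G := G) p
  -- In Sweedler notation the argument is `Δ(p)(a ⊗ 1) = Δ(p)(a₁ ⊗ a₂S(a₃)) = Δ(p)Δ(a₁)(1 ⊗ S(a₂)) =
  -- Δ(p)(1 ⊗ S(a))`. The set `q` is large enough for the counit and all the comultiplication
  -- components involved to vanish outside it, so that every sum over the intermediate block `l` may
  -- run over `q`.
  set q : Finset G.Irr := e ∪ w (i, j) ∪ s.biUnion fun k => w (j, k) with hq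
  have hqe : ∀ l, l ∉ q → G.counitBlock l = 0 := fun l hl => he l fun h => hl (by simp [hq, h])
  have hqw : ∀ l, l ∉ q → G.comulBlock i j l = 0 := fun l hl =>
    hw (i, j) l fun h => hl (by simp [hq, h])
  have hqs : ∀ k ∈ s, ∀ l, l ∉ q → G.comulBlock j k l = 0 := fun k hk l hl =>
    hw (j, k) l fun h => hl (Finset.mem_union_right _ (Finset.mem_biUnion.mpr ⟨k, hk, h⟩))
  let B : ∀ k, G.Block j ⊗[ℂ] G.Block k →ₗ[ℂ] G.Block j := fun k =>
    LinearMap.mul' ℂ (G.Block j) ∘ₗ (G.antipodeBlock j k).lTensor (G.Block j)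
  have hB : ∀ l, ∑ k ∈ s, B k ∘ₗ G.comulBlock j k l =
      (G.counitBlock l).smulRight (1 : G.Block j) := fun l => by
    ext1 v
    rw [LinearMap.sum_apply]
    exact G.antipodeBlock_right hs (blockIncl G.dim l v)
  -- This is `a₁ ⊗ a₂S(a₃) = a ⊗ 1`: the antipode axiom collapses the last two legs to a counit,
  -- which the counit axiom then removes.
  have hR : ∑ k ∈ s, (B k).lTensor (G.Block i) (∑ l ∈ q,
      (G.comulBlock j k l).lTensor (G.Block i) (G.comul a (i, l))) = a i ⊗ₜ[ℂ] 1 := by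
    simp only [map_sum]
    rw [Finset.sum_comm, ← G.counitBlock_right hqe a i, TensorProduct.sum_tmul]
    refine Finset.sum_congr rfl fun l _ => ?_
    have h1 : ∀ k, (B k).lTensor (G.Block i)
        ((G.comulBlock j k l).lTensor (G.Block i) (G.comul a (i, l))) =
        (B k ∘ₗ G.comulBlock j k l).lTensor (G.Block i) (G.comul a (i, l)) := fun k => by
      rw [LinearMap.lTensor_comp (G.Block i) (B k), LinearMap.comp_apply]
    simp only [h1]
    rw [sum_lTensor_apply, hB l]
    induction G.comul a (i, l) using TensorProduct.induction_on with
    | zero => simp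
    | add x y hx hy => simp only [map_add, hx, hy, TensorProduct.add_tmul]
    | tmul x y =>
      rw [LinearMap.lTensor_tmul, LinearMap.lTensor_tmul, LinearMap.smulRight_apply,
        TensorProduct.rid_tmul, TensorProduct.smul_tmul]
  rw [← hR, Finset.mul_sum, hsum s subset_rfl, TensorProduct.tmul_sum, Finset.mul_sum]
  refine Finset.sum_congr rfl fun k hk => ?_
  -- Coassociativity makes the first two legs a `Δ(a₁)`, ready to meet `Δ(p)`; on the other side `a
  -- k` is written as `(ε ⊗ id)Δ(a)`. Both sides are then sums over the same blocks `l`, and agree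
  -- term by term.
  rw [← G.comulBlock_coassoc hqw (hqs k hk), ← G.counitBlock_left hqe a k]
  simp only [map_sum, Finset.mul_sum, TensorProduct.tmul_sum]
  refine Finset.sum_congr rfl fun l _ => ?_
  induction G.comul a (l, k) using TensorProduct.induction_on with
  | zero => simp
  | add x y hx hy => simp only [map_add, mul_add, hx, hy, TensorProduct.tmul_add]
  | tmul x z =>
    have h4 : ∀ y : G.Block i ⊗[ℂ] G.Block j, (B k).lTensor (G.Block i)
        (TensorProduct.assoc ℂ (G.Block i) (G.Block j) (G.Block k) (y ⊗ₜ[ℂ] z)) =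
          y * (1 ⊗ₜ[ℂ] G.antipodeBlock j k z) := by
      intro y
      induction y using TensorProduct.induction_on with
      | zero => simp
      | add x y hx hy => simp only [TensorProduct.add_tmul, map_add, add_mul, hx, hy]
      | tmul x y => simp [B]
    -- The only use of the hypothesis on `p`: multiplicativity of `Δ` gives `Δ(p)Δ(x) = Δ(px) =
    -- ε(x)Δ(p)`.
    have h5 : G.comul p (i, j) * G.comulBlock i j l x =
        G.counitBlock l x • G.comul p (i, j) := by
      change (G.comul p * G.comul (blockIncl G.dim l x)) (i, j) = _
      rw [← map_mul, hp, map_smul]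
      rfl
    rw [LinearMap.rTensor_tmul, LinearMap.rTensor_tmul, h4, ← mul_assoc, h5,
      TensorProduct.lid_tmul, map_smul, TensorProduct.tmul_smul, smul_mul_assoc, mul_smul_comm]

/-- `(1 ⊗ a)Δ(p) = (S(a) ⊗ 1)Δ(p)` if `fp = ε(f)p` for all `f`. -/
theorem one_tmul_mul_comul {p : G.Fun} (hp : ∀ f, f * p = G.counit f • p) (a : G.Fun)
    (i j : G.Irr) :
    (1 ⊗ₜ[ℂ] a j) * G.comul p (i, j) = (G.antipode a i ⊗ₜ[ℂ] 1) * G.comul p (i, j) := by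
  classical
  obtain ⟨s, hs, hsum⟩ := G.exists_antipodeBlock i
  obtain ⟨e, he⟩ := G.exists_counitBlock_eq_zero
  choose w hw using fun p => NormalRep.comul_block_eq_zero (G := G) p
  -- The mirror image of the previous computation, with the other antipode axiom: `(1 ⊗ a)Δ(p) =
  -- (S(a₁)a₂ ⊗ a₃)Δ(p) = (S(a₁) ⊗ 1)Δ(a₂)Δ(p) = (S(a) ⊗ 1)Δ(p)`.
  set q : Finset G.Irr := e ∪ w (i, j) ∪ s.biUnion fun k => w (k, i) with hq
  have hqe : ∀ l, l ∉ q → G.counitBlock l = 0 := fun l hl => he l fun h => hl (by simp [hq, h])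
  have hqw : ∀ l, l ∉ q → G.comulBlock i j l = 0 := fun l hl =>
    hw (i, j) l fun h => hl (by simp [hq, h])
  have hqs : ∀ k ∈ s, ∀ l, l ∉ q → G.comulBlock k i l = 0 := fun k hk l hl =>
    hw (k, i) l fun h => hl (Finset.mem_union_right _ (Finset.mem_biUnion.mpr ⟨k, hk, h⟩))
  let B : ∀ k, G.Block k ⊗[ℂ] G.Block i →ₗ[ℂ] G.Block i := fun k =>
    LinearMap.mul' ℂ (G.Block i) ∘ₗ (G.antipodeBlock i k).rTensor (G.Block i)
  have hB : ∀ l, ∑ k ∈ s, B k ∘ₗ G.comulBlock k i l =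
      (G.counitBlock l).smulRight (1 : G.Block i) := fun l => by
    ext1 v
    rw [LinearMap.sum_apply]
    exact G.antipodeBlock_left hs (blockIncl G.dim l v)
  have hR : ∑ k ∈ s, (B k).rTensor (G.Block j) (∑ l ∈ q,
      (G.comulBlock k i l).rTensor (G.Block j) (G.comul a (l, j))) = 1 ⊗ₜ[ℂ] a j := by
    simp only [map_sum]
    rw [Finset.sum_comm, ← G.counitBlock_left hqe a j, TensorProduct.tmul_sum]
    refine Finset.sum_congr rfl fun l _ => ?_
    have h1 : ∀ k, (B k).rTensor (G.Block j)
        ((G.comulBlock k i l).rTensor (G.Block j) (G.comul a (l, j))) =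
        (B k ∘ₗ G.comulBlock k i l).rTensor (G.Block j) (G.comul a (l, j)) := fun k => by
      rw [LinearMap.rTensor_comp (G.Block j) (B k), LinearMap.comp_apply]
    simp only [h1]
    rw [sum_rTensor_apply, hB l]
    induction G.comul a (l, j) using TensorProduct.induction_on with
    | zero => simp
    | add x y hx hy => simp only [map_add, hx, hy, TensorProduct.tmul_add]
    | tmul x y =>
      rw [LinearMap.rTensor_tmul, LinearMap.rTensor_tmul, LinearMap.smulRight_apply,
        TensorProduct.lid_tmul, TensorProduct.smul_tmul]
  rw [← hR, Finset.sum_mul, hsum s subset_rfl, TensorProduct.sum_tmul, Finset.sum_mul]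
  refine Finset.sum_congr rfl fun k hk => ?_
  -- Here coassociativity is needed in the reverse direction, so that the last two legs become
  -- `Δ(a₂)`.
  rw [(LinearEquiv.eq_symm_apply _).mpr (G.comulBlock_coassoc (hqs k hk) hqw a),
    ← G.counitBlock_right hqe a k]
  simp only [map_sum, Finset.sum_mul, TensorProduct.sum_tmul]
  refine Finset.sum_congr rfl fun l _ => ?_
  induction G.comul a (k, l) using TensorProduct.induction_on with
  | zero => simp
  | add x y hx hy => simp only [map_add, add_mul, hx, hy, TensorProduct.add_tmul]
  | tmul z x =>
    have h4 : ∀ y : G.Block i ⊗[ℂ] G.Block j, (B k).rTensor (G.Block j)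
        ((TensorProduct.assoc ℂ (G.Block k) (G.Block i) (G.Block j)).symm (z ⊗ₜ[ℂ] y)) =
          (G.antipodeBlock i k z ⊗ₜ[ℂ] 1) * y := by
      intro y
      induction y using TensorProduct.induction_on with
      | zero => simp
      | add x y hx hy => simp only [TensorProduct.tmul_add, map_add, mul_add, hx, hy]
      | tmul x y => simp [B]
    have h5 : G.comulBlock i j l x * G.comul p (i, j) =
        G.counitBlock l x • G.comul p (i, j) := by
      change (G.comul (blockIncl G.dim l x) * G.comul p) (i, j) = _
      rw [← map_mul, hp, map_smul]
      rfl
    rw [LinearMap.lTensor_tmul, LinearMap.lTensor_tmul, h4, mul_assoc, h5,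
      TensorProduct.rid_tmul, map_smul, ← TensorProduct.smul_tmul', smul_mul_assoc, mul_smul_comm]

end DiscreteQuantumGroup

/-! ### Slice maps and modular automorphisms -/

section Slices

variable {A B : Type*} [Ring A] [Algebra ℂ A] [Ring B] [Algebra ℂ B]

/-- The slice map `id ⊗ φ`. -/
noncomputable def sliceRight (A : Type*) [Ring A] [Algebra ℂ A] (φ : B →ₗ[ℂ] ℂ) :
    A ⊗[ℂ] B →ₗ[ℂ] A :=
  (TensorProduct.rid ℂ A).toLinearMap ∘ₗ φ.lTensor A

/-- The slice map `φ ⊗ id`. -/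
noncomputable def sliceLeft (B : Type*) [Ring B] [Algebra ℂ B] (φ : A →ₗ[ℂ] ℂ) :
    A ⊗[ℂ] B →ₗ[ℂ] B :=
  (TensorProduct.lid ℂ B).toLinearMap ∘ₗ φ.rTensor B

@[simp]
theorem sliceRight_tmul (φ : B →ₗ[ℂ] ℂ) (a : A) (b : B) : sliceRight A φ (a ⊗ₜ b) = φ b • a := rfl

@[simp]
theorem sliceLeft_tmul (φ : A →ₗ[ℂ] ℂ) (a : A) (b : B) : sliceLeft B φ (a ⊗ₜ b) = φ a • b := rfl

theorem sliceRight_mul_tmul_one (φ : B →ₗ[ℂ] ℂ) (m : A ⊗[ℂ] B) (a : A) :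
    sliceRight A φ (m * (a ⊗ₜ 1)) = sliceRight A φ m * a := by
  induction m using TensorProduct.induction_on with
  | zero => simp
  | add x y hx hy => simp only [add_mul, map_add, hx, hy]
  | tmul x y => simp

theorem sliceRight_tmul_one_mul (φ : B →ₗ[ℂ] ℂ) (m : A ⊗[ℂ] B) (a : A) :
    sliceRight A φ ((a ⊗ₜ 1) * m) = a * sliceRight A φ m := by
  induction m using TensorProduct.induction_on with
  | zero => simp
  | add x y hx hy => simp only [mul_add, map_add, hx, hy]
  | tmul x y => simp

theorem sliceLeft_mul_one_tmul (φ : A →ₗ[ℂ] ℂ) (m : A ⊗[ℂ] B) (b : B) :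
    sliceLeft B φ (m * (1 ⊗ₜ b)) = sliceLeft B φ m * b := by
  induction m using TensorProduct.induction_on with
  | zero => simp
  | add x y hx hy => simp only [add_mul, map_add, hx, hy]
  | tmul x y => simp

theorem sliceLeft_one_tmul_mul (φ : A →ₗ[ℂ] ℂ) (m : A ⊗[ℂ] B) (b : B) :
    sliceLeft B φ ((1 ⊗ₜ b) * m) = b * sliceLeft B φ m := by
  induction m using TensorProduct.induction_on with
  | zero => simp
  | add x y hx hy => simp only [mul_add, map_add, hx, hy]
  | tmul x y => simp

/-- Moves a factor in the sliced leg from one side of `m` to the other, at the price of the modular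
automorphism. With `m` a component of `Δ(p)` this links the two antipode identities, which have
`Δ(p)` on opposite sides. -/
theorem sliceRight_modular {φ : B →ₗ[ℂ] ℂ} {b c : B} (h : ∀ y, φ (b * y) = φ (y * c))
    (m : A ⊗[ℂ] B) : sliceRight A φ ((1 ⊗ₜ b) * m) = sliceRight A φ (m * (1 ⊗ₜ c)) := by
  induction m using TensorProduct.induction_on with
  | zero => simp
  | add x y hx hy => simp only [mul_add, add_mul, map_add, hx, hy]
  | tmul x y => simp [h]

theorem sliceLeft_modular {φ : A →ₗ[ℂ] ℂ} {a c : A} (h : ∀ y, φ (a * y) = φ (y * c))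
    (m : A ⊗[ℂ] B) : sliceLeft B φ ((a ⊗ₜ 1) * m) = sliceLeft B φ (m * (c ⊗ₜ 1)) := by
  induction m using TensorProduct.induction_on with
  | zero => simp
  | add x y hx hy => simp only [mul_add, add_mul, map_add, hx, hy]
  | tmul x y => simp [h]

/-- A faithful positive functional on a finite dimensional algebra has a modular automorphism. -/
theorem exists_modular [StarRing A] [FiniteDimensional ℂ A] (φ : A →ₗ[ℂ] ℂ)
    (hφ : ∀ a, φ (star a * a) = 0 → a = 0) (a : A) : ∃ c, ∀ y, φ (a * y) = φ (y * c) := by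
  -- `T c` is the functional `y ↦ φ(yc)`. Evaluating at `star c` shows that `T` is injective, hence
  -- bijective by dimension, and `c` is the preimage of `y ↦ φ(ay)`.
  let T : A →ₗ[ℂ] Module.Dual ℂ A := (LinearMap.mul ℂ A).flip.compr₂ φ
  have hT : Function.Injective T := (injective_iff_map_eq_zero T).mpr fun c hc =>
    hφ c (congrArg (fun f : Module.Dual ℂ A => f (star c)) hc)
  obtain ⟨c, hc⟩ := (LinearMap.injective_iff_surjective_of_finrank_eq_finrank
    (Subspace.dual_finrank_eq (K := ℂ) (V := A)).symm).mp hT (φ ∘ₗ LinearMap.mulLeft ℂ a)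
  exact ⟨c, fun y => (congrArg (fun f : Module.Dual ℂ A => f y) hc).symm⟩

end Slices

/-! ### Unimodularity makes the antipode an involution compatible with the star -/

namespace DiscreteQuantumGroup

variable {G : DiscreteQuantumGroup.{u}}

/-- On a unimodular discrete quantum group, the antipode is involutive and *-preserving. -/
theorem IsUnimodular.antipode (hG : G.IsUnimodular) :
    (∀ f, G.antipode (G.antipode f) = f) ∧ ∀ f, G.antipode (star f) = star (G.antipode f) := by
  classical
  obtain ⟨φ, hl, hr⟩ := hG
  obtain ⟨o, hp, hp'⟩ := G.exists_trivial_block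
  set p := blockIncl G.dim o 1 with hpdef
  set c := φ o 1 with hcdef
  have hc : c ≠ 0 := fun h => by
    have h1 : (1 : G.Block o) = 0 := hl.faithful o 1 (by rw [star_one, one_mul]; exact h)
    have h2 := congrFun (congrFun h1 ⟨0, G.dim_pos o⟩) ⟨0, G.dim_pos o⟩
    simp at h2
  have hP : ∀ i j, star (G.comul p (i, j)) = G.comul p (i, j) := fun i j => by
    change (star (G.comul p)) (i, j) = _
    rw [← map_star, hpdef, star_blockIncl, star_one]
  have hI := fun a i j => G.comul_mul_tmul_one hp' a i j
  have hII := fun a i j => G.one_tmul_mul_comul hp a i j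
  -- Left invariance at `p`, that is `(id ⊗ φ)Δ(p) = c1`, as a finite sum; finiteness is the
  -- condition `(A ⊗ 1)Δ(A) ⊆ A ⊗ A`.
  obtain ⟨s, hs⟩ : ∃ s : G.Irr → Finset G.Irr,
      ∀ i, ∑ j ∈ s i, sliceRight (G.Block i) (φ j) (G.comul p (i, j)) = c • 1 :=
    ⟨fun i => (G.comul_finite_right o i).toFinset, fun i => by
      rw [← finsum_eq_sum_of_notMem fun j hj => ?_]
      · exact hl.left_invariant o 1 i
      · rw [Set.Finite.mem_toFinset, Set.mem_ofPred_eq, not_not] at hj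
        rw [hj, map_zero]⟩
  obtain ⟨t, ht⟩ : ∃ t : G.Irr → Finset G.Irr,
      ∀ j, ∑ i ∈ t j, sliceLeft (G.Block j) (φ i) (G.comul p (i, j)) = c • 1 :=
    ⟨fun j => (G.comul_finite_left o j).toFinset, fun j => by
      rw [← finsum_eq_sum_of_notMem fun i hi => ?_]
      · exact hr.right_invariant o 1 j
      · rw [Set.Finite.mem_toFinset, Set.mem_ofPred_eq, not_not] at hi
        rw [hi, map_zero]⟩
  -- As `Δ(p)` is self-adjoint, the adjoint of `(1 ⊗ a)Δ(p) = (S(a) ⊗ 1)Δ(p)` followed by the first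
  -- identity gives `Δ(p)(1 ⊗ a*) = Δ(p)(S(a)* ⊗ 1) = Δ(p)(1 ⊗ S(S(a)*))`. The slice by `φ` of
  -- `Δ(p)(1 ⊗ b)` in the first leg is `cb`, so the right-hand factors agree.
  have hstar : ∀ a, G.antipode (star (G.antipode a)) = star a := fun a => by
    funext j
    refine smul_right_injective _ hc ?_
    have key : ∀ i, G.comul p (i, j) * (1 ⊗ₜ[ℂ] star (a j)) =
        G.comul p (i, j) * (1 ⊗ₜ[ℂ] G.antipode (star (G.antipode a)) j) := fun i => by
      have h := congrArg star (hII a i j)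
      rw [star_mul, star_mul, hP, TensorProduct.star_tmul, TensorProduct.star_tmul, star_one,
        star_one] at h
      exact h.trans (hI (star (G.antipode a)) i j)
    have h1 : ∀ b : G.Block j, c • b =
        ∑ i ∈ t j, sliceLeft (G.Block j) (φ i) (G.comul p (i, j) * (1 ⊗ₜ[ℂ] b)) := fun b => by
      simp only [sliceLeft_mul_one_tmul]
      rw [← Finset.sum_mul, ht, smul_mul_assoc, one_mul]
    dsimp only
    rw [h1, h1]
    exact Finset.sum_congr rfl fun i _ => congrArg _ (key i).symm
  have hsurj : ∀ a, ∃ b, G.antipode b = a := fun a =>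
    ⟨star (G.antipode (star a)), by rw [hstar, star_star]⟩
  choose σ hσ using fun i => exists_modular (φ i) (hl.faithful i)
  -- Take `b` with `S(b) = σ(a)`. Then `cS(a) = (id ⊗ φ)((1 ⊗ a)Δ(p)) = (id ⊗ φ)(Δ(p)(1 ⊗ S(b))) =
  -- (id ⊗ φ)(Δ(p)(b ⊗ 1)) = cb`, so `S(a) = b` and `S²(a) = σ(a)`. Only left invariance enters.
  have hSS : ∀ a, G.antipode (G.antipode a) = fun i => σ i (a i) := fun a => by
    obtain ⟨b, hb⟩ := hsurj fun i => σ i (a i)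
    rw [← hb]
    congr 1
    funext i
    refine smul_right_injective _ hc ?_
    have h1 : c • G.antipode a i =
        ∑ j ∈ s i, sliceRight (G.Block i) (φ j) ((1 ⊗ₜ[ℂ] a j) * G.comul p (i, j)) := by
      simp only [hII, sliceRight_tmul_one_mul]
      rw [← Finset.mul_sum, hs, mul_smul_comm, mul_one]
    have h2 : c • b i = ∑ j ∈ s i, sliceRight (G.Block i) (φ j)
        (G.comul p (i, j) * (1 ⊗ₜ[ℂ] G.antipode b j)) := by
      simp only [← hI, sliceRight_mul_tmul_one]
      rw [← Finset.sum_mul, hs, smul_mul_assoc, one_mul]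
    dsimp only
    rw [h1, h2, hb]
    exact Finset.sum_congr rfl fun j _ => sliceRight_modular (hσ j (a j)) _
  -- Slicing in the other leg, by right invariance of the same `φ`: `cS(σ(S(e))) = (φ ⊗
  -- id)(Δ(p)(σ(S(e)) ⊗ 1)) = (φ ⊗ id)((S(e) ⊗ 1)Δ(p)) = (φ ⊗ id)((1 ⊗ e)Δ(p)) = ce`, and `σ(S(e)) =
  -- S³(e)`. Here unimodularity is decisive: one `σ` serves both Haar weights.
  have hS4 : ∀ a, G.antipode (G.antipode (G.antipode (G.antipode a))) = a := fun e => by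
    rw [hSS (G.antipode e)]
    funext j
    refine smul_right_injective _ hc ?_
    have h1 : c • G.antipode (fun i => σ i (G.antipode e i)) j =
        ∑ i ∈ t j, sliceLeft (G.Block j) (φ i)
          (G.comul p (i, j) * (σ i (G.antipode e i) ⊗ₜ[ℂ] 1)) := by
      have h := fun i => hI (fun i => σ i (G.antipode e i)) i j
      dsimp only at h
      simp only [h, sliceLeft_mul_one_tmul]
      rw [← Finset.sum_mul, ht, smul_mul_assoc, one_mul]
    have h2 : c • e j = ∑ i ∈ t j, sliceLeft (G.Block j) (φ i)
        ((G.antipode e i ⊗ₜ[ℂ] 1) * G.comul p (i, j)) := by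
      simp only [← hII, sliceLeft_one_tmul_mul]
      rw [← Finset.mul_sum, ht, mul_smul_comm, mul_one]
    dsimp only
    rw [h1, h2]
    exact Finset.sum_congr rfl fun i _ => (sliceLeft_modular (hσ i _) _).symm
  have hinv : ∀ a, G.antipode (G.antipode a) = a := fun a => by
    -- The element `y` lies in the `-1` eigenspace of `S² = σ`. Hence `φ(yy*) = φ(y*σ(y)) = -φ(y*y)`
    -- in each block; both values are nonnegative, so `φ(y*y) = 0`.
    set y := G.antipode (G.antipode a) - a with hy
    have hy1 : G.antipode (G.antipode y) = -y := by
      rw [hy, map_sub, map_sub, hS4, neg_sub]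
    rw [← sub_eq_zero, ← hy]
    funext i
    refine hl.faithful i _ ?_
    have h1 : σ i (y i) = -y i := by
      have := congrFun (hSS y) i
      rw [hy1] at this
      exact this.symm
    have h2 := hσ i (y i) (star (y i))
    rw [h1, mul_neg, map_neg] at h2
    have h3 := hl.nonneg i (star (y i))
    rw [star_star, h2] at h3
    exact le_antisymm (neg_nonneg.mp h3) (hl.nonneg i (y i))
  refine ⟨hinv, fun f => ?_⟩
  -- Apply `S` to `S(S(f)*) = f*` and cancel `S²`.
  have h := congrArg G.antipode (hstar f)
  rw [hinv] at h
  exact h.symm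

/-! ### Uniqueness of the unitary antipode -/

open scoped Matrix in
/-- A matrix commutes with a positive definite matrix if it commutes with its square. -/
theorem _root_.Matrix.PosDef.commute_of_sq {n : Type*} [Fintype n] [DecidableEq n]
    {F a : Matrix n n ℂ} (hF : F.PosDef) (h : F * F * a = a * (F * F)) : F * a = a * F := by
  set b := F * a - a * F with hb
  -- The commutator anticommutes with `F`, since `Fb + bF = F²a - aF²`. This replaces an appeal to
  -- the functional calculus for the square root.
  have h1 : F * b + b * F = 0 := by
    rw [hb, mul_sub, sub_mul, ← mul_assoc, h]
    noncomm_ring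
  -- By cyclicity this is the trace of `b*(Fb + bF)`. Both summands are traces of positive matrices,
  -- so `b*Fb = 0`.
  have h2 : (star b * F * b).trace + (b * F * star b).trace = 0 := by
    have h3 : (b * F * star b).trace = (star b * (b * F)).trace := Matrix.trace_mul_comm _ _
    rw [h3, ← Matrix.trace_add, mul_assoc, ← mul_add, h1, mul_zero, Matrix.trace_zero]
  have h4 : (star b * F * b).PosSemidef := hF.posSemidef.conjTranspose_mul_mul_same b
  have h5 : (b * F * star b).PosSemidef := hF.posSemidef.mul_mul_conjTranspose_same b
  have h6 : (star b * F * b).trace = 0 := by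
    refine le_antisymm ?_ h4.trace_nonneg
    rw [eq_neg_of_add_eq_zero_left h2]
    exact neg_nonpos.mpr h5.trace_nonneg
  have h7 : star b * F * b = 0 := h4.trace_eq_zero_iff.mp h6
  have h8 : b = 0 := by
    refine Matrix.toLin'.injective (LinearMap.ext fun v => ?_)
    by_contra hv
    -- If `bv ≠ 0` then `⟪bv, F bv⟫ > 0`, whereas it equals `⟪v, b*Fb v⟫ = 0`.
    have h9 := hF.dotProduct_mulVec_pos (x := b *ᵥ v) (by simpa using hv)
    have h10 : star (b *ᵥ v) ⬝ᵥ F *ᵥ b *ᵥ v = star v ⬝ᵥ (star b * F * b) *ᵥ v := by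
      rw [Matrix.star_mulVec, ← Matrix.dotProduct_mulVec, Matrix.mulVec_mulVec,
        Matrix.mulVec_mulVec, Matrix.star_eq_conjTranspose, mul_assoc]
    rw [h10, h7, Matrix.zero_mulVec, dotProduct_zero] at h9
    exact lt_irrefl _ h9
  exact sub_eq_zero.mp h8

/-- If the antipode is *-preserving, every unitary antipode is equal to it. -/
theorem IsUnitaryAntipode.eq_antipode {R : G.Fun →ₗ[ℂ] G.Fun} (hR : G.IsUnitaryAntipode R)
    (hS : ∀ f, G.antipode (star f) = star (G.antipode f)) : R = G.antipode := by
  obtain ⟨F, hF, hpol⟩ := hR.polar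
  have hF1 : F * F⁻¹ = 1 := funext fun i => Matrix.mul_nonsing_inv _ ((hF i).det_pos.ne'.isUnit)
  have hF2 : F⁻¹ * F = 1 := funext fun i => Matrix.nonsing_inv_mul _ ((hF i).det_pos.ne'.isUnit)
  have hFs : star F = F := funext fun i => (hF i).isHermitian
  have hFs' : star F⁻¹ = F⁻¹ := funext fun i => (hF i).isHermitian.inv
  have hinj : Function.Injective R := Function.LeftInverse.injective hR.involutive
  -- With `S = R ∘ Ad F` and both `S` and `R` *-preserving, `Ad F` preserves the star up to the
  -- injective `R`. Since `F` is self-adjoint, conjugating with the star turns `Ad F` into `Ad F⁻¹`.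
  -- So `F²` is central, and then `F` is.
  have h1 : ∀ f, F * f * F⁻¹ = F⁻¹ * f * F := fun f => by
    have h := hS (star f)
    rw [hpol, hpol, ← hR.map_star, star_star, star_mul, star_mul, star_star, hFs, hFs',
      ← mul_assoc] at h
    exact hinj h
  have h2 : ∀ f, F * F * f = f * (F * F) := fun f => by
    calc F * F * f = F * (F * f * F⁻¹) * F := by simp only [mul_assoc, hF2, mul_one]
      _ = F * (F⁻¹ * f * F) * F := by rw [h1]
      _ = F * F⁻¹ * f * (F * F) := by simp only [mul_assoc]
      _ = f * (F * F) := by rw [hF1, one_mul]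
  have h3 : ∀ f, F * f = f * F := fun f => funext fun i =>
    (hF i).commute_of_sq (congrFun (h2 f) i)
  refine LinearMap.ext fun f => ?_
  rw [hpol, h3, mul_assoc, hF1, mul_one]

/-- The scaling part of the polar decomposition is trivial: `F = 1` works. -/
theorem isUnitaryAntipode_antipode (hinv : ∀ f, G.antipode (G.antipode f) = f)
    (hS : ∀ f, G.antipode (star f) = star (G.antipode f)) : G.IsUnitaryAntipode G.antipode where
  map_mul := G.antipode_mul
  map_star := hS
  involutive := hinv
  polar := ⟨1, fun _ => Matrix.PosDef.one, fun f => by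
    have h : (1 : G.Fun)⁻¹ = 1 := funext fun _ => inv_one
    rw [h, mul_one, one_mul]⟩

end DiscreteQuantumGroup

/-! ### The duality of Hilbert spaces given by an antiunitary -/

section AntiunitaryPairing

theorem antiunitary_inner {H K : Type*} [NormedAddCommGroup H] [InnerProductSpace ℂ H]
    [NormedAddCommGroup K] [InnerProductSpace ℂ K] (J : H ≃ₗᵢ⋆[ℂ] K) (ξ η : H) :
    inner ℂ (J ξ) (J η) = inner ℂ η ξ :=
  ((ConjSpace.toConj H).symm.trans J : ConjSpace H ≃ₗᵢ[ℂ] K).inner_map_map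
    (ConjSpace.toConj H ξ) (ConjSpace.toConj H η)

variable {H K : Type*} [NormedAddCommGroup H] [InnerProductSpace ℂ H] [FiniteDimensional ℂ H]
  [NormedAddCommGroup K] [InnerProductSpace ℂ K] [FiniteDimensional ℂ K]

/-- The pairing `J ξ ⊗ η ↦ ⟪ξ, η⟫` given by an antiunitary `J`. -/
noncomputable def antiunitaryEv (J : H ≃ₗᵢ⋆[ℂ] K) : HTensor K H →L[ℂ] ℂ :=
  LinearMap.toContinuousLinearMap (E := HTensor K H) (TensorProduct.lift
    (LinearMap.mk₂ ℂ (fun (k : K) (h : H) => inner ℂ (J.symm k) h)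
      (fun k k' h => by rw [map_add, inner_add_left])
      (fun c k h => by rw [map_smulₛₗ, inner_smul_left]; simp)
      (fun k h h' => inner_add_right _ _ _)
      (fun c k h => inner_smul_right _ _ _)) : K ⊗[ℂ] H →ₗ[ℂ] ℂ)

theorem antiunitaryEv_tmul (J : H ≃ₗᵢ⋆[ℂ] K) (k : K) (h : H) :
    antiunitaryEv J (HTensor.tmul k h) = inner ℂ (J.symm k) h := rfl

/-- The vector `∑ i, e i ⊗ J (e i)` for an orthonormal basis `e`. -/
noncomputable def antiunitaryVec (J : H ≃ₗᵢ⋆[ℂ] K) : HTensor H K :=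
  ∑ i, HTensor.tmul (stdOrthonormalBasis ℂ H i) (J (stdOrthonormalBasis ℂ H i))

/-- The map `1 ↦ ∑ i, e i ⊗ J (e i)`. -/
noncomputable def antiunitaryCoev (J : H ≃ₗᵢ⋆[ℂ] K) : ℂ →L[ℂ] HTensor H K :=
  ContinuousLinearMap.toSpanSingleton ℂ (antiunitaryVec J)

/-- Adjoints of intertwiners are intertwiners, so this reduces equivariance of coevaluations to that
of evaluations. The inverse antiunitary appears because the evaluation must be defined on `HTensor H
K`. -/
theorem antiunitaryCoev_eq_adjoint [CompleteSpace H] [CompleteSpace K] (J : H ≃ₗᵢ⋆[ℂ] K) :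
    antiunitaryCoev J = ContinuousLinearMap.adjoint (antiunitaryEv J.symm) := by
  rw [ContinuousLinearMap.eq_adjoint_iff]
  intro c y
  have h : innerSL ℂ (antiunitaryVec J) = antiunitaryEv J.symm := by
    refine HTensor.ext fun ξ k => ?_
    obtain ⟨η, rfl⟩ := J.surjective k
    rw [innerSL_apply_apply, antiunitaryEv_tmul, antiunitaryVec, sum_inner]
    change _ = inner ℂ (J ξ) (J η)
    rw [antiunitary_inner, ← (stdOrthonormalBasis ℂ H).sum_inner_mul_inner]
    refine Finset.sum_congr rfl fun i _ => ?_
    refine (TensorProduct.inner_tmul _ _ _ _ _).trans ?_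
    rw [antiunitary_inner, mul_comm]
  change inner ℂ (c • antiunitaryVec J) y = _
  rw [inner_smul_left, ← h, innerSL_apply_apply, RCLike.inner_apply,
    mul_comm]

/-- The composite sends `Jξ` to `∑ ⟪ξ, e i⟫ J(e i)`, which by antilinearity is `J(∑ ⟪e i, ξ⟫ e i) =
Jξ`. The unit isomorphisms on the right give the form of the equation required by `ExactPairing`. -/
theorem antiunitary_zigzag_right (J : H ≃ₗᵢ⋆[ℂ] K) :
    HTensor.map (antiunitaryEv J) (.id ℂ K) ∘L
      ((HTensor.assoc K H K).symm : HTensor K (HTensor H K) →L[ℂ] HTensor (HTensor K H) K) ∘L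
        HTensor.map (.id ℂ K) (antiunitaryCoev J) =
    ((HTensor.lid K).symm : K →L[ℂ] HTensor ℂ K) ∘L (HTensor.rid K : HTensor K ℂ →L[ℂ] K) := by
  refine HTensor.ext fun k c => ?_
  obtain ⟨ξ, rfl⟩ := J.surjective k
  set e := stdOrthonormalBasis ℂ H with he
  have h1 : HTensor.tmul (J ξ) (antiunitaryCoev J c) =
      ∑ i, c • HTensor.tmul (J ξ) (HTensor.tmul (e i) (J (e i))) := by
    rw [← Finset.smul_sum]
    exact (TensorProduct.tmul_smul c (J ξ) (antiunitaryVec J)).trans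
      (congrArg (c • ·) (TensorProduct.tmul_sum (J ξ) _ _))
  have h2 : ∀ i, HTensor.tmul (inner ℂ ξ (e i)) (J (e i)) =
      (HTensor.lid K).symm (J (inner ℂ (e i) ξ • e i)) := fun i => by
    rw [map_smulₛₗ, inner_conj_symm, HTensor.lid_symm_apply, HTensor.tmul_smul', smul_eq_mul,
      mul_one]
  change HTensor.map (antiunitaryEv J) (.id ℂ K) ((HTensor.assoc K H K).symm
    (HTensor.tmul (J ξ) (antiunitaryCoev J c))) = (HTensor.lid K).symm (c • J ξ)
  rw [h1, map_sum, map_sum]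
  conv_rhs => rw [← e.sum_repr' ξ]
  simp only [map_smul, HTensor.assoc_symm_tmul, HTensor.map_tmul, antiunitaryEv_tmul,
    LinearIsometryEquiv.symm_apply_apply, ContinuousLinearMap.id_apply, h2, ← Finset.smul_sum,
    ← map_sum]

/-- Here the composite sends `ξ` directly to its expansion `∑ ⟪e i, ξ⟫ e i`. -/
theorem antiunitary_zigzag_left (J : H ≃ₗᵢ⋆[ℂ] K) :
    HTensor.map (.id ℂ H) (antiunitaryEv J) ∘L
      (HTensor.assoc H K H : HTensor (HTensor H K) H →L[ℂ] HTensor H (HTensor K H)) ∘L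
        HTensor.map (antiunitaryCoev J) (.id ℂ H) =
    ((HTensor.rid H).symm : H →L[ℂ] HTensor H ℂ) ∘L (HTensor.lid H : HTensor ℂ H →L[ℂ] H) := by
  refine HTensor.ext fun c ξ => ?_
  set e := stdOrthonormalBasis ℂ H with he
  have h1 : HTensor.tmul (antiunitaryCoev J c) ξ =
      ∑ i, c • HTensor.tmul (HTensor.tmul (e i) (J (e i))) ξ := by
    rw [← Finset.smul_sum]
    exact (TensorProduct.smul_tmul' c (antiunitaryVec J) ξ).symm.trans
      (congrArg (c • ·) (TensorProduct.sum_tmul _ _ ξ))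
  have h2 : ∀ i, HTensor.tmul (e i) (inner ℂ (e i) ξ) =
      (HTensor.rid H).symm (inner ℂ (e i) ξ • e i) := fun i => by
    rw [HTensor.rid_symm_apply, ← HTensor.tmul_smul', smul_eq_mul, mul_one]
  change HTensor.map (.id ℂ H) (antiunitaryEv J) ((HTensor.assoc H K H)
    (HTensor.tmul (antiunitaryCoev J c) ξ)) = (HTensor.rid H).symm (c • ξ)
  rw [h1, map_sum, map_sum]
  conv_rhs => rw [← e.sum_repr' ξ]
  simp only [map_smul, HTensor.assoc_tmul, HTensor.map_tmul, antiunitaryEv_tmul,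
    LinearIsometryEquiv.symm_apply_apply, ContinuousLinearMap.id_apply, h2, ← Finset.smul_sum,
    map_sum]

end AntiunitaryPairing

/-! ### Equivariance of the evaluation under the functions on `G` -/

section Rigidity

open scoped Matrix.Norms.L2Operator

variable {G : DiscreteQuantumGroup.{u}} {X : Type v} {H K : Type*}
  [NormedAddCommGroup H] [InnerProductSpace ℂ H] [FiniteDimensional ℂ H] [CompleteSpace H]
  [NormedAddCommGroup K] [InnerProductSpace ℂ K] [FiniteDimensional ℂ K] [CompleteSpace K]

/-- On `Jξ ⊗ η` the element `a ⊗ b` produces `⟪φ(S(a*))T'ξ, φ(b)η⟫ = ⟪T'ξ, φ(S(a)b)η⟫`, and summing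
over `Δ(f)` the axiom `m(S ⊗ id)Δ(f) = ε(f)1` leaves `ε(f)⟪T'ξ, η⟫`. The operators `T` and `T'` make
room for the projections of the quantum permutations. -/
theorem NormalRep.antiunitaryEv_intertwines {φ : NormalRep G H} {ψ : NormalRep G K}
    (hS : ∀ f, G.antipode (star f) = star (G.antipode f)) (hone : G.antipode 1 = 1)
    {J : H ≃ₗᵢ⋆[ℂ] K} {T : K →L[ℂ] K} {T' : H →L[ℂ] H}
    (hT : ∀ f ξ, T (ψ.hom f (J ξ)) = J (φ.hom (G.antipode (star f)) (T' ξ))) :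
    (ψ.mul φ).Intertwines (counit G) (antiunitaryEv J ∘L HTensor.map T 1) := fun f => by
  classical
  obtain ⟨s₀, hs₀, -⟩ := ψ.pou.2
  obtain ⟨t, ht, hsum⟩ := φ.pou.2
  choose w hw using fun k => G.exists_antipodeBlock k
  -- Besides the blocks seen by `ψ`, this contains every block from which the antipode reaches a
  -- block in `t`, so the antipode axiom can be summed over `s`.
  set s := s₀ ∪ t.biUnion w with hsdef
  have hs : ∀ i, i ∉ s → ψ.block i 1 = 0 := fun i hi =>
    hs₀ i fun h => hi (Finset.mem_union_left _ h)
  have hA : ∀ j ∈ t, ∀ i, i ∉ s → G.antipodeBlock j i = 0 := fun j hj i hi =>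
    (hw j).1 i fun h => hi (Finset.mem_union_right _ (Finset.mem_biUnion.mpr ⟨j, hj, h⟩))
  have key : ∀ (i j : G.Irr) (x : G.Block i ⊗[ℂ] G.Block j) (ξ η : H),
      antiunitaryEv J (HTensor.map T 1 (ψ.pairBlock φ (i, j) x (HTensor.tmul (J ξ) η))) =
      inner ℂ (T' ξ) (φ.block j (LinearMap.mul' ℂ (G.Block j)
        ((G.antipodeBlock j i).rTensor (G.Block j) x)) η) := fun i j x ξ η => by
    induction x using TensorProduct.induction_on with
    | zero => simp
    | add x y hx hy =>
      simp only [map_add, _root_.add_apply, hx, hy, inner_add_right]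
    | tmul a b =>
      rw [pairBlock_tmul, HTensor.map_tmul, HTensor.map_tmul, antiunitaryEv_tmul, block_apply, hT,
        LinearIsometryEquiv.symm_apply_apply, LinearMap.rTensor_tmul, LinearMap.mul'_apply, hS,
        map_star]
      have h1 : φ.block j (G.antipodeBlock j i a * b) =
          φ.hom (G.antipode (blockIncl G.dim i a)) * φ.block j b := by
        rw [← tau_one_mul j b, ← mul_assoc, hom_mul_block, ← map_mul]
        rfl
      rw [h1]
      exact ContinuousLinearMap.adjoint_inner_left _ _ _
  -- The case `f = 1` of `hT`; it identifies `ev(T Jξ ⊗ η)` with `⟪T'ξ, η⟫`.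
  have hT1 : ∀ ξ, T (J ξ) = J (T' ξ) := fun ξ => by
    have h := hT 1 ξ
    rw [star_one, hone, map_one, map_one] at h
    exact h
  refine HTensor.ext fun k η => ?_
  obtain ⟨ξ, rfl⟩ := J.surjective k
  rw [mul_hom, box_eq_sum ψ φ _ hs ht]
  simp only [ContinuousLinearMap.comp_apply, _root_.sum_apply, map_sum]
  rw [Finset.sum_product_right]
  simp only [key]
  rw [counit_hom_apply, HTensor.map_tmul, antiunitaryEv_tmul, hT1,
    LinearIsometryEquiv.symm_apply_apply]
  have h2 : ∀ j ∈ t, ∑ i ∈ s, inner ℂ (T' ξ) (φ.block j (LinearMap.mul' ℂ (G.Block j)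
        ((G.antipodeBlock j i).rTensor (G.Block j) (G.comul f (i, j)))) η) =
      G.counit f * inner ℂ (T' ξ) (φ.block j 1 η) := fun j hj => by
    rw [← inner_sum, ← _root_.sum_apply, ← map_sum, G.antipodeBlock_left (hA j hj), map_smul,
      _root_.smul_apply, inner_smul_right]
  rw [Finset.sum_congr rfl h2, ← Finset.mul_sum, ← inner_sum, ← _root_.sum_apply, hsum]

/-! ### Conjugate pairs of free wreath corepresentations -/

namespace WreathCorep

theorem Intertwines.adjoint {H K : Type*} [NormedAddCommGroup H] [InnerProductSpace ℂ H]
    [CompleteSpace H] [NormedAddCommGroup K] [InnerProductSpace ℂ K] [CompleteSpace K]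
    {π : WreathCorep G X H} {ρ : WreathCorep G X K} {T : H →L[ℂ] K} (h : π.Intertwines ρ T) :
    ρ.Intertwines π (ContinuousLinearMap.adjoint T) where
  rep x f := by
    have h1 := congrArg ContinuousLinearMap.adjoint (h.rep x (star f))
    rw [ContinuousLinearMap.adjoint_comp, ContinuousLinearMap.adjoint_comp, map_star (π.rep x),
      map_star (ρ.rep x), ContinuousLinearMap.star_eq_adjoint, ContinuousLinearMap.star_eq_adjoint,
      ContinuousLinearMap.adjoint_adjoint, ContinuousLinearMap.adjoint_adjoint] at h1
    exact h1.symm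
  perm x y := by
    have h1 := congrArg ContinuousLinearMap.adjoint (h.perm x y)
    rw [ContinuousLinearMap.adjoint_comp, ContinuousLinearMap.adjoint_comp,
      ← ContinuousLinearMap.star_eq_adjoint (π.perm.u x y),
      ← ContinuousLinearMap.star_eq_adjoint (ρ.perm.u x y),
      (π.perm.isProj x y).isSelfAdjoint.star_eq, (ρ.perm.isProj x y).isSelfAdjoint.star_eq] at h1
    exact h1.symm

/-- The antiunitary `J` identifies `ρ` with the conjugate of `π`. -/
structure IsConjugate (π : WreathCorep G X H) (ρ : WreathCorep G X K) (J : H ≃ₗᵢ⋆[ℂ] K) :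
    Prop where
  rep : ∀ x y f ξ, (ρ.ext x).hom f (ρ.perm.u x y (J ξ)) =
    J ((π.ext y).hom (G.antipode (star f)) (π.perm.u y x ξ))
  perm : ∀ x y ξ, ρ.perm.u x y (J ξ) = J (π.perm.u y x ξ)

variable {π : WreathCorep G X H} {ρ : WreathCorep G X K} {J : H ≃ₗᵢ⋆[ℂ] K}

/-- The defining relation carries a single projection instead of the sum over `y`, so exchanging `π`
and `ρ` only exchanges `x` and `y` and replaces `f` by `S(f*)`. As `S` is involutive and
*-preserving, `f ↦ S(f*)` is an involution. -/
theorem IsConjugate.symm (h : π.IsConjugate ρ J) (hinv : ∀ f, G.antipode (G.antipode f) = f)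
    (hS : ∀ f, G.antipode (star f) = star (G.antipode f)) : ρ.IsConjugate π J.symm where
  rep x y f k := by
    obtain ⟨ξ, rfl⟩ := J.surjective k
    rw [h.rep, LinearIsometryEquiv.symm_apply_apply, LinearIsometryEquiv.symm_apply_apply, ← hS,
      star_star, hinv]
  perm x y k := by
    obtain ⟨ξ, rfl⟩ := J.surjective k
    rw [h.perm, LinearIsometryEquiv.symm_apply_apply, LinearIsometryEquiv.symm_apply_apply]

theorem IsConjugate.ev_intertwines (h : π.IsConjugate ρ J) (hone : G.antipode 1 = 1)
    (hS : ∀ f, G.antipode (star f) = star (G.antipode f)) :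
    (ρ.tensor π).Intertwines (unit G X) (antiunitaryEv J) := by
  refine intertwines_of_ext (fun x => ?_) (fun x y => ?_)
  · rw [tensor_ext, unit_ext]
    refine NormalRep.intertwines_of_pou (P := fun y => HTensor.map (ρ.perm.u x y) (1 : H →L[ℂ] H))
      (ρ.perm.row_pou x).map_left (θ := fun y => (ρ.ext x).mul (π.ext y))
      (fun y => ρ.tensorRep_intertwines π x y (NormalRep.Intertwines.one _)) (fun y => ?_)
    -- On the range of `ρ^X_{xy} ⊗ 1` the tensor product is simply `(ρ^G_x ⊗ π^G_y)Δ`. Conjugation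
    -- by `J` turns the projection into `π^X_{yx}`.
    refine NormalRep.antiunitaryEv_intertwines hS hone (T' := π.perm.u y x) fun f ξ => ?_
    rw [← h.rep]
    exact congrArg (fun A : K →L[ℂ] K => A (J ξ)) (ρ.ext_comm x y f).symm
  · refine (ρ.perm.row_pou x).map_left.ext_comp (M := ℂ) fun z => ?_
    have h1 := ρ.perm.tensorU_mul_row π.perm x y z
    change (ρ.tensor π).perm.u x y ∘L HTensor.map (ρ.perm.u x z) 1 = _ at h1
    rw [ContinuousLinearMap.comp_assoc, h1]
    refine HTensor.ext fun k η => ?_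
    obtain ⟨ξ, rfl⟩ := J.surjective k
    -- Moving the self-adjoint projection across the inner product gives `π^X_{zx}π^X_{zy}`, which
    -- is `π^X_{zx}` for `x = y` and zero otherwise: the entries `δ_{xy}` of the unit object.
    have h2 : inner ℂ (π.perm.u z x ξ) (π.perm.u z y η) =
        inner ℂ ξ ((π.perm.u z x * π.perm.u z y) η) := by
      conv_lhs => rw [← (π.perm.isProj z x).isSelfAdjoint.star_eq]
      exact ContinuousLinearMap.adjoint_inner_left _ _ _
    have h3 : inner ℂ (π.perm.u z x ξ) η = inner ℂ ξ (π.perm.u z x η) := by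
      conv_lhs => rw [← (π.perm.isProj z x).isSelfAdjoint.star_eq]
      exact ContinuousLinearMap.adjoint_inner_left _ _ _
    simp only [ContinuousLinearMap.comp_apply, HTensor.map_tmul, antiunitaryEv_tmul, h.perm,
      LinearIsometryEquiv.symm_apply_apply, h2]
    by_cases hxy : x = y
    · subst hxy
      rw [trivial_diag, (π.perm.isProj z x).isIdempotentElem.eq]
      exact h3.symm
    · rw [trivial_row x y hxy, π.perm.row_orth z x y hxy]
      exact inner_zero_right _

/-- Cutting the sum that defines `π̄^G_x` down by one projection leaves a single summand. -/
theorem contragredient_isConjugate (π : WreathCorep G X H)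
    (hR : G.IsUnitaryAntipode G.antipode) :
    π.IsConjugate (π.contragredient hR) (ConjSpace.toConj H) where
  rep x y f ξ := by
    have h := NormalRep.glueProj_mul (fun y => (π.ext y).conj hR)
      (fun y => ConjSpace.bar (π.perm.u y x)) (ConjSpace.pou_bar (π.perm.col_pou x))
      (fun y => ConjSpace.isStarProjection_bar (π.perm.isProj y x)) (π.conj_comm hR x) f y
    have h1 : (π.contragredient hR).ext x = π.contragredientRep hR x := ofNormal_ext _ _ _ x
    rw [h1]
    exact congrArg (fun A : ConjSpace H →L[ℂ] ConjSpace H => A (ConjSpace.toConj H ξ)) h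
  perm _ _ _ := rfl

end WreathCorep

/-! ### Exact pairings in the category -/

namespace FreeWreath

/-- Conjugate objects are dual to each other. -/
noncomputable abbrev exactPairing {π ρ : FreeWreath G X} {J : π.space ≃ₗᵢ⋆[ℂ] ρ.space}
    (h : π.corep.IsConjugate ρ.corep J) (hR : G.IsUnitaryAntipode G.antipode) :
    ExactPairing π ρ where
  coevaluation' := ⟨antiunitaryCoev J, by
    -- The coevaluation is the adjoint of the evaluation `π ⊗ ρ → 1` belonging to the reversed
    -- conjugate pair with antiunitary `J⁻¹`.
    rw [antiunitaryCoev_eq_adjoint]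
    exact ((h.symm hR.involutive hR.map_star).ev_intertwines hR.map_one hR.map_star).adjoint⟩
  evaluation' := ⟨antiunitaryEv J, h.ev_intertwines hR.map_one hR.map_star⟩
  coevaluation_evaluation' := hom_ext (antiunitary_zigzag_right J)
  evaluation_coevaluation' := hom_ext (antiunitary_zigzag_left J)

end FreeWreath

end Rigidity

/-- Every finite dimensional `X`-free wreath corepresentation of a unimodular discrete quantum group
is dualisable, with dual its contragredient, and the category of these is rigid. The first
clause records that the unitary antipode, on which the contragredient depends, is well defined. -/
theorem mainTheorem12 (G : DiscreteQuantumGroup.{u}) (hG : G.IsUnimodular) (X : Type v) :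
    (∃! R : G.Fun →ₗ[ℂ] G.Fun, G.IsUnitaryAntipode R) ∧
    (∀ (R : G.Fun →ₗ[ℂ] G.Fun) (hR : G.IsUnitaryAntipode R) (π : FreeWreath G X),
      Nonempty (ExactPairing π (π.contragredient hR)) ∧
      Nonempty (ExactPairing (π.contragredient hR) π)) ∧
    Nonempty (RigidCategory (FreeWreath G X)) := by
  obtain ⟨hinv, hS⟩ := hG.antipode
  have hA := DiscreteQuantumGroup.isUnitaryAntipode_antipode hinv hS
  have hpair : ∀ (R : G.Fun →ₗ[ℂ] G.Fun) (hR : G.IsUnitaryAntipode R) (π : FreeWreath G X),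
      Nonempty (ExactPairing π (π.contragredient hR)) ∧
      Nonempty (ExactPairing (π.contragredient hR) π) := fun R hR π => by
    -- Uniqueness replaces an arbitrary unitary antipode by `S` itself, for which the antipode
    -- axioms are available.
    obtain rfl := hR.eq_antipode hS
    have h := π.corep.contragredient_isConjugate hR
    exact ⟨⟨FreeWreath.exactPairing (ρ := π.contragredient hR) h hR⟩,
      ⟨FreeWreath.exactPairing (π := π.contragredient hR) (h.symm hinv hS) hR⟩⟩
  refine ⟨⟨_, hA, fun R hR => hR.eq_antipode hS⟩, hpair, ⟨?_⟩⟩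
  -- The contragredient serves on both sides: the pairing of `π` with `π̄` makes it a right dual,
  -- the pairing of `π̄` with `π` a left dual.
  exact
    { rightDual := fun π =>
        { rightDual := π.contragredient hA
          exact := (hpair _ hA π).1.some }
      leftDual := fun π =>
        { leftDual := π.contragredient hA
          exact := (hpair _ hA π).2.some } }
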